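/- Fix a universal prefix-free oracle Turing machine $U$. For an oracle $A\subseteq\mathbb{N}$ and a rational vector $p$ (encoded as a binary string in a standard way), let $K^A(p)$ be the length of a shortest program from which $U$ with oracle $A$ (and empty side information) outputs $p$, and write $K=K^{\emptyset}$. For $x\in\mathbb{R}^m$ and $r\in\mathbb{N}$ let \[K^A_r(x)=\min\{K^A(p):p\in\mathbb{Q}^m,\ \|p-x\|<2^{-r}\},\qquad K_r(x)=K^{\emptyset}_r(x).\] For $e\in\mathbb{R}^n$ let $K^{A,e}_r$ denote $K^{B}_r$, where the oracle $B$ is the join of $A$ with a set $A_e$ that encodes the binary expansions of the coordinates of $e$ in a standard way. Let $B_1(z)$ be the open unit ball around $z$, and let $\log=\log_2$. Then for every $n\in\mathbb{N}$ and every $z\in\mathbb{R}^n$ there is a constant $C$, depending only on $z$ (and on $n$ and $U$), such that the following holds. Suppose that $e\in S^{n-1}$, $r\in\mathbb{N}$, $\delta\in\mathbb{R}$ with $\delta>0$, and $\varepsilon,\eta\in\mathbb{Q}$ with $\varepsilon,\eta>0$ satisfy $r\ge\log(2\|z\|+5)+1$ and (i) $K_r(z)\le(\eta+\varepsilon)r$;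 (ii) for every $w\in B_1(z)$ with $w\neq z$ and $e\cdot w=e\cdot z$, if $t=-\log\|z-w\|\in(0,r]$, then $K_r(w)\ge(\eta-\varepsilon)r+\delta\,(r-t)$. Then for every oracle set $A\subseteq\mathbb{N}$, \[K^{A,e}_r(e\cdot z)\ \ge\ K^{A,e}_r(z)-\frac{n\varepsilon}{\delta}\,r-K(\varepsilon)-K(\eta)-C\log r .\] -/

import Mathlib

namespace PointComplexity

/-- Programs for oracle computation on natural numbers: one constructor for each clause in the
inductive definition of the functions that are partial recursive in an oracle
(compare `Nat.RecursiveIn`). -/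
inductive OracleCode : Type
  | zero : OracleCode
  | succ : OracleCode
  | left : OracleCode
  | right : OracleCode
  | oracle : OracleCode
  | pair : OracleCode → OracleCode → OracleCode
  | comp : OracleCode → OracleCode → OracleCode
  | prec : OracleCode → OracleCode → OracleCode
  | rfind : OracleCode → OracleCode

open Classical in
/-- The partial function computed by a program when its oracle is the set `A ⊆ ℕ`; the
instruction `oracle` returns the value of the characteristic function of `A`. -/
noncomputable def OracleCode.eval (A : Set ℕ) : OracleCode → ℕ →. ℕ
  | OracleCode.zero => fun _ => Part.some 0
  | OracleCode.succ => fun n => Part.some (n + 1)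
  | OracleCode.left => fun n => Part.some (Nat.unpair n).1
  | OracleCode.right => fun n => Part.some (Nat.unpair n).2
  | OracleCode.oracle => fun n => Part.some (if n ∈ A then 1 else 0)
  | OracleCode.pair f g => fun n => Nat.pair <$> OracleCode.eval A f n <*> OracleCode.eval A g n
  | OracleCode.comp f g => fun n => OracleCode.eval A g n >>= OracleCode.eval A f
  | OracleCode.prec f g => Nat.unpaired fun a n =>
      n.rec (OracleCode.eval A f a) fun y IH => do
        let i ← IH
        OracleCode.eval A g (Nat.pair a (Nat.pair y i))
  | OracleCode.rfind f => fun a =>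
      Nat.rfind fun n => (fun m => decide (m = 0)) <$> OracleCode.eval A f (Nat.pair a n)

/-- The input-output behaviour of an oracle machine: `M A π τ` is the output, if there is one, of
`M` with oracle `A` on program `π` and side information `τ`. -/
abbrev OracleMachine : Type := Set ℕ → List Bool → List Bool →. List Bool

/-- `M` is computed, uniformly in the oracle, by one program. -/
def OracleMachine.IsComputable (M : OracleMachine) : Prop :=
  ∃ c : OracleCode, ∀ (A : Set ℕ) (π τ : List Bool),
    c.eval A (Nat.pair (Encodable.encode π) (Encodable.encode τ)) =
      (M A π τ).map Encodable.encode

/-- For every oracle and every side information, no program on which `M` halts is a proper prefix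
of another one. -/
def OracleMachine.IsPrefixFree (M : OracleMachine) : Prop :=
  ∀ (A : Set ℕ) (τ π π' : List Bool),
    (M A π τ).Dom → (M A π' τ).Dom → π <+: π' → π = π'

/-- `U` is a universal prefix-free oracle machine: it is a prefix-free oracle machine, and it
simulates every prefix-free oracle machine `M` with programs that are longer by at most a constant
depending only on `M`. -/
structure OracleMachine.IsUniversal (U : OracleMachine) : Prop where
  isComputable : U.IsComputable
  isPrefixFree : U.IsPrefixFree
  simulates : ∀ M : OracleMachine, M.IsComputable → M.IsPrefixFree →
    ∃ c : ℕ, ∀ (A : Set ℕ) (π τ σ : List Bool), σ ∈ M A π τ →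
      ∃ π' : List Bool, σ ∈ U A π' τ ∧ π'.length ≤ π.length + c

/-- `K^A(σ ∣ τ)`, the least length of a program for `σ` given `τ` (for universal `U` there always
is such a program). -/
noncomputable def condK (U : OracleMachine) (A : Set ℕ) (σ τ : List Bool) : ℕ :=
  sInf {l : ℕ | ∃ π : List Bool, π.length = l ∧ σ ∈ U A π τ}

/-- `K^A(σ) = K^A(σ ∣ λ)` with `λ` the empty string. -/
noncomputable def strK (U : OracleMachine) (A : Set ℕ) (σ : List Bool) : ℕ :=
  condK U A σ []

/-- A code of a rational number: the pair of its numerator and denominator in lowest terms. -/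
def ratCode (q : ℚ) : ℕ := Nat.pair (Encodable.encode q.num) q.den

/-- A rational vector as a binary string: the binary digits of a code of the list of its
entries. -/
def ratVecString {m : ℕ} (p : Fin m → ℚ) : List Bool :=
  Nat.bits (Encodable.encode (List.ofFn fun i => ratCode (p i)))

/-- `K^A(p)` for a rational vector `p`. -/
noncomputable def ratVecK (U : OracleMachine) (A : Set ℕ) {m : ℕ} (p : Fin m → ℚ) : ℕ :=
  strK U A (ratVecString p)

/-- `K^A(q)` for a rational number `q`, regarded as a vector of length one. -/
noncomputable def ratK (U : OracleMachine) (A : Set ℕ) (q : ℚ) : ℕ :=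
  ratVecK U A ![q]

/-- A rational vector as a point of Euclidean space. -/
noncomputable def ratPoint {m : ℕ} (p : Fin m → ℚ) : EuclideanSpace ℝ (Fin m) :=
  WithLp.toLp 2 fun i => (p i : ℝ)

/-- `K^A_r(x)`, the complexity of the point `x` at precision `r`: the least complexity of a rational
point in the open ball of radius `2⁻ʳ` around `x`. -/
noncomputable def pointK (U : OracleMachine) (A : Set ℕ) (r : ℕ) {m : ℕ}
    (x : EuclideanSpace ℝ (Fin m)) : ℕ :=
  sInf {l : ℕ | ∃ p : Fin m → ℚ,
    ratPoint p ∈ Metric.ball x ((2 : ℝ) ^ (-(r : ℤ))) ∧ ratVecK U A p = l}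

/-- `K^A_r(x)` for a real number `x`, regarded as a point of one-dimensional Euclidean space. -/
noncomputable def realK (U : OracleMachine) (A : Set ℕ) (r : ℕ) (x : ℝ) : ℕ :=
  pointK U A r (!₂[x] : EuclideanSpace ℝ (Fin 1))

/-- The oracle set `A_y` that encodes the binary expansions of the coordinates of `y`: for each
coordinate `y i` it records the integer part, and those `k ≥ 1` for which the `k`-th binary digit
of the fractional part (that is, the parity of `⌊2ᵏ y i⌋`) is `1`. -/
def pointOracle {m : ℕ} (y : EuclideanSpace ℝ (Fin m)) : Set ℕ :=
  {a : ℕ | ∃ i : Fin m,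
    a = Nat.pair i (Nat.pair 0 (Encodable.encode ⌊y i⌋)) ∨
    ∃ k : ℕ, 1 ≤ k ∧ a = Nat.pair i (Nat.pair k 0) ∧ Odd ⌊(2 : ℝ) ^ k * y i⌋}

/-- The oracle that gives access to both `A` (at even places) and `B` (at odd places). -/
def joinOracle (A B : Set ℕ) : Set ℕ :=
  {a : ℕ | (∃ k ∈ A, a = 2 * k) ∨ ∃ k ∈ B, a = 2 * k + 1}

end PointComplexity

open PointComplexity

/-! Let D be the difference between the complexities of z and of e·z at precision r relative to A
and e, let k = K_r(z), and neglect terms of order log r. The grid points near z whose inner product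
with e agrees with e·z up to O(2^(-r)) form a tube. From an approximation of e·z and the oracle for
e a machine can compute the tube; it then enumerates the grid points produced by programs of length
at most k, keeps those in the tube, and is told the index of the one next to z. Hence D ≤ log N,
where N is the number of points kept (`exists_ratVecK_le_of_inTube`). Since a tube is thin in one
direction, log N ≤ (n - 1)r (`card_tube_le`).

The decisive step turns a large N into a simple point of the slice through z, with no oracle. At
this resolution there are only 2^(O(r)) tubes, and at most 2^(k+1) points are ever enumerated. A
selection with exponential weights, made online because one never knows whether the enumeration is
complete, picks at most 2^(k+2-x) points and hits every tube that receives 2^x · O(r) of them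
(`length_picks_mul_le`, `exists_mem_picks`). The selection treats all tubes at once and does not
know e, so a picked point has unrelativized complexity at most k - x (`exists_simple_of_many`). With
2^x close to N / O(r), the tube around the slice contains a picked point; moved into the slice and
away from z, it becomes a point w with D ≤ log N ≤ k - K_r(w). This is `exists_projection_bounds`;
by (i) and (ii) it gives D ≤ 2εr.

Three more bounds hold: D ≤ (n - 1)r; D ≤ K_r(z) ≤ (η + ε)r; and, as every slice contains a point at
distance at least 1/2 from z of complexity about r (`exists_simple_mem_slice`), condition (ii)
forces (η - ε)r + (r - 1)δ ≤ r. Elementary real arithmetic, `le_of_projection_bounds`, extracts D ≤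
(nε/δ)r from the four. No machine is given ε or η, so K(ε) and K(η) enter only as nonnegative terms.
-/

namespace PointComplexity

open Encodable

/-! ### Computability relative to an oracle. -/

/-- `F` is computed, uniformly in the oracle, by one program. -/
def OracleComputable (F : Set ℕ → ℕ →. ℕ) : Prop :=
  ∃ c : OracleCode, ∀ A, c.eval A = F A

namespace OracleComputable

theorem of_partrec {f : ℕ →. ℕ} (hf : Nat.Partrec f) : OracleComputable fun _ => f := by
  induction hf with
  | zero => exact ⟨.zero, fun A => rfl⟩
  | succ => exact ⟨.succ, fun A => rfl⟩
  | left => exact ⟨.left, fun A => rfl⟩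
  | right => exact ⟨.right, fun A => rfl⟩
  | pair _ _ hf hg =>
    obtain ⟨c, hc⟩ := hf
    obtain ⟨d, hd⟩ := hg
    exact ⟨.pair c d, fun A => by simp only [OracleCode.eval, hc, hd]; rfl⟩
  | comp _ _ hf hg =>
    obtain ⟨c, hc⟩ := hf
    obtain ⟨d, hd⟩ := hg
    exact ⟨.comp c d, fun A => by simp only [OracleCode.eval, hc, hd]; rfl⟩
  | prec _ _ hf hg =>
    obtain ⟨c, hc⟩ := hf
    obtain ⟨d, hd⟩ := hg
    exact ⟨.prec c d, fun A => by simp only [OracleCode.eval, hc, hd]; rfl⟩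
  | rfind _ hf =>
    obtain ⟨c, hc⟩ := hf
    exact ⟨.rfind c, fun A => by simp only [OracleCode.eval, hc]; rfl⟩

theorem comp {F G : Set ℕ → ℕ →. ℕ} (hF : OracleComputable F) (hG : OracleComputable G) :
    OracleComputable fun A n => (G A n).bind (F A) := by
  obtain ⟨c, hc⟩ := hF
  obtain ⟨d, hd⟩ := hG
  exact ⟨.comp c d, fun A => by simp only [OracleCode.eval, hc, hd]; rfl⟩

theorem pair {F G : Set ℕ → ℕ →. ℕ} (hF : OracleComputable F) (hG : OracleComputable G) :
    OracleComputable fun A n => Nat.pair <$> F A n <*> G A n := by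
  obtain ⟨c, hc⟩ := hF
  obtain ⟨d, hd⟩ := hG
  exact ⟨.pair c d, fun A => by simp only [OracleCode.eval, hc, hd]; rfl⟩

end OracleComputable

/-- A query to the empty oracle is the constant 0. Through this, unrelativized complexity becomes
accessible to dovetailing and step-bounded evaluation. -/
theorem OracleCode.eval_empty_partrec (c : OracleCode) : Nat.Partrec (c.eval ∅) := by
  induction c with
  | zero => exact .zero
  | succ => exact .succ
  | left => exact .left
  | right => exact .right
  | oracle =>
    refine Nat.Partrec.zero.of_eq fun n => ?_
    simp [OracleCode.eval, pure, PFun.pure]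
  | pair _ _ hf hg => exact .pair hf hg
  | comp _ _ hf hg => exact .comp hf hg
  | prec _ _ hf hg => exact .prec hf hg
  | rfind _ hf => exact .rfind hf

/-- A total function with an oracle that is computed by one program. -/
def OracleTotal (f : Set ℕ → ℕ → ℕ) : Prop :=
  OracleComputable fun A n => Part.some (f A n)

namespace OracleTotal

theorem of_primrec {f : ℕ → ℕ} (hf : Primrec f) : OracleTotal fun _ => f :=
  OracleComputable.of_partrec (Nat.Partrec.of_primrec (Primrec.nat_iff.1 hf))

theorem comp {f g : Set ℕ → ℕ → ℕ} (hf : OracleTotal f) (hg : OracleTotal g) :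
    OracleTotal fun A n => f A (g A n) := by
  obtain ⟨c, hc⟩ := OracleComputable.comp hf hg
  exact ⟨c, fun A => by rw [hc]; funext n; simp⟩

theorem pair {f g : Set ℕ → ℕ → ℕ} (hf : OracleTotal f) (hg : OracleTotal g) :
    OracleTotal fun A n => Nat.pair (f A n) (g A n) := by
  obtain ⟨c, hc⟩ := OracleComputable.pair hf hg
  exact ⟨c, fun A => by rw [hc]; funext n; simp [Seq.seq]⟩

theorem comp₂ {p : ℕ → ℕ → ℕ} {f g : Set ℕ → ℕ → ℕ} (hp : Primrec₂ p) (hf : OracleTotal f)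
    (hg : OracleTotal g) : OracleTotal fun A n => p (f A n) (g A n) := by
  have h : Primrec fun x : ℕ => p x.unpair.1 x.unpair.2 :=
    hp.comp (Primrec.fst.comp Primrec.unpair) (Primrec.snd.comp Primrec.unpair)
  obtain ⟨c, hc⟩ := (of_primrec h).comp (hf.pair hg)
  exact ⟨c, fun A => by rw [hc]; funext n; simp⟩

open Classical in
theorem query {g : Set ℕ → ℕ → ℕ} (hg : OracleTotal g) :
    OracleTotal fun A n => if g A n ∈ A then 1 else 0 :=
  comp (f := fun A n => if n ∈ A then 1 else 0) ⟨.oracle, fun _ => rfl⟩ hg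

theorem rec {f : Set ℕ → ℕ} {g : Set ℕ → ℕ → ℕ} (hf : OracleTotal fun A _ => f A)
    (hg : OracleTotal g) :
    OracleTotal fun A n => Nat.rec (f A) (fun y i => g A (Nat.pair y i)) n := by
  obtain ⟨c, hc⟩ := hf
  obtain ⟨d, hd⟩ := hg.comp (of_primrec (Primrec.snd.comp Primrec.unpair))
  have key : OracleTotal fun A x =>
      Nat.rec (f A) (fun y i => g A (Nat.pair y i)) x.unpair.2 := by
    refine ⟨.prec c d, fun A => ?_⟩
    funext x
    simp only [OracleCode.eval, hc, hd, Nat.unpaired]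
    induction x.unpair.2 with
    | zero => rfl
    | succ m ih =>
      simp only [Nat.unpair_pair] at ih ⊢
      rw [ih]
      simp
  -- The instruction `prec` recurses on the second half of a pair; the first half is a dummy
  -- parameter, here 0.
  obtain ⟨c, hc⟩ := key.comp (of_primrec
    (Primrec₂.natPair.comp (Primrec.const 0) Primrec.id))
  exact ⟨c, fun A => by rw [hc]; funext n; simp⟩

end OracleTotal

/-! ### Binary strings and a prefix-free code with a header. -/

theorem primrec_bits : Primrec Nat.bits := by
  have hg : Primrec₂ fun (_ : Unit) (l : List (List Bool)) =>
      if l.length = 0 then some []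
      else (l[l.length.div2]?).map fun t => l.length.bodd :: t := by
    have hlen : Primrec fun p : Unit × List (List Bool) => p.2.length :=
      Primrec.list_length.comp Primrec.snd
    refine Primrec.ite (Primrec.eq.comp hlen (Primrec.const 0)) (Primrec.const _) ?_
    refine Primrec.option_map
      (Primrec.list_getElem?.comp Primrec.snd (Primrec.nat_div2.comp hlen)) ?_
    exact Primrec.list_cons.comp (Primrec.nat_bodd.comp (hlen.comp Primrec.fst)) Primrec.snd
  refine (Primrec.nat_strong_rec (fun _ : Unit => Nat.bits) hg fun _ n => ?_).comp
    (Primrec.const ()) Primrec.id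
  rcases eq_or_ne n 0 with rfl | hn
  · simp
  · have h2 : n.div2 < n := by rw [Nat.div2_val]; omega
    have hb : Nat.bits n = n.bodd :: Nat.bits n.div2 := by
      conv_lhs => rw [← Nat.bit_bodd_div2 n]
      refine Nat.bits_append_bit _ _ fun h => ?_
      have := Nat.bit_bodd_div2 n
      rw [h] at this
      cases hb : n.bodd <;> simp_all
    simp [hn, h2, hb]

/-- The number with a given list of binary digits, lowest digit first. -/
def ofBits (l : List Bool) : ℕ :=
  l.foldr (fun b x => 2 * x + b.toNat) 0

theorem primrec_ofBits : Primrec ofBits := by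
  refine Primrec.list_foldr (f := fun l : List Bool => l) (g := fun _ => 0)
    (h := fun _ p => 2 * p.2 + p.1.toNat) Primrec.id (Primrec.const 0) ?_
  refine Primrec.nat_add.comp (Primrec.nat_double.comp (Primrec.snd.comp Primrec.snd)) ?_
  exact (Primrec.dom_bool Bool.toNat).comp (Primrec.fst.comp Primrec.snd)

@[simp] theorem ofBits_bits (n : ℕ) : ofBits (Nat.bits n) = n := by
  induction n using Nat.binaryRec' with
  | zero => rfl
  | bit b n h ih =>
    rw [Nat.bits_append_bit n b h]
    change 2 * ofBits n.bits + b.toNat = _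
    rw [ih, Nat.bit_val]

/-- `ofBits` ignores zeros at the high end, so the length can be prescribed. An index below 2^L thus
costs exactly L bits. -/
theorem exists_ofBits_eq (L : ℕ) {v : ℕ} (hv : v < 2 ^ L) :
    ∃ l : List Bool, l.length = L ∧ ofBits l = v := by
  induction L generalizing v with
  | zero => exact ⟨[], rfl, by simp at hv; simp [ofBits, hv]⟩
  | succ L ih =>
    obtain ⟨l, hl, hv'⟩ := ih (v := v / 2) (by rw [pow_succ] at hv; omega)
    refine ⟨decide (v % 2 = 1) :: l, by simp [hl], ?_⟩
    change 2 * ofBits l + _ = v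
    rw [hv']
    rcases Nat.mod_two_eq_zero_or_one v with h | h <;> simp [h] <;> omega

/-- A prefix-free code for binary strings. -/
def selfDelim : List Bool → List Bool
  | [] => [false]
  | b :: l => true :: b :: selfDelim l

theorem length_selfDelim (l : List Bool) : (selfDelim l).length = 2 * l.length + 1 := by
  induction l with
  | nil => rfl
  | cons b l ih => simp [selfDelim, ih]; ring

theorem selfDelim_append_inj {l l' t t' : List Bool} (h : selfDelim l ++ t = selfDelim l' ++ t') :
    l = l' ∧ t = t' := by
  induction l generalizing l' with
  | nil => cases l' <;> simp_all [selfDelim]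
  | cons b l ih =>
    cases l' with
    | nil => simp_all [selfDelim]
    | cons b' l' =>
      simp only [selfDelim, List.cons_append, List.cons.injEq, true_and] at h
      obtain ⟨rfl, h⟩ := h
      simpa using ih h

theorem primrec_selfDelim : Primrec selfDelim := by
  have : Primrec fun l : List Bool =>
      l.foldr (fun b t => true :: b :: t) [false] := by
    refine Primrec.list_foldr (f := fun l : List Bool => l) (g := fun _ => [false])
      (h := fun _ p => true :: p.1 :: p.2) Primrec.id (Primrec.const _) ?_
    exact Primrec.list_cons.comp (Primrec.const true) (Primrec.list_cons.comp
      (Primrec.fst.comp Primrec.snd) (Primrec.snd.comp Primrec.snd))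
  refine this.of_eq fun l => ?_
  induction l with
  | nil => rfl
  | cons b l ih => simp [selfDelim, ← ih]

/-- A prefix-free code for pairs of a number (a header) and a string. -/
def headerCode (x : ℕ × List Bool) : List Bool :=
  selfDelim (Nat.bits (Nat.pair x.1 x.2.length)) ++ x.2

/-- The self-delimiting first part also records the length of the string, so it determines where the
codeword ends. The string itself is then stored without overhead, and only the header pays a factor.
-/
theorem headerCode_append_inj {x y : ℕ × List Bool} {t : List Bool}
    (h : headerCode x ++ t = headerCode y) : x = y ∧ t = [] := by
  obtain ⟨a, l⟩ := x
  obtain ⟨b, l'⟩ := y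
  simp only [headerCode, List.append_assoc] at h
  obtain ⟨h₁, h₂⟩ := selfDelim_append_inj h
  have h₃ := congrArg ofBits h₁
  rw [ofBits_bits, ofBits_bits] at h₃
  obtain ⟨rfl, h₄⟩ := Nat.pair_eq_pair.1 h₃
  have h₅ := congrArg List.length h₂
  have ht : t = [] := by
    rw [List.length_append] at h₅
    exact List.length_eq_zero_iff.1 (by omega)
  subst ht
  simp_all

theorem primrec_headerCode : Primrec headerCode :=
  Primrec.list_append.comp (primrec_selfDelim.comp (primrec_bits.comp
    (Primrec₂.natPair.comp Primrec.fst (Primrec.list_length.comp Primrec.snd)))) Primrec.snd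

theorem size_pair_le (a b : ℕ) : Nat.size (Nat.pair a b) ≤ 2 * (Nat.size a + Nat.size b) := by
  rw [Nat.size_le]
  have h := Nat.pair_lt_max_add_one_sq a b
  have ha : a < 2 ^ (Nat.size a + Nat.size b) :=
    (Nat.lt_size_self a).trans_le (Nat.pow_le_pow_right two_pos (by omega))
  have hb : b < 2 ^ (Nat.size a + Nat.size b) :=
    (Nat.lt_size_self b).trans_le (Nat.pow_le_pow_right two_pos (by omega))
  refine h.trans_le ?_
  rw [mul_comm, pow_mul]
  exact Nat.pow_le_pow_left (max_lt ha hb) 2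

theorem length_headerCode_le (x : ℕ × List Bool) :
    (headerCode x).length ≤ x.2.length + 4 * (Nat.size x.1 + Nat.size x.2.length) + 1 := by
  have := size_pair_le x.1 x.2.length
  rw [headerCode, List.length_append, length_selfDelim, Nat.size_eq_bits_len]
  omega

/-- The pair coded by a program, found by search. -/
def headerDecode (π : List Bool) : Part (ℕ × List Bool) :=
  Nat.rfindOpt fun m => (decode m : Option (ℕ × List Bool)).bind fun x =>
    if headerCode x = π then some x else none

theorem mem_headerDecode {π : List Bool} {x : ℕ × List Bool} :
    x ∈ headerDecode π ↔ headerCode x = π := by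
  constructor
  · intro h
    obtain ⟨m, hm⟩ := Nat.rfindOpt_spec h
    simp only [Option.mem_def, Option.bind_eq_some_iff] at hm
    obtain ⟨y, -, hy⟩ := hm
    split_ifs at hy with h'
    rwa [← Option.some.inj hy]
  · intro h
    have hdom : (headerDecode π).Dom := by
      refine Nat.rfindOpt_dom.2 ⟨encode x, x, ?_⟩
      simp [h]
    obtain ⟨y, hy⟩ := Part.dom_iff_mem.1 hdom
    obtain ⟨m, hm⟩ := Nat.rfindOpt_spec hy
    simp only [Option.mem_def, Option.bind_eq_some_iff] at hm
    obtain ⟨y', -, hy'⟩ := hm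
    split_ifs at hy' with h'
    obtain rfl := Option.some.inj hy'
    have : x = y' := (headerCode_append_inj (t := []) (by simp [h, h'])).1
    rwa [this]

theorem partrec_headerDecode : Partrec headerDecode := by
  refine Partrec.rfindOpt (Primrec.to_comp ?_)
  refine Primrec.option_bind (Primrec.decode.comp Primrec.snd) ?_
  refine Primrec.ite ?_ (Primrec.option_some.comp Primrec.snd) (Primrec.const none)
  exact Primrec.eq.comp (primrec_headerCode.comp Primrec.snd) (Primrec.fst.comp Primrec.fst)

/-- Whatever a program computes from a header and a string, it is as complex as the string up to
a term that is logarithmic in the header and in the length of the string. -/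
theorem OracleMachine.IsUniversal.exists_program {U : OracleMachine} (hU : U.IsUniversal)
    {F : Set ℕ → ℕ →. ℕ} (hF : OracleComputable F) :
    ∃ C : ℕ, ∀ (A : Set ℕ) (h : ℕ) (ρ σ : List Bool),
      encode σ ∈ F A (Nat.pair h (encode ρ)) →
      ∃ π : List Bool, σ ∈ U A π [] ∧
        π.length ≤ ρ.length + 4 * (Nat.size h + Nat.size ρ.length) + C := by
  -- This machine halts only on codewords, which is what makes it prefix-free whatever `F` does.
  let M : OracleMachine := fun A π _ =>
    (headerDecode π).bind fun x => (F A (encode x)).bind fun y =>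
      ((decode y : Option (List Bool)) : Part (List Bool))
  have hM : M.IsComputable := by
    have hdec : Nat.Partrec fun m =>
        (((decode m.unpair.1 : Option (List Bool)) : Part (List Bool)).bind fun π =>
          (headerDecode π).map encode) := by
      refine Partrec.nat_iff.1 (Partrec.bind (Computable.ofOption
        (Computable.decode.comp (Computable.fst.comp Computable.unpair))) ?_)
      exact (partrec_headerDecode.comp Computable.snd).map (Computable.encode.comp Computable.snd)
    have hout : Nat.Partrec fun y =>
        ((decode y : Option (List Bool)) : Part (List Bool)).map encode :=
      Partrec.nat_iff.1 ((Computable.ofOption Computable.decode).map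
        (Computable.encode.comp Computable.snd))
    obtain ⟨c, hc⟩ := (OracleComputable.of_partrec hout).comp
      (hF.comp (OracleComputable.of_partrec hdec))
    refine ⟨c, fun A π τ => ?_⟩
    rw [hc]
    have hb : ((headerDecode π).map encode).bind (F A) =
        (headerDecode π).bind fun x => F A (encode x) := Part.bind_map _ _ _
    simp only [M, Nat.unpair_pair, encodek, Part.map_bind, Part.coe_some, Part.bind_some, hb,
      Part.bind_assoc]
  have hM' : M.IsPrefixFree := by
    intro A τ π π' h h' hp
    obtain ⟨s, hs⟩ := Part.dom_iff_mem.1 h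
    obtain ⟨s', hs'⟩ := Part.dom_iff_mem.1 h'
    obtain ⟨x, hx, -⟩ := Part.mem_bind_iff.1 hs
    obtain ⟨y, hy, -⟩ := Part.mem_bind_iff.1 hs'
    rw [mem_headerDecode] at hx hy
    obtain ⟨t, ht⟩ := hp
    rw [← hx, ← hy] at ht
    obtain ⟨rfl, rfl⟩ := headerCode_append_inj ht
    rw [← hx, ← hy]
  obtain ⟨c, hc⟩ := hU.simulates M hM hM'
  refine ⟨c + 1, fun A h ρ σ hσ => ?_⟩
  obtain ⟨π, hπ, hl⟩ := hc A (headerCode (h, ρ)) [] σ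
    (Part.mem_bind_iff.2 ⟨(h, ρ), mem_headerDecode.2 rfl, Part.mem_bind_iff.2
      ⟨_, hσ, by simp⟩⟩)
  refine ⟨π, hπ, hl.trans ?_⟩
  have := length_headerCode_le (h, ρ)
  simp only at this
  omega

/-! ### Online hitting sets by exponential weights. -/

section OnlineHitting

variable {α : Type*} (mem : ℕ → α → Bool) (X N J : ℕ)

/-- The weight of the `j`-th set after the arrivals `l`, of which `P` have been picked: it is zero
once the set has been hit, and otherwise grows by the factor `(X + 1) / X` with every arrival. -/
def hitWeight (l P : List α) (j : ℕ) : ℕ :=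
  if P.countP (mem j) = 0 then
    (X + 1) ^ l.countP (mem j) * X ^ (N - l.countP (mem j)) else 0

/-- The elements picked online from a sequence of arrivals (latest first): an element is picked if
the sets that contain it and have not been hit are heavy. -/
def picks : List α → List α
  | [] => []
  | a :: l =>
    if J * X * X ^ N ≤
        N * ((List.range J).map fun j => if mem j a then hitWeight mem X N l (picks l) j else 0).sum
    then a :: picks l else picks l

theorem picks_suffix_cons (a : α) (l : List α) :
    picks mem X N J l <:+ picks mem X N J (a :: l) := by
  rw [picks]
  split_ifs
  · exact List.suffix_cons _ _
  · exact List.suffix_rfl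

/-- A pick is never revoked, so along a growing enumeration the picks form a growing list and each
keeps its index, counted from the end. -/
theorem picks_suffix {l l' : List α} (h : l <:+ l') :
    picks mem X N J l <:+ picks mem X N J l' := by
  obtain ⟨t, rfl⟩ := h
  induction t with
  | nil => exact List.suffix_rfl
  | cons a t ih => exact ih.trans (picks_suffix_cons mem X N J a _)

variable {mem X N J}

/-- This is the invariant of the selection, by induction on the arrivals. If an arrival is picked,
the sets containing it lose all their weight, which by the threshold pays for one pick. If it is not
picked, those sets gain a fraction 1/X of a weight below the threshold, so N times the total grows
by at most J · X^N, the increase of the right-hand side. The factor X^N only keeps the weights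
integral. -/
theorem picks_potential (hX : 0 < X) {l : List α} (hl : l.length ≤ N) :
    N * ((List.range J).map (hitWeight mem X N l (picks mem X N J l))).sum +
      (picks mem X N J l).length * (J * X * X ^ N) ≤ (N + l.length) * (J * X ^ N) := by
  induction l with
  | nil =>
    have h0 : hitWeight mem X N [] [] = fun _ => X ^ N := by
      funext j
      simp [hitWeight]
    simp [picks, h0]
  | cons a l ih =>
    have ih := ih (by simp at hl; omega)
    set W := hitWeight mem X N l (picks mem X N J l) with hW
    rw [List.length_cons, picks, ← hW]
    split_ifs with hc
    · have hsum : ((List.range J).map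
          (hitWeight mem X N (a :: l) (a :: picks mem X N J l))).sum +
          ((List.range J).map fun j => if mem j a then W j else 0).sum ≤
          ((List.range J).map W).sum := by
        rw [← List.sum_map_add]
        refine List.sum_le_sum fun j _ => ?_
        by_cases hj : mem j a
        · simp [hitWeight, hj]
        · simp [hitWeight, hj, hW]
      have := Nat.mul_le_mul_left N hsum
      rw [List.length_cons]
      rw [mul_add] at this
      have e1 : (N + (l.length + 1)) * (J * X ^ N) = (N + l.length) * (J * X ^ N) + J * X ^ N := by
        ring
      have e2 : ((picks mem X N J l).length + 1) * (J * X * X ^ N) =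
          (picks mem X N J l).length * (J * X * X ^ N) + J * X * X ^ N := by ring
      rw [e1, e2]
      omega
    · push Not at hc
      have hsum : X * ((List.range J).map (hitWeight mem X N (a :: l) (picks mem X N J l))).sum ≤
          X * ((List.range J).map W).sum +
          ((List.range J).map fun j => if mem j a then W j else 0).sum := by
        rw [← List.sum_map_mul_left, ← List.sum_map_mul_left, ← List.sum_map_add]
        refine List.sum_le_sum fun j _ => ?_
        by_cases hj : mem j a
        · rw [if_pos hj]
          simp only [hitWeight, hW, List.countP_cons_of_pos hj]
          split_ifs
          · have hcount : l.countP (mem j) + 1 ≤ N := by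
              have := List.countP_le_length (p := mem j) (l := l)
              simp at hl
              omega
            obtain ⟨d, hd⟩ := Nat.exists_eq_add_of_le hcount
            have h1 : N - (l.countP (mem j) + 1) = d := by omega
            have h2 : N - l.countP (mem j) = d + 1 := by omega
            rw [h1, h2]
            apply le_of_eq
            ring
          · simp
        · simp [hitWeight, hj, hW]
      have h1 : X * (N * ((List.range J).map
          (hitWeight mem X N (a :: l) (picks mem X N J l))).sum) ≤
          X * (N * ((List.range J).map W).sum + J * X ^ N) := by
        have := Nat.mul_le_mul_left N hsum
        nlinarith
      have h2 := Nat.le_of_mul_le_mul_left h1 hX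
      nlinarith

theorem length_picks_mul_le (hX : 0 < X) (hJ : 0 < J) {l : List α} (hl : l.length ≤ N) :
    (picks mem X N J l).length * X ≤ 2 * N := by
  have h := picks_potential (mem := mem) (J := J) hX hl
  have hpos : 0 < J * X ^ N := by positivity
  refine Nat.le_of_mul_le_mul_right ?_ hpos
  have h1 := Nat.mul_le_mul_right (J * X ^ N) hl
  have e1 : (picks mem X N J l).length * X * (J * X ^ N) =
      (picks mem X N J l).length * (J * X * X ^ N) := by ring
  have e2 : (N + l.length) * (J * X ^ N) = N * (J * X ^ N) + l.length * (J * X ^ N) := by ring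
  have e3 : 2 * N * (J * X ^ N) = N * (J * X ^ N) + N * (J * X ^ N) := by ring
  rw [e1, e3]
  omega

/-- A set with X · m arrivals that was never hit would have relative weight at least (1 + 1/X)^(Xm)
≥ 2^m, more than the bound 2J for the total relative weight. -/
theorem exists_mem_picks (hX : 0 < X) (hN : 0 < N) {l : List α} (hl : l.length ≤ N) {j m : ℕ}
    (hj : j < J) (hm : 2 * J < 2 ^ m) (hc : X * m ≤ l.countP (mem j)) :
    ∃ a ∈ picks mem X N J l, mem j a := by
  by_contra! hne
  have h0 : (picks mem X N J l).countP (mem j) = 0 := by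
    rw [List.countP_eq_zero]
    exact fun a ha => by simp [hne a ha]
  have hpot := picks_potential (mem := mem) (J := J) hX hl
  have hsingle : hitWeight mem X N l (picks mem X N J l) j ≤
      ((List.range J).map (hitWeight mem X N l (picks mem X N J l))).sum :=
    List.le_sum_of_mem (List.mem_map.2 ⟨j, List.mem_range.2 hj, rfl⟩)
  have hw : hitWeight mem X N l (picks mem X N J l) j ≤ 2 * J * X ^ N := by
    refine Nat.le_of_mul_le_mul_left ?_ hN
    have := Nat.mul_le_mul_left N hsingle
    have h3 : (N + l.length) * (J * X ^ N) ≤ (N + N) * (J * X ^ N) := by gcongr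
    have h4 : N * (2 * J * X ^ N) = (N + N) * (J * X ^ N) := by ring
    rw [h4]
    omega
  rw [hitWeight, if_pos h0] at hw
  set c := l.countP (mem j) with hcdef
  have hcN : c ≤ N := List.countP_le_length.trans hl
  obtain ⟨d, hd⟩ := Nat.exists_eq_add_of_le hcN
  have hd' : N - c = d := by omega
  rw [hd', hd, pow_add, ← mul_assoc] at hw
  have hw' := Nat.le_of_mul_le_mul_right hw (by positivity : 0 < X ^ d)
  obtain ⟨t, ht⟩ := Nat.exists_eq_add_of_le hc
  -- Bernoulli's inequality: (1 + 1/X)^X ≥ 2.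
  have hbern : 2 * X ^ X ≤ (X + 1) ^ X := by
    obtain ⟨Y, rfl⟩ : ∃ Y, X = Y + 1 := ⟨X - 1, by omega⟩
    have := Nat.pow_le_pow_left (le_refl (Y + 1 + 1)) (Y + 1)
    have h := one_add_mul_le_pow (a := (1 : ℝ) / (Y + 1))
      (by have : (0 : ℝ) ≤ 1 / (Y + 1) := by positivity
          linarith) (Y + 1)
    have h5 : (2 : ℝ) ≤ (1 + 1 / (Y + 1)) ^ (Y + 1) := by
      refine le_trans (le_of_eq ?_) h
      push_cast
      field_simp
      ring
    have h6 : (1 + 1 / ((Y : ℝ) + 1)) ^ (Y + 1) =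
        ((Y : ℝ) + 1 + 1) ^ (Y + 1) / (Y + 1) ^ (Y + 1) := by
      rw [← div_pow]
      congr 1
      field_simp
    rw [h6, le_div_iff₀ (by positivity)] at h5
    exact_mod_cast h5
  have h7 : 2 ^ m * X ^ c ≤ (X + 1) ^ c := by
    rw [ht, pow_add, pow_add, pow_mul, pow_mul, ← mul_assoc, ← mul_pow]
    exact Nat.mul_le_mul (Nat.pow_le_pow_left hbern m)
      (Nat.pow_le_pow_left (Nat.le_succ X) t)
  have h8 := h7.trans hw'
  have h9 := Nat.le_of_mul_le_mul_right h8 (by positivity : 0 < X ^ c)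
  omega

end OnlineHitting

/-! ### The online selection is primitive recursive. -/

theorem primrec_list_sum : Primrec (List.sum : List ℕ → ℕ) := by
  have : Primrec fun l : List ℕ => l.foldr (fun a s => a + s) 0 :=
    Primrec.list_foldr (f := fun l : List ℕ => l) (g := fun _ => 0) (h := fun _ p => p.1 + p.2)
      Primrec.id (Primrec.const 0)
      (Primrec.nat_add.comp (Primrec.fst.comp Primrec.snd) (Primrec.snd.comp Primrec.snd))
  exact this.of_eq fun l => by induction l <;> simp_all

theorem primrec_nat_pow : Primrec₂ ((· ^ ·) : ℕ → ℕ → ℕ) :=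
  Primrec₂.unpaired'.1 Nat.Primrec.pow

theorem primrec_countP {α β : Type*} [Primcodable α] [Primcodable β] {f : α → List β}
    {p : α → β → Bool} (hf : Primrec f) (hp : Primrec₂ p) :
    Primrec fun a => (f a).countP (p a) := by
  have h : Primrec fun a => ((f a).filterMap fun b => if p a b then some b else none).length := by
    refine Primrec.list_length.comp (Primrec.listFilterMap hf ?_)
    exact Primrec.ite (Primrec.eq.comp hp (Primrec.const true))
      (Primrec.option_some.comp Primrec.snd) (Primrec.const none)
  refine h.of_eq fun a => ?_
  rw [List.countP_eq_length_filter, ← List.filterMap_eq_filter]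
  rfl

theorem primrec_picks {γ α : Type*} [Primcodable γ] [Primcodable α] {mem : γ → ℕ → α → Bool}
    {X N J : γ → ℕ} (hmem : Primrec fun x : γ × ℕ × α => mem x.1 x.2.1 x.2.2)
    (hX : Primrec X) (hN : Primrec N) (hJ : Primrec J) :
    Primrec fun x : γ × List α => picks (mem x.1) (X x.1) (N x.1) (J x.1) x.2 := by
  have hcount : Primrec fun x : (γ × ℕ) × List α => x.2.countP (mem x.1.1 x.1.2) :=
    primrec_countP Primrec.snd (hmem.comp (Primrec.pair (Primrec.fst.comp (Primrec.fst.comp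
      Primrec.fst)) (Primrec.pair (Primrec.snd.comp (Primrec.fst.comp Primrec.fst))
      Primrec.snd)))
  have hweight : Primrec fun x : γ × ℕ × List α × List α =>
      hitWeight (mem x.1) (X x.1) (N x.1) x.2.2.1 x.2.2.2 x.2.1 := by
    have hγ : Primrec fun x : γ × ℕ × List α × List α => x.1 := Primrec.fst
    have hj : Primrec fun x : γ × ℕ × List α × List α => (x.1, x.2.1) :=
      Primrec.pair Primrec.fst (Primrec.fst.comp Primrec.snd)
    have h1 := hcount.comp (Primrec.pair hj (Primrec.fst.comp (Primrec.snd.comp Primrec.snd)))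
    have h2 := hcount.comp (Primrec.pair hj (Primrec.snd.comp (Primrec.snd.comp Primrec.snd)))
    refine Primrec.ite (Primrec.eq.comp h2 (Primrec.const 0)) ?_ (Primrec.const 0)
    exact Primrec.nat_mul.comp
      (primrec_nat_pow.comp (Primrec.succ.comp (hX.comp hγ)) h1)
      (primrec_nat_pow.comp (hX.comp hγ) (Primrec.nat_sub.comp (hN.comp hγ) h1))
  have hsum : Primrec fun x : γ × α × List α × List α =>
      ((List.range (J x.1)).map fun j => if mem x.1 j x.2.1 then
        hitWeight (mem x.1) (X x.1) (N x.1) x.2.2.1 x.2.2.2 j else 0).sum := by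
    refine primrec_list_sum.comp (Primrec.list_map
      (Primrec.list_range.comp (hJ.comp Primrec.fst)) ?_)
    have hγ : Primrec fun x : (γ × α × List α × List α) × ℕ => x.1.1 :=
      Primrec.fst.comp Primrec.fst
    have ha : Primrec fun x : (γ × α × List α × List α) × ℕ => x.1.2.1 :=
      Primrec.fst.comp (Primrec.snd.comp Primrec.fst)
    have hl : Primrec fun x : (γ × α × List α × List α) × ℕ => x.1.2.2 :=
      Primrec.snd.comp (Primrec.snd.comp Primrec.fst)
    exact Primrec.ite (Primrec.eq.comp
      (hmem.comp (Primrec.pair hγ (Primrec.pair Primrec.snd ha))) (Primrec.const true))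
      (hweight.comp (Primrec.pair hγ (Primrec.pair Primrec.snd hl))) (Primrec.const 0)
  have hcond : PrimrecPred fun x : γ × α × List α × List α =>
      J x.1 * X x.1 * X x.1 ^ N x.1 ≤ N x.1 *
        ((List.range (J x.1)).map fun j => if mem x.1 j x.2.1 then
          hitWeight (mem x.1) (X x.1) (N x.1) x.2.2.1 x.2.2.2 j else 0).sum := by
    have hX' := hX.comp (Primrec.fst (α := γ) (β := α × List α × List α))
    have hN' := hN.comp (Primrec.fst (α := γ) (β := α × List α × List α))
    have hJ' := hJ.comp (Primrec.fst (α := γ) (β := α × List α × List α))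
    exact Primrec.nat_le.comp (Primrec.nat_mul.comp (Primrec.nat_mul.comp hJ' hX')
      (primrec_nat_pow.comp hX' hN')) (Primrec.nat_mul.comp hN' hsum)
  have hrec : Primrec fun x : γ × List α => List.rec (motive := fun _ => List α) []
      (fun a l P => if J x.1 * X x.1 * X x.1 ^ N x.1 ≤ N x.1 *
        ((List.range (J x.1)).map fun j => if mem x.1 j a then
          hitWeight (mem x.1) (X x.1) (N x.1) l P j else 0).sum then a :: P else P) x.2 := by
    refine Primrec.list_rec (f := fun x : γ × List α => x.2) (g := fun _ => [])
      (h := fun x (p : α × List α × List α) => if J x.1 * X x.1 * X x.1 ^ N x.1 ≤ N x.1 *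
        ((List.range (J x.1)).map fun j => if mem x.1 j p.1 then
          hitWeight (mem x.1) (X x.1) (N x.1) p.2.1 p.2.2 j else 0).sum
        then p.1 :: p.2.2 else p.2.2) Primrec.snd (Primrec.const []) ?_
    have ha : Primrec fun x : (γ × List α) × α × List α × List α => x.2.1 :=
      Primrec.fst.comp Primrec.snd
    have hP : Primrec fun x : (γ × List α) × α × List α × List α => x.2.2.2 :=
      Primrec.snd.comp (Primrec.snd.comp Primrec.snd)
    exact Primrec.ite (hcond.comp (Primrec.pair (Primrec.fst.comp Primrec.fst) Primrec.snd))
      (Primrec.list_cons.comp ha hP) hP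
  refine hrec.of_eq fun x => ?_
  obtain ⟨c, l⟩ := x
  induction l with
  | nil => rfl
  | cons a l ih => simp only [picks, ← ih]

/-! ### Enumerating the outputs of short programs. -/

theorem card_short_strings (k : ℕ) :
    ∃ s : Finset (List Bool), (∀ l : List Bool, l.length ≤ k → l ∈ s) ∧ s.card ≤ 2 ^ (k + 1) := by
  induction k with
  | zero => exact ⟨{[]}, by simp, by simp⟩
  | succ k ih =>
    obtain ⟨s, hs, hc⟩ := ih
    refine ⟨s ∪ (Finset.univ : Finset (List.Vector Bool (k + 1))).image List.Vector.toList,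
      fun l hl => ?_, ?_⟩
    · rcases Nat.lt_or_ge k l.length with h | h
      · refine Finset.mem_union_right _ (Finset.mem_image.2 ⟨⟨l, by omega⟩, Finset.mem_univ _, rfl⟩)
      · exact Finset.mem_union_left _ (hs l h)
    · refine (Finset.card_union_le _ _).trans ?_
      have : ((Finset.univ : Finset (List.Vector Bool (k + 1))).image List.Vector.toList).card ≤
          2 ^ (k + 1) := Finset.card_image_le.trans (by simp)
      rw [pow_succ _ (k + 1)]
      omega

/-- The values of a partial recursive function at programs of bounded length can be enumerated
without repetition. -/
theorem exists_enumeration {α β : Type*} [Primcodable α] [Primcodable β] [DecidableEq α]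
    {V : β × List Bool →. α} (hV : Partrec V) :
    ∃ stage : ℕ × β → ℕ → List α, Primrec₂ stage ∧ (∀ x S, (stage x S).Nodup) ∧
      (∀ x S T, S ≤ T → stage x S <:+ stage x T) ∧
      (∀ k b π a, π.length ≤ k → a ∈ V (b, π) → ∃ S, a ∈ stage (k, b) S) ∧
      ∀ x S, (stage x S).length ≤ 2 ^ (x.1 + 1) := by
  obtain ⟨c, hc⟩ := Nat.Partrec.Code.exists_code.1 hV
  -- Dovetailing: `s` codes a time bound together with a program.
  let ev : ℕ × β → ℕ → Option α := fun x s =>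
    (decode s.unpair.2 : Option (List Bool)).bind fun π =>
      if π.length ≤ x.1 then
        (Nat.Partrec.Code.evaln s.unpair.1 c (encode (x.2, π))).bind decode
      else none
  have hev : Primrec₂ ev := by
    refine Primrec.option_bind (Primrec.decode.comp
      (Primrec.snd.comp (Primrec.unpair.comp Primrec.snd))) ?_
    refine Primrec.ite ?_ ?_ (Primrec.const none)
    · exact Primrec.nat_le.comp (Primrec.list_length.comp Primrec.snd)
        (Primrec.fst.comp (Primrec.fst.comp Primrec.fst))
    · refine Primrec.option_bind ?_ (Primrec.decode.comp Primrec.snd)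
      exact Nat.Partrec.Code.primrec_evaln.comp (Primrec.pair (Primrec.pair
        (Primrec.fst.comp (Primrec.unpair.comp (Primrec.snd.comp Primrec.fst)))
        (Primrec.const c)) (Primrec.encode.comp (Primrec.pair
          (Primrec.snd.comp (Primrec.fst.comp Primrec.fst)) Primrec.snd)))
  have hsound : ∀ x s a, ev x s = some a → ∃ π : List Bool, π.length ≤ x.1 ∧ a ∈ V (x.2, π) := by
    intro x s a h
    obtain ⟨π, -, h⟩ := Option.bind_eq_some_iff.1 h
    split_ifs at h with hlen
    obtain ⟨y, hy, hya⟩ := Option.bind_eq_some_iff.1 h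
    have := Nat.Partrec.Code.evaln_sound hy
    rw [hc] at this
    simp only [encodek, Part.coe_some, Part.bind_some, Part.mem_map_iff] at this
    obtain ⟨a', ha', rfl⟩ := this
    rw [encodek] at hya
    exact ⟨π, hlen, Option.some.inj hya ▸ ha'⟩
  have hcomplete : ∀ k b π a, π.length ≤ k → a ∈ V (b, π) → ∃ s, ev (k, b) s = some a := by
    intro k b π a hlen ha
    have : encode a ∈ c.eval (encode (b, π)) := by
      rw [hc]
      simp only [encodek, Part.coe_some, Part.bind_some]
      exact Part.mem_map _ ha
    obtain ⟨t, ht⟩ := Nat.Partrec.Code.evaln_complete.1 this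
    refine ⟨Nat.pair t (encode π), ?_⟩
    simp only [ev, Nat.unpair_pair, encodek, Option.bind_some, if_pos hlen]
    rw [Option.mem_def.1 ht, Option.bind_some, encodek]
  let step : Option α → List α → List α := fun o l =>
    o.elim l fun a => if ∃ b ∈ l, b = a then l else a :: l
  let stage : ℕ × β → ℕ → List α := fun x S => Nat.rec [] (fun s l => step (ev x s) l) S
  have hstep : Primrec₂ step := by
    have hmem : PrimrecRel fun (l : List α) (a : α) => ∃ b ∈ l, b = a :=
      PrimrecRel.exists_mem_list Primrec.eq
    have hg : Primrec₂ fun (p : Option α × List α) (a : α) =>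
        if ∃ b ∈ p.2, b = a then p.2 else a :: p.2 :=
      Primrec.ite (hmem.comp (Primrec.snd.comp Primrec.fst) Primrec.snd)
        (Primrec.snd.comp Primrec.fst)
        (Primrec.list_cons.comp Primrec.snd (Primrec.snd.comp Primrec.fst))
    refine (Primrec.option_casesOn (o := fun p : Option α × List α => p.1) Primrec.fst
      Primrec.snd hg).of_eq fun p => ?_
    rcases p with ⟨_ | a, l⟩ <;> rfl
  have hstage : Primrec₂ stage := by
    refine Primrec.nat_rec' (f := fun p : (ℕ × β) × ℕ => p.2) (g := fun _ => [])
      (h := fun p (q : ℕ × List α) => step (ev p.1 q.1) q.2) Primrec.snd (Primrec.const []) ?_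
    exact hstep.comp (hev.comp (Primrec.fst.comp Primrec.fst) (Primrec.fst.comp Primrec.snd))
      (Primrec.snd.comp Primrec.snd)
  have hsucc : ∀ x S, stage x (S + 1) = step (ev x S) (stage x S) := fun _ _ => rfl
  have hsuffix : ∀ x S, stage x S <:+ stage x (S + 1) := by
    intro x S
    rw [hsucc]
    rcases ev x S with _ | a
    · exact List.suffix_rfl
    · simp only [step, Option.elim]
      split_ifs
      · exact List.suffix_rfl
      · exact List.suffix_cons _ _
  have hnodup : ∀ x S, (stage x S).Nodup := by
    intro x S
    induction S with
    | zero => exact List.nodup_nil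
    | succ S ih =>
      rw [hsucc]
      rcases ev x S with _ | a
      · exact ih
      · simp only [step, Option.elim]
        split_ifs with h
        · exact ih
        · exact List.nodup_cons.2 ⟨fun ha => h ⟨a, ha, rfl⟩, ih⟩
  have hprog : ∀ x S, ∀ a ∈ stage x S, ∃ π : List Bool, π.length ≤ x.1 ∧ a ∈ V (x.2, π) := by
    intro x S
    induction S with
    | zero => simp [stage]
    | succ S ih =>
      intro a ha
      rw [hsucc] at ha
      rcases h : ev x S with _ | b
      · rw [h] at ha
        exact ih a ha
      · rw [h] at ha
        simp only [step, Option.elim] at ha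
        split_ifs at ha with h'
        · exact ih a ha
        · rcases List.mem_cons.1 ha with rfl | ha
          · exact hsound x S a h
          · exact ih a ha
  refine ⟨stage, hstage, hnodup, fun x S T hST => ?_, fun k b π a hlen ha => ?_, fun x S => ?_⟩
  · induction T, hST using Nat.le_induction with
    | base => exact List.suffix_rfl
    | succ T _ ih => exact ih.trans (hsuffix x T)
  · obtain ⟨s, hs⟩ := hcomplete k b π a hlen ha
    refine ⟨s + 1, ?_⟩
    rw [hsucc, hs]
    simp only [step, Option.elim]
    split_ifs with h
    · obtain ⟨b, hb, rfl⟩ := h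
      exact hb
    · exact List.mem_cons_self
  · obtain ⟨s, hs, hcard⟩ := card_short_strings x.1
    rw [← List.toFinset_card_of_nodup (hnodup x S)]
    refine le_trans ?_ hcard
    -- Distinct outputs come from distinct programs, as `V` is single-valued; so there are at most
    -- as many outputs as short strings.
    choose! f hf hfV using hprog x S
    refine Finset.card_le_card_of_injOn f (fun a ha => hs _ (hf a (List.mem_toFinset.1 ha))) ?_
    intro a ha b hb hab
    have h1 := hfV a (List.mem_toFinset.1 ha)
    have h2 := hfV b (List.mem_toFinset.1 hb)
    rw [hab] at h1
    exact Part.mem_unique h1 h2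

/-! ### Rational numbers and grid points through their codes. -/

theorem encode_int_natCast (n : ℕ) : encode (n : ℤ) = 2 * n := by
  change Equiv.intEquivNat (n : ℤ) = 2 * n
  rfl

theorem encode_int_negSucc (n : ℕ) : encode (Int.negSucc n) = 2 * n + 1 := by
  change Equiv.intEquivNat (Int.negSucc n) = 2 * n + 1
  rfl

/-- Bounded search: the gcd is the greatest common divisor not exceeding a + b. For a = b = 0 the
search range contains only 0, which is the right value. -/
theorem primrec_gcd : Primrec₂ Nat.gcd := by
  have hdvd : PrimrecRel fun a b : ℕ => b % a = 0 :=
    Primrec.eq.comp (Primrec.nat_mod.comp Primrec.snd Primrec.fst) (Primrec.const 0)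
  have hp : PrimrecRel fun (x : ℕ × ℕ) (d : ℕ) => x.1 % d = 0 ∧ x.2 % d = 0 := by
    refine PrimrecPred.and ?_ ?_
    · exact hdvd.comp Primrec.snd (Primrec.fst.comp Primrec.fst)
    · exact hdvd.comp Primrec.snd (Primrec.snd.comp Primrec.fst)
  have hb : Primrec fun x : ℕ × ℕ => x.1 + x.2 := Primrec.nat_add.comp Primrec.fst Primrec.snd
  refine (Primrec.nat_findGreatest hb hp).of_eq fun x => ?_
  obtain ⟨a, b⟩ := x
  rcases Nat.eq_zero_or_pos (a + b) with h | h
  · obtain ⟨rfl, rfl⟩ : a = 0 ∧ b = 0 := by omega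
    rfl
  · refine (Nat.findGreatest_eq_iff).2 ⟨?_, fun _ => ⟨?_, ?_⟩, fun d hd hd' hdd => ?_⟩
    · rcases Nat.eq_zero_or_pos a with ha | ha
      · subst ha
        simp
      · exact (Nat.gcd_le_left b ha).trans (by simp)
    · exact Nat.mod_eq_zero_of_dvd (Nat.gcd_dvd_left a b)
    · exact Nat.mod_eq_zero_of_dvd (Nat.gcd_dvd_right a b)
    · have := Nat.dvd_gcd (Nat.dvd_of_mod_eq_zero hdd.1) (Nat.dvd_of_mod_eq_zero hdd.2)
      have hpos : 0 < Nat.gcd a b := by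
        rcases Nat.eq_zero_or_pos a with ha | ha
        · exact Nat.gcd_pos_of_pos_right _ (by omega)
        · exact Nat.gcd_pos_of_pos_left _ ha
      have hle := Nat.le_of_dvd hpos this
      simp only at hd
      omega

/-- From a code of a rational number `q`, the integer part of `2 ^ R * (q + A)`. -/
def codeFloor (A R c : ℕ) : ℕ :=
  (if c.unpair.1 % 2 = 0 then c.unpair.1 / 2 + A * c.unpair.2
    else A * c.unpair.2 - (c.unpair.1 / 2 + 1)) * 2 ^ R / c.unpair.2

/-- Even codes are the nonnegative numerators a, odd codes the negative ones -(a + 1). Truncated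
subtraction replaces q + A by its maximum with 0, and this does not affect the natural-number floor.
-/
theorem codeFloor_ratCode (A R : ℕ) (q : ℚ) :
    codeFloor A R (ratCode q) = ⌊(2 : ℚ) ^ R * (q + A)⌋₊ := by
  have hd : (0 : ℚ) < q.den := by exact_mod_cast q.den_pos
  have hq : (q.num : ℚ) = q * q.den := (Rat.mul_den_eq_num q).symm
  have key : ∀ m : ℕ, (m : ℚ) = max 0 ((q.num : ℚ) + A * q.den) →
      m * 2 ^ R / q.den = ⌊(2 : ℚ) ^ R * (q + A)⌋₊ := by
    intro m hm
    have h1 : (2 : ℚ) ^ R * max 0 (q + A) = ((m * 2 ^ R : ℕ) : ℚ) / (q.den : ℕ) := by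
      rw [eq_div_iff hd.ne']
      push_cast
      have hmax : max 0 ((q + A) * q.den) = max 0 (q + A) * (q.den : ℚ) := by
        rw [max_mul_of_nonneg _ _ hd.le, zero_mul]
      rw [hm, hq, ← add_mul, hmax]
      ring
    have h2 : ⌊(2 : ℚ) ^ R * max 0 (q + A)⌋₊ = ⌊(2 : ℚ) ^ R * (q + A)⌋₊ := by
      rcases le_total 0 (q + A) with h | h
      · rw [max_eq_right h]
      · rw [max_eq_left h, Nat.floor_of_nonpos (mul_nonpos_of_nonneg_of_nonpos (by positivity) h)]
        simp
    rw [← h2, h1, Nat.floor_div_eq_div]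
  rw [codeFloor, ratCode, Nat.unpair_pair]
  refine key _ ?_
  rcases hnum : q.num with a | a
  · rw [Int.ofNat_eq_natCast, encode_int_natCast]
    simp only [Nat.mul_mod_right, if_true]
    have : 2 * a / 2 = a := by omega
    rw [this, max_eq_right]
    · push_cast; ring
    · push_cast; positivity
  · rw [encode_int_negSucc]
    have h1 : ¬ (2 * a + 1) % 2 = 0 := by omega
    have h2 : (2 * a + 1) / 2 = a := by omega
    simp only [h1, if_false, h2]
    rw [Int.cast_negSucc]
    rcases le_total (a + 1) (A * q.den) with h | h
    · rw [Nat.cast_sub h, max_eq_right]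
      · push_cast; ring
      · have : ((a + 1 : ℕ) : ℚ) ≤ ((A * q.den : ℕ) : ℚ) := by exact_mod_cast h
        push_cast at this ⊢
        linarith
    · rw [Nat.sub_eq_zero_of_le h, max_eq_left]
      · simp
      · have : ((A * q.den : ℕ) : ℚ) ≤ ((a + 1 : ℕ) : ℚ) := by exact_mod_cast h
        push_cast at this ⊢
        linarith

theorem primrec_codeFloor (A : ℕ) : Primrec₂ (codeFloor A) := by
  have hu : Primrec fun x : ℕ × ℕ => x.2.unpair := Primrec.unpair.comp Primrec.snd
  have h1 : Primrec fun x : ℕ × ℕ => x.2.unpair.1 := Primrec.fst.comp hu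
  have h2 : Primrec fun x : ℕ × ℕ => x.2.unpair.2 := Primrec.snd.comp hu
  have hA := Primrec.nat_mul.comp (Primrec.const A) h2
  have hh := Primrec.nat_div.comp h1 (Primrec.const 2)
  refine Primrec.nat_div.comp (Primrec.nat_mul.comp (Primrec.ite (Primrec.eq.comp
    (Primrec.nat_mod.comp h1 (Primrec.const 2)) (Primrec.const 0)) (Primrec.nat_add.comp hh hA)
    (Primrec.nat_sub.comp hA (Primrec.succ.comp hh)))
    (primrec_nat_pow.comp (Primrec.const 2) Primrec.fst)) h2

/-- From a string that codes a rational vector `p`, the integer parts of `2 ^ R * (p i + A)`. -/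
def stringFloor (A : ℕ) {n : ℕ} (R : ℕ) (σ : List Bool) : Fin n → ℕ := fun i =>
  codeFloor A R (((decode (ofBits σ) : Option (List ℕ)).getD []).getD i 0)

theorem stringFloor_ratVecString (A R : ℕ) {n : ℕ} (p : Fin n → ℚ) (i : Fin n) :
    stringFloor A R (ratVecString p) i = ⌊(2 : ℚ) ^ R * (p i + A)⌋₊ := by
  rw [stringFloor, ratVecString, ofBits_bits, encodek, ← codeFloor_ratCode]
  simp

theorem primrec_stringFloor (A n : ℕ) :
    Primrec fun x : ℕ × List Bool => (stringFloor A x.1 x.2 : Fin n → ℕ) := by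
  refine Primrec.fin_curry.2 ?_
  have hl : Primrec fun x : (ℕ × List Bool) × Fin n =>
      (decode (ofBits x.1.2) : Option (List ℕ)).getD [] :=
    Primrec.option_getD.comp (Primrec.decode.comp (primrec_ofBits.comp
      (Primrec.snd.comp Primrec.fst))) (Primrec.const [])
  exact (primrec_codeFloor A).comp (Primrec.fst.comp Primrec.fst)
    ((Primrec.list_getD 0).comp hl (Primrec.fin_val.comp Primrec.snd))

/-- The point with index `G` of the grid of mesh `2 ^ (-R)` with the corner `(-A, …, -A)`. -/
def gridVec (A : ℕ) {n : ℕ} (R : ℕ) (G : Fin n → ℕ) : Fin n → ℚ := fun i =>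
  (G i : ℚ) / 2 ^ R - A

/-- The code of the rational number `g / 2 ^ R - A`. -/
def gridCode (A R g : ℕ) : ℕ :=
  let d := Nat.gcd ((g - A * 2 ^ R) + (A * 2 ^ R - g)) (2 ^ R)
  Nat.pair (if A * 2 ^ R ≤ g then 2 * ((g - A * 2 ^ R) / d)
    else 2 * ((A * 2 ^ R - g) / d - 1) + 1) (2 ^ R / d)

theorem ratCode_div {a : ℤ} {m D : ℕ} (hD : 0 < D) (hm : a.natAbs = m) :
    ratCode ((a : ℚ) / D) = Nat.pair (if 0 ≤ a then 2 * (m / Nat.gcd m D)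
      else 2 * (m / Nat.gcd m D - 1) + 1) (D / Nat.gcd m D) := by
  have hg : 0 < Nat.gcd m D := Nat.gcd_pos_of_pos_right _ hD
  obtain ⟨m', hm'⟩ := Nat.gcd_dvd_left m D
  obtain ⟨D', hD'⟩ := Nat.gcd_dvd_right m D
  have e1 : m / Nat.gcd m D = m' := Nat.div_eq_of_eq_mul_right hg hm'
  have e2 : D / Nat.gcd m D = D' := Nat.div_eq_of_eq_mul_right hg hD'
  have hcop : Nat.Coprime m' D' := by
    rw [← e1, ← e2]
    exact Nat.coprime_div_gcd_div_gcd hg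
  have hD'0 : 0 < D' := by
    rcases Nat.eq_zero_or_pos D' with h | h
    · rw [h] at hD'; omega
    · exact h
  have hgQ : ((Nat.gcd m D : ℕ) : ℚ) ≠ 0 := by exact_mod_cast hg.ne'
  have hdiv : ∀ s : ℤ, a = s * m → ((a : ℚ) / D) = ((s * m' : ℤ) : ℚ) / ((D' : ℤ) : ℚ) := by
    intro s hs
    have hm2 : (m : ℚ) = (Nat.gcd m D : ℕ) * m' := by exact_mod_cast hm'
    have hD2 : (D : ℚ) = (Nat.gcd m D : ℕ) * D' := by exact_mod_cast hD'
    rw [hs]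
    push_cast
    rw [hm2, hD2]
    have : (D' : ℚ) ≠ 0 := by exact_mod_cast hD'0.ne'
    field_simp
  rw [e1, e2, ratCode]
  split_ifs with h
  · have ha : a = 1 * m := by omega
    have hc : Nat.Coprime (1 * (m' : ℤ)).natAbs (D' : ℤ).natAbs := by simpa using hcop
    rw [hdiv 1 ha, Rat.num_div_eq_of_coprime (by exact_mod_cast hD'0) hc]
    have := Rat.den_div_eq_of_coprime (a := 1 * (m' : ℤ)) (b := D') (by exact_mod_cast hD'0) hc
    rw [one_mul, encode_int_natCast]
    rw [one_mul] at this
    congr 1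
    exact_mod_cast this
  · have ha : a = -1 * m := by omega
    have hm0 : m ≠ 0 := by omega
    have hm'0 : m' ≠ 0 := by rintro rfl; rw [mul_zero] at hm'; exact hm0 hm'
    have hc : Nat.Coprime (-1 * (m' : ℤ)).natAbs (D' : ℤ).natAbs := by simpa using hcop
    rw [hdiv (-1) ha, Rat.num_div_eq_of_coprime (by exact_mod_cast hD'0) hc]
    have := Rat.den_div_eq_of_coprime (a := -1 * (m' : ℤ)) (b := D') (by exact_mod_cast hD'0) hc
    have hneg : -1 * (m' : ℤ) = Int.negSucc (m' - 1) := by omega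
    rw [← encode_int_negSucc, ← hneg]
    congr 1
    exact_mod_cast this

theorem ratCode_grid (A R g : ℕ) : ratCode ((g : ℚ) / 2 ^ R - A) = gridCode A R g := by
  have h := ratCode_div (a := (g : ℤ) - A * 2 ^ R) (D := 2 ^ R)
    (m := (g - A * 2 ^ R) + (A * 2 ^ R - g)) (by positivity) (by
      have : ((A * 2 ^ R : ℕ) : ℤ) = A * 2 ^ R := by push_cast; ring
      rw [← this]
      omega)
  have e : ((g : ℚ) / 2 ^ R - A) = (((g : ℤ) - A * 2 ^ R : ℤ) : ℚ) / ((2 ^ R : ℕ) : ℚ) := by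
    push_cast
    field_simp
  rw [e, h, gridCode]
  have hiff : (0 : ℤ) ≤ (g : ℤ) - A * 2 ^ R ↔ A * 2 ^ R ≤ g := by
    rw [sub_nonneg]
    exact_mod_cast Iff.rfl
  by_cases hle : A * 2 ^ R ≤ g
  · have h0 : A * 2 ^ R - g = 0 := by omega
    rw [if_pos (hiff.2 hle), if_pos hle, h0, add_zero]
  · have h0 : g - A * 2 ^ R = 0 := by omega
    rw [if_neg fun h => hle (hiff.1 h), if_neg hle, h0, zero_add]

theorem primrec_gridCode (A : ℕ) : Primrec₂ (gridCode A) := by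
  have hp : Primrec fun x : ℕ × ℕ => 2 ^ x.1 := primrec_nat_pow.comp (Primrec.const 2) Primrec.fst
  have hA := Primrec.nat_mul.comp (Primrec.const A) hp
  have h1 := Primrec.nat_sub.comp (Primrec.snd (α := ℕ)) hA
  have h2 := Primrec.nat_sub.comp hA (Primrec.snd (α := ℕ))
  have hd := primrec_gcd.comp (Primrec.nat_add.comp h1 h2) hp
  refine Primrec₂.natPair.comp (Primrec.ite (Primrec.nat_le.comp hA Primrec.snd) ?_ ?_)
    (Primrec.nat_div.comp hp hd)
  · exact Primrec.nat_double.comp (Primrec.nat_div.comp h1 hd)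
  · exact Primrec.nat_double_succ.comp (Primrec.pred.comp (Primrec.nat_div.comp h2 hd))

/-- The string of a rational vector uses lowest terms; `gridCode` reduces the fraction by the gcd,
so a machine can pass from grid indices to the required output. -/
theorem primrec_ratVecString_gridVec (A n : ℕ) :
    Primrec fun x : ℕ × (Fin n → ℕ) => ratVecString (gridVec A x.1 x.2) := by
  have h : Primrec fun x : ℕ × (Fin n → ℕ) =>
      Nat.bits (encode (List.ofFn fun i => gridCode A x.1 (x.2 i))) := by
    refine primrec_bits.comp (Primrec.encode.comp (Primrec.list_ofFn fun i => ?_))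
    exact (primrec_gridCode A).comp Primrec.fst
      (Primrec.fin_app.comp Primrec.snd (Primrec.const i))
  refine h.of_eq fun x => ?_
  simp only [ratVecString, gridVec, ratCode_grid]

/-! ### First bounds for the complexity of strings and grid points. -/

section Basic

variable {U : OracleMachine}

theorem strK_le_of_mem {A : Set ℕ} {σ π : List Bool} (h : σ ∈ U A π []) :
    strK U A σ ≤ π.length :=
  Nat.sInf_le ⟨π, rfl, h⟩

theorem OracleMachine.IsUniversal.exists_strK_le (hU : U.IsUniversal)
    {F : Set ℕ → ℕ →. ℕ} (hF : OracleComputable F) :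
    ∃ C : ℕ, ∀ (A : Set ℕ) (h : ℕ) (ρ σ : List Bool),
      encode σ ∈ F A (Nat.pair h (encode ρ)) →
      strK U A σ ≤ ρ.length + 4 * (Nat.size h + Nat.size ρ.length) + C := by
  obtain ⟨C, hC⟩ := hU.exists_program hF
  refine ⟨C, fun A h ρ σ hσ => ?_⟩
  obtain ⟨π, hπ, hl⟩ := hC A h ρ σ hσ
  exact (strK_le_of_mem hπ).trans hl

/-- By universality some program prints σ, so the infimum is attained and is not the default value 0
of an empty set. -/
theorem OracleMachine.IsUniversal.exists_shortest (hU : U.IsUniversal) (A : Set ℕ)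
    (σ : List Bool) : ∃ π : List Bool, π.length = strK U A σ ∧ σ ∈ U A π [] := by
  obtain ⟨C, hC⟩ := hU.exists_program
    (OracleTotal.of_primrec (Primrec.snd.comp Primrec.unpair))
  obtain ⟨π, hπ, -⟩ := hC A 0 σ σ (by simp)
  exact Nat.sInf_mem (s := {l : ℕ | ∃ π : List Bool, π.length = l ∧ σ ∈ U A π []}) ⟨_, π, rfl, hπ⟩

/-- Ignoring the oracle costs at most a constant. -/
theorem OracleMachine.IsUniversal.exists_strK_le_empty (hU : U.IsUniversal) :
    ∃ C : ℕ, ∀ (A : Set ℕ) (σ : List Bool), strK U A σ ≤ strK U ∅ σ + C := by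
  obtain ⟨c, hc⟩ := hU.isComputable
  obtain ⟨c', hc'⟩ := OracleComputable.of_partrec c.eval_empty_partrec
  obtain ⟨C, hC⟩ := hU.simulates (fun _ => U ∅)
    ⟨c', fun A π τ => by rw [hc']; exact hc ∅ π τ⟩ fun _ => hU.isPrefixFree ∅
  refine ⟨C, fun A σ => ?_⟩
  obtain ⟨π, hπ, h⟩ := hU.exists_shortest ∅ σ
  obtain ⟨π', h', hl⟩ := hC A π [] σ h
  exact (strK_le_of_mem h').trans (hπ ▸ hl)

/-- The unrelativized machine as a partial recursive function. -/
theorem OracleMachine.IsUniversal.partrec (hU : U.IsUniversal) :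
    Partrec fun π : List Bool => U ∅ π [] := by
  obtain ⟨c, hc⟩ := hU.isComputable
  have h : Partrec (c.eval ∅) := Partrec.nat_iff.2 c.eval_empty_partrec
  have h' : Partrec fun π : List Bool => c.eval ∅ (Nat.pair (encode π) (encode ([] : List Bool))) :=
    h.comp (Primrec.to_comp (Primrec₂.natPair.comp Primrec.encode (Primrec.const _)))
  have h'' : Partrec fun π : List Bool => (U ∅ π []).map encode := by
    refine h'.of_eq fun π => ?_
    rw [hc]
  exact Partrec.map_encode_iff.1 h''

theorem OracleMachine.IsUniversal.exists_strK_le_of_partrec (hU : U.IsUniversal)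
    {β : Type*} [Primcodable β] {f : β × List Bool →. List Bool} (hf : Partrec f) :
    ∃ C : ℕ, ∀ (B : Set ℕ) (b : β) (ρ σ : List Bool), σ ∈ f (b, ρ) →
      strK U B σ ≤ ρ.length + 4 * (Nat.size (encode b) + Nat.size ρ.length) + C := by
  obtain ⟨C, hC⟩ := hU.exists_strK_le (OracleComputable.of_partrec hf)
  refine ⟨C, fun B b ρ σ hσ => hC B _ ρ σ ?_⟩
  refine Part.mem_bind_iff.2 ⟨(b, ρ), ?_, Part.mem_map _ hσ⟩
  rw [← encode_prod_val, encodek, Part.coe_some]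
  exact Part.mem_some _

/-- A grid point that is computed from a parameter and a string is as complex as the string, up to
a logarithmic term. -/
theorem OracleMachine.IsUniversal.exists_ratVecK_gridVec_le (hU : U.IsUniversal) (A : ℕ) {n : ℕ}
    {β : Type*} [Primcodable β] {f : β × List Bool →. ℕ × (Fin n → ℕ)} (hf : Partrec f) :
    ∃ C : ℕ, ∀ (B : Set ℕ) (b : β) (ρ : List Bool) (R : ℕ) (G : Fin n → ℕ),
      (R, G) ∈ f (b, ρ) →
      ratVecK U B (gridVec A R G) ≤
        ρ.length + 4 * (Nat.size (encode b) + Nat.size ρ.length) + C := by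
  have hstr : Computable fun y : ℕ × (Fin n → ℕ) => ratVecString (gridVec A y.1 y.2) :=
    (primrec_ratVecString_gridVec A n).to_comp
  obtain ⟨C, hC⟩ := hU.exists_strK_le_of_partrec (hf.map (hstr.comp Computable.snd).to₂)
  refine ⟨C, fun B b ρ R G hG => hC B b ρ _ ?_⟩
  exact Part.mem_map_iff _ |>.2 ⟨(R, G), hG, rfl⟩

end Basic

/-- New elements are added in front, so in the reversed lists each element keeps its index for ever.
A search through the stages therefore recovers it from the index alone, without the stage. -/
theorem exists_mem_rfindOpt_reverse {α : Type*} {L : ℕ → List α}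
    (hL : ∀ S T, S ≤ T → L S <:+ L T) {S : ℕ} {a : α} (ha : a ∈ L S) :
    ∃ i < (L S).length, a ∈ Nat.rfindOpt fun T => (L T).reverse[i]? := by
  obtain ⟨i, hi, hia⟩ := List.mem_iff_getElem.1 (List.mem_reverse.2 ha)
  refine ⟨i, by simpa using hi, ?_⟩
  refine (Nat.rfindOpt_mono ?_).2 ⟨S, ?_⟩
  · intro b m k hmk hb
    obtain ⟨t, ht⟩ := List.reverse_prefix.2 (hL m k hmk)
    rw [← ht]
    rw [Option.mem_def] at hb ⊢
    rw [List.getElem?_append_left, hb]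
    exact (List.getElem?_eq_some_iff.1 hb).1
  · rw [Option.mem_def, List.getElem?_eq_getElem hi, hia]

/-! ### Tubes as a finite, decidable family. -/

section Tubes

theorem primrec_fin_sum {α : Type*} [Primcodable α] {n : ℕ} {f : Fin n → α → ℕ}
    (hf : ∀ i, Primrec (f i)) : Primrec fun a => ∑ i, f i a :=
  (primrec_list_sum.comp (Primrec.list_ofFn hf)).of_eq fun a => by rw [List.sum_ofFn]

theorem primrecPred_forall_fin {α : Type*} [Primcodable α] {n : ℕ} {p : Fin n → α → Prop}
    (hp : ∀ i, PrimrecPred (p i)) : PrimrecPred fun a => ∀ i, p i a := by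
  classical
  have h : Primrec fun a => ∑ i, if p i a then 0 else 1 :=
    primrec_fin_sum fun i => Primrec.ite (hp i) (Primrec.const 0) (Primrec.const 1)
  refine (Primrec.eq.comp h (Primrec.const 0)).of_eq fun a => ?_
  simp

variable {n : ℕ}

/-- The grid points in a coarse box that satisfy a linear equation approximately. -/
def InTube (a w c : ℕ) (lo : Fin n → ℕ) (R : ℕ) (E : Fin n → ℕ) (b : ℕ) (G : Fin n → ℕ) : Prop :=
  (∀ i, lo i * 2 ^ R ≤ G i * 2 ^ c ∧ G i * 2 ^ c < (lo i + 2) * 2 ^ R) ∧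
    (∑ i, E i * G i) + 4 ^ R * a ≤ 2 ^ R * ((∑ i, G i) + b + w) ∧
    2 ^ R * ((∑ i, G i) + b) ≤ (∑ i, E i * G i) + 4 ^ R * a + 2 ^ R * w

instance (a w c : ℕ) (lo : Fin n → ℕ) (R : ℕ) (E : Fin n → ℕ) (b : ℕ) (G : Fin n → ℕ) :
    Decidable (InTube a w c lo R E b G) := by
  unfold InTube
  infer_instance

/-- In the definition of a tube all data are shifted to natural numbers and negative terms are moved
to the other side, so no truncated subtraction occurs and primitive recursiveness is immediate. -/
theorem primrecPred_inTube (a w c : ℕ) (lo : Fin n → ℕ) :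
    PrimrecPred fun x : ℕ × (Fin n → ℕ) × ℕ × (Fin n → ℕ) =>
      InTube a w c lo x.1 x.2.1 x.2.2.1 x.2.2.2 := by
  let τ := ℕ × (Fin n → ℕ) × ℕ × (Fin n → ℕ)
  have hR : Primrec fun x : τ => 2 ^ x.1 := primrec_nat_pow.comp (Primrec.const 2) Primrec.fst
  have h4 : Primrec fun x : τ => 4 ^ x.1 * a :=
    Primrec.nat_mul.comp (primrec_nat_pow.comp (Primrec.const 4) Primrec.fst) (Primrec.const a)
  have hE : ∀ i, Primrec fun x : τ => x.2.1 i := fun i =>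
    Primrec.fin_app.comp (Primrec.fst.comp Primrec.snd) (Primrec.const i)
  have hb : Primrec fun x : τ => x.2.2.1 := Primrec.fst.comp (Primrec.snd.comp Primrec.snd)
  have hG : ∀ i, Primrec fun x : τ => x.2.2.2 i := fun i =>
    Primrec.fin_app.comp (Primrec.snd.comp (Primrec.snd.comp Primrec.snd)) (Primrec.const i)
  have hEG := primrec_fin_sum fun i => Primrec.nat_mul.comp (hE i) (hG i)
  have hS := primrec_fin_sum hG
  refine PrimrecPred.and (primrecPred_forall_fin fun i => PrimrecPred.and ?_ ?_)
    (PrimrecPred.and ?_ ?_)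
  · exact Primrec.nat_le.comp (Primrec.nat_mul.comp (Primrec.const _) hR)
      (Primrec.nat_mul.comp (hG i) (Primrec.const _))
  · exact Primrec.nat_lt.comp (Primrec.nat_mul.comp (hG i) (Primrec.const _))
      (Primrec.nat_mul.comp (Primrec.const _) hR)
  · exact Primrec.nat_le.comp (Primrec.nat_add.comp hEG h4) (Primrec.nat_mul.comp hR
      (Primrec.nat_add.comp (Primrec.nat_add.comp hS hb) (Primrec.const w)))
  · exact Primrec.nat_le.comp (Primrec.nat_mul.comp hR (Primrec.nat_add.comp hS hb))
      (Primrec.nat_add.comp (Primrec.nat_add.comp hEG h4)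
        (Primrec.nat_mul.comp hR (Primrec.const w)))

/-- The `i`-th digit of `j` in base `Q`. -/
def digit (Q j i : ℕ) : ℕ := j / Q ^ i % Q

/-- Membership in the `j`-th tube, whose parameters are the digits of `j` in base `2 ^ (R + s)`. -/
def tubeMem (a w c : ℕ) (lo : Fin n → ℕ) (s R j : ℕ) (G : Fin n → ℕ) : Bool :=
  decide (InTube a w c lo R (fun i => digit (2 ^ (R + s)) j i) (digit (2 ^ (R + s)) j n) G)

theorem primrec_tubeMem (a w c : ℕ) (lo : Fin n → ℕ) (s : ℕ) :
    Primrec fun x : ℕ × ℕ × (Fin n → ℕ) => tubeMem a w c lo s x.1 x.2.1 x.2.2 := by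
  have hQ : Primrec fun x : ℕ × ℕ × (Fin n → ℕ) => 2 ^ (x.1 + s) :=
    primrec_nat_pow.comp (Primrec.const 2) (Primrec.nat_add.comp Primrec.fst (Primrec.const s))
  have hd : ∀ i, Primrec fun x : ℕ × ℕ × (Fin n → ℕ) => digit (2 ^ (x.1 + s)) x.2.1 i := fun i =>
    Primrec.nat_mod.comp (Primrec.nat_div.comp (Primrec.fst.comp Primrec.snd)
      (primrec_nat_pow.comp hQ (Primrec.const i))) hQ
  have hE : Primrec fun x : ℕ × ℕ × (Fin n → ℕ) => fun i : Fin n =>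
      digit (2 ^ (x.1 + s)) x.2.1 i :=
    Primrec.fin_curry.2 ((Primrec.fin_curry₁.2 fun i => hd i).comp₂ Primrec₂.right Primrec₂.left)
  have hx := Primrec.pair (Primrec.fst (α := ℕ)) (Primrec.pair hE
    (Primrec.pair (hd n) (Primrec.snd.comp Primrec.snd)))
  exact primrecPred_iff_primrec_decide.1 ((primrecPred_inTube a w c lo).comp hx)

theorem exists_digits {Q : ℕ} (hQ : 0 < Q) (m : ℕ) (f : ℕ → ℕ) (hf : ∀ i < m, f i < Q) :
    ∃ j < Q ^ m, ∀ i < m, digit Q j i = f i := by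
  induction m generalizing f with
  | zero => exact ⟨0, by simp, by simp⟩
  | succ m ih =>
    obtain ⟨j, hj, h⟩ := ih (fun i => f (i + 1)) fun i hi => hf (i + 1) (by omega)
    have h0 := hf 0 (by omega)
    refine ⟨f 0 + Q * j, ?_, fun i hi => ?_⟩
    · have : Q * (j + 1) ≤ Q * Q ^ m := Nat.mul_le_mul_left Q hj
      rw [pow_succ']
      rw [mul_add] at this
      omega
    · rcases i with _ | i
      · simp [digit, Nat.mod_eq_of_lt h0]
      · have := h i (by omega)
        rw [digit] at this ⊢
        rw [pow_succ', ← Nat.div_div_eq_div_mul, Nat.add_mul_div_left _ _ hQ,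
          Nat.div_eq_of_lt h0, zero_add, this]

end Tubes

/-! ### Reading the digits of a direction from the oracle. -/

section Digits

open Classical in
/-- The digits of a coordinate in the interval `[-1, 1]`, shifted by one, as read from an oracle. -/
noncomputable def oracleDigits (i : ℕ) (B : Set ℕ) (k : ℕ) : ℕ :=
  Nat.rec
    ((if 2 * Nat.pair i (Nat.pair 0 0) + 1 ∈ B then 1 else 0) +
      2 * (if 2 * Nat.pair i (Nat.pair 0 2) + 1 ∈ B then 1 else 0))
    (fun y d => 2 * d + (if 2 * Nat.pair i (Nat.pair (y + 1) 0) + 1 ∈ B then 1 else 0)) k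

theorem oracleTotal_oracleDigits (i : ℕ) : OracleTotal (oracleDigits i) := by
  classical
  have hconst : ∀ m : ℕ, OracleTotal fun _ _ => m := fun m =>
    OracleTotal.of_primrec (Primrec.const m)
  have h1 : OracleTotal fun B _ =>
      (if 2 * Nat.pair i (Nat.pair 0 0) + 1 ∈ B then 1 else 0) +
        2 * (if 2 * Nat.pair i (Nat.pair 0 2) + 1 ∈ B then 1 else 0) :=
    OracleTotal.comp₂ Primrec.nat_add (hconst _).query
      (OracleTotal.comp₂ Primrec.nat_mul (hconst 2) (hconst _).query)
  have hy : Primrec fun x : ℕ => 2 * Nat.pair i (Nat.pair (x.unpair.1 + 1) 0) + 1 :=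
    Primrec.nat_double_succ.comp (Primrec₂.natPair.comp (Primrec.const i)
      (Primrec₂.natPair.comp (Primrec.succ.comp (Primrec.fst.comp Primrec.unpair))
        (Primrec.const 0)))
  have h2 : OracleTotal fun B x => 2 * x.unpair.2 +
      (if 2 * Nat.pair i (Nat.pair (x.unpair.1 + 1) 0) + 1 ∈ B then 1 else 0) :=
    OracleTotal.comp₂ Primrec.nat_add
      (OracleTotal.of_primrec (Primrec.nat_double.comp (Primrec.snd.comp Primrec.unpair)))
      (OracleTotal.of_primrec hy).query
  have h3 := OracleTotal.rec h1 h2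
  simp only [Nat.unpair_pair] at h3
  exact h3

theorem oracleTotal_encode_map {l : List (Set ℕ → ℕ → ℕ)} (hl : ∀ f ∈ l, OracleTotal f) :
    OracleTotal fun B k => encode (l.map fun f => f B k) := by
  induction l with
  | nil => exact OracleTotal.of_primrec (Primrec.const _)
  | cons f l ih =>
    have h := OracleTotal.comp₂ (p := fun a b => (Nat.pair a b).succ)
      (Primrec.succ.comp₂ Primrec₂.natPair) (hl f List.mem_cons_self)
      (ih fun g hg => hl g (List.mem_cons_of_mem f hg))
    exact h

/-- The digits of a direction up to position `R`, one number for every coordinate. -/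
noncomputable def dirDigits {n : ℕ} (e : EuclideanSpace ℝ (Fin n)) (R : ℕ) (i : Fin n) : ℕ :=
  ⌊(2 : ℝ) ^ R * (e i + 1)⌋₊

theorem mem_joinOracle_odd (A B : Set ℕ) (k : ℕ) : 2 * k + 1 ∈ joinOracle A B ↔ k ∈ B := by
  constructor
  · rintro (⟨j, -, h⟩ | ⟨j, hj, h⟩)
    · omega
    · obtain rfl : k = j := by omega
      exact hj
  · exact fun h => Or.inr ⟨k, h, rfl⟩

theorem pair_zero_mem_pointOracle {n : ℕ} (e : EuclideanSpace ℝ (Fin n)) (i : Fin n) (m : ℕ) :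
    Nat.pair i (Nat.pair 0 m) ∈ pointOracle e ↔ m = encode ⌊e i⌋ := by
  constructor
  · rintro ⟨j, h | ⟨k, hk, h, -⟩⟩
    · simp only [Nat.pair_eq_pair] at h
      obtain ⟨h1, -, h2⟩ := h
      obtain rfl : i = j := Fin.ext h1
      exact h2
    · simp only [Nat.pair_eq_pair] at h
      omega
  · rintro rfl
    exact ⟨i, Or.inl rfl⟩

theorem pair_succ_mem_pointOracle {n : ℕ} (e : EuclideanSpace ℝ (Fin n)) (i : Fin n) (k : ℕ) :
    Nat.pair i (Nat.pair (k + 1) 0) ∈ pointOracle e ↔ Odd ⌊(2 : ℝ) ^ (k + 1) * e i⌋ := by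
  constructor
  · rintro ⟨j, h | ⟨k', hk, h, ho⟩⟩
    · simp only [Nat.pair_eq_pair] at h
      omega
    · simp only [Nat.pair_eq_pair, and_true] at h
      obtain ⟨h1, rfl⟩ := h
      obtain rfl : i = j := Fin.ext h1
      exact ho
  · exact fun h => ⟨i, Or.inr ⟨k + 1, by omega, rfl, h⟩⟩

/-- Passing from ⌊y⌋ to ⌊2y⌋ doubles the value and adds the parity bit of ⌊2y⌋, which is exactly
what the oracle stores. -/
theorem oracleDigits_eq {n : ℕ} (A : Set ℕ) (e : EuclideanSpace ℝ (Fin n)) (i : Fin n)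
    (he : |e i| ≤ 1) (R : ℕ) :
    oracleDigits i (joinOracle A (pointOracle e)) R = dirDigits e R i := by
  obtain ⟨h1, h2⟩ := abs_le.1 he
  have key : ((oracleDigits i (joinOracle A (pointOracle e)) R : ℕ) : ℤ) =
      ⌊(2 : ℝ) ^ R * e i⌋ + 2 ^ R := by
    induction R with
    | zero =>
      simp only [oracleDigits, mem_joinOracle_odd, pair_zero_mem_pointOracle, pow_zero, one_mul]
      have hlo : -1 ≤ ⌊e i⌋ := Int.le_floor.2 (by push_cast; exact h1)
      have hhi : ⌊e i⌋ ≤ 1 := by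
        have : (⌊e i⌋ : ℝ) ≤ 1 := (Int.floor_le _).trans h2
        exact_mod_cast this
      -- The codes of -1, 0, 1 are 1, 0, 2. After the shift by one they must contribute 0, 1, 2, so
      -- the code 1 is never queried.
      have hcases : ⌊e i⌋ = -1 ∨ ⌊e i⌋ = 0 ∨ ⌊e i⌋ = 1 := by omega
      rcases hcases with h | h | h <;> rw [h]
      · have : encode (-1 : ℤ) = 1 := rfl
        simp [this]
      · have : encode (0 : ℤ) = 0 := rfl
        simp [this]
      · have : encode (1 : ℤ) = 2 := rfl
        simp [this]
    | succ R ih =>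
      have hstep : oracleDigits i (joinOracle A (pointOracle e)) (R + 1) =
          2 * oracleDigits i (joinOracle A (pointOracle e)) R +
          (open Classical in if Odd ⌊(2 : ℝ) ^ (R + 1) * e i⌋ then 1 else 0) := by
        simp only [oracleDigits, mem_joinOracle_odd, pair_succ_mem_pointOracle]
      rw [hstep]
      push_cast
      rw [ih]
      have hf1 := Int.floor_le ((2 : ℝ) ^ R * e i)
      have hf2 := Int.lt_floor_add_one ((2 : ℝ) ^ R * e i)
      have hp : (2 : ℝ) ^ (R + 1) * e i = 2 * ((2 : ℝ) ^ R * e i) := by ring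
      have hge : 2 * ⌊(2 : ℝ) ^ R * e i⌋ ≤ ⌊(2 : ℝ) ^ (R + 1) * e i⌋ := by
        rw [Int.le_floor, hp]
        push_cast
        linarith
      have hlt : ⌊(2 : ℝ) ^ (R + 1) * e i⌋ < 2 * ⌊(2 : ℝ) ^ R * e i⌋ + 2 := by
        rw [Int.floor_lt, hp]
        push_cast
        linarith
      have hpow : (2 : ℤ) ^ (R + 1) = 2 * 2 ^ R := by ring
      rw [hpow]
      split_ifs with hodd
      · obtain ⟨t, ht⟩ := hodd
        push_cast
        omega
      · rw [Int.not_odd_iff_even] at hodd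
        obtain ⟨t, ht⟩ := hodd
        push_cast
        omega
  have hfl : (dirDigits e R i : ℤ) = ⌊(2 : ℝ) ^ R * (e i + 1)⌋ :=
    Int.natCast_floor_eq_floor (mul_nonneg (by positivity) (by linarith))
  have h3 : ⌊(2 : ℝ) ^ R * (e i + 1)⌋ = ⌊(2 : ℝ) ^ R * e i⌋ + 2 ^ R := by
    rw [mul_add, mul_one]
    have : (2 : ℝ) ^ R = ((2 ^ R : ℤ) : ℝ) := by push_cast; rfl
    rw [this, Int.floor_add_intCast]
  rw [← hfl] at h3
  rw [← h3] at key
  exact_mod_cast key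

end Digits

/-! ### Describing an element of a growing list by its index. -/

section Machines

variable {U : OracleMachine} {n : ℕ}

/-- The element with a given index in a growing list, displaced by `p - q`. -/
def listOutput {β : Type*} (R : β → ℕ) (L : β → ℕ → List (Fin n → ℕ))
    (y : (β × (Fin n → ℕ) × (Fin n → ℕ)) × ℕ) : Part (ℕ × (Fin n → ℕ)) :=
  (Nat.rfindOpt fun T => (L y.1.1 T).reverse[y.2]?).map fun G =>
    (R y.1.1, fun i => G i + y.1.2.1 i - y.1.2.2 i)

theorem partrec_listOutput {β : Type*} [Primcodable β] {R : β → ℕ}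
    {L : β → ℕ → List (Fin n → ℕ)} (hR : Primrec R) (hL : Primrec₂ L) :
    Partrec (listOutput R L) := by
  refine Partrec.map (Partrec.rfindOpt (Primrec.to_comp ?_)) (Primrec.to_comp ?_)
  · exact Primrec.list_getElem?.comp (Primrec.list_reverse.comp
      (hL.comp (Primrec.fst.comp (Primrec.fst.comp Primrec.fst)) Primrec.snd))
      (Primrec.snd.comp Primrec.fst)
  · refine Primrec.pair (hR.comp (Primrec.fst.comp (Primrec.fst.comp Primrec.fst)))
      (Primrec.fin_curry.2 ?_)
    have hx : Primrec fun y : (((β × (Fin n → ℕ) × (Fin n → ℕ)) × ℕ) × (Fin n → ℕ)) × Fin n =>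
        y.1.1.1.2 := Primrec.snd.comp (Primrec.fst.comp (Primrec.fst.comp Primrec.fst))
    refine Primrec.nat_sub.comp (Primrec.nat_add.comp ?_ ?_) ?_
    · exact Primrec.fin_app.comp (Primrec.snd.comp Primrec.fst) Primrec.snd
    · exact Primrec.fin_app.comp (Primrec.fst.comp hx) Primrec.snd
    · exact Primrec.fin_app.comp (Primrec.snd.comp hx) Primrec.snd

theorem exists_mem_listOutput {β : Type*} {R : β → ℕ} {L : β → ℕ → List (Fin n → ℕ)}
    (hmono : ∀ b S T, S ≤ T → L b S <:+ L b T) {b : β} {S m : ℕ} {G : Fin n → ℕ}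
    (hG : G ∈ L b S) (hm : (L b S).length ≤ 2 ^ m) :
    ∃ ρ : List Bool, ρ.length = m ∧ ∀ p q : Fin n → ℕ,
      (R b, fun i => G i + p i - q i) ∈ listOutput R L ((b, p, q), ofBits ρ) := by
  obtain ⟨i, hi, hiG⟩ := exists_mem_rfindOpt_reverse (L := L b) (hmono b) hG
  obtain ⟨ρ, hρ, rfl⟩ := exists_ofBits_eq m (hi.trans_le hm)
  exact ⟨ρ, hρ, fun p q => (Part.mem_map_iff _).2 ⟨G, hiG, rfl⟩⟩

/-- The displacements range over a finite set, so their codes have bounded size and cost only a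
constant in a header. -/
theorem exists_size_encode_le (n M : ℕ) :
    ∃ D : ℕ, ∀ (β : Type) [Primcodable β] (b : β) (p q : Fin n → ℕ), (∀ i, p i ≤ M) →
      (∀ i, q i ≤ M) →
      Nat.size ((Primcodable.toEncodable (α := β × (Fin n → ℕ) × (Fin n → ℕ))).encode
        (b, p, q)) ≤ 2 * Nat.size (encode b) + D := by
  have hfin : {p : Fin n → ℕ | ∀ i, p i ≤ M}.Finite := by
    refine (Set.finite_Iic (fun _ : Fin n => M)).subset fun p hp => hp
  obtain ⟨D, hD⟩ := (hfin.image fun p =>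
    Nat.size ((Primcodable.toEncodable (α := Fin n → ℕ)).encode p)).bddAbove
  refine ⟨8 * D, fun β _ b p q hp hq => ?_⟩
  have h1 := hD (Set.mem_image_of_mem _ hp)
  have h2 := hD (Set.mem_image_of_mem _ hq)
  have h3 := size_pair_le (encode b) (Nat.pair
    ((Primcodable.toEncodable (α := Fin n → ℕ)).encode p)
    ((Primcodable.toEncodable (α := Fin n → ℕ)).encode q))
  have h4 := size_pair_le ((Primcodable.toEncodable (α := Fin n → ℕ)).encode p)
    ((Primcodable.toEncodable (α := Fin n → ℕ)).encode q)
  refine h3.trans ?_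
  omega

/-- The index of `G` takes m bits and everything else goes into the header. The bounded displacement
is included so that the bound covers all neighbours of `G` at once, which makes rounding harmless
later. -/
theorem OracleMachine.IsUniversal.exists_ratVecK_le_of_mem_list (hU : U.IsUniversal) (A M : ℕ)
    {β : Type} [Primcodable β] {R : β → ℕ} {L : β → ℕ → List (Fin n → ℕ)} (hR : Primrec R)
    (hL : Primrec₂ L) (hmono : ∀ b S T, S ≤ T → L b S <:+ L b T) :
    ∃ C : ℕ, ∀ (B : Set ℕ) (b : β) (S m : ℕ) (G : Fin n → ℕ), G ∈ L b S →
      (L b S).length ≤ 2 ^ m → ∀ p q : Fin n → ℕ, (∀ i, p i ≤ M) → (∀ i, q i ≤ M) →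
        ratVecK U B (gridVec A (R b) fun i => G i + p i - q i) ≤
          m + 8 * (Nat.size (encode b) + Nat.size m) + C := by
  obtain ⟨C, hC⟩ := hU.exists_ratVecK_gridVec_le A
    ((partrec_listOutput hR hL).comp (Computable.pair Computable.fst
      (primrec_ofBits.to_comp.comp Computable.snd)))
  obtain ⟨D, hD⟩ := exists_size_encode_le n M
  refine ⟨C + 4 * D, fun B b S m G hG hm p q hp hq => ?_⟩
  obtain ⟨ρ, rfl, h⟩ := exists_mem_listOutput (R := R) hmono hG hm
  have h1 := hC B (b, p, q) ρ _ _ (h p q)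
  have h2 := hD β b p q hp hq
  refine h1.trans ?_
  omega

/-- A tube that contains many points of an enumeration contains one of small complexity. -/
theorem OracleMachine.IsUniversal.exists_simple_of_many (hU : U.IsUniversal)
    {stage : ℕ × ℕ → ℕ → List (Fin n → ℕ)} (hst : Primrec₂ stage)
    (hsuf : ∀ x S T, S ≤ T → stage x S <:+ stage x T)
    (hlen : ∀ x S, (stage x S).length ≤ 2 ^ (x.1 + 1)) (A M a w c : ℕ) (lo : Fin n → ℕ) (s : ℕ) :
    ∃ C : ℕ, ∀ (B : Set ℕ) (R k x S j m : ℕ), j < 2 ^ ((R + s) * (n + 1)) →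
      2 * 2 ^ ((R + s) * (n + 1)) < 2 ^ m →
      2 ^ x * m ≤ (stage (k, R) S).countP (tubeMem a w c lo s R j) →
      x ≤ k + 2 ∧ ∃ G, tubeMem a w c lo s R j G ∧
        ∀ p q : Fin n → ℕ, (∀ i, p i ≤ M) → (∀ i, q i ≤ M) →
          ratVecK U B (gridVec A R fun i => G i + p i - q i) ≤ (k + 2 - x) +
            8 * (Nat.size (Nat.pair R (Nat.pair k x)) + Nat.size (k + 2 - x)) + C := by
  have hpicks : Primrec fun y : (ℕ × ℕ × ℕ) × List (Fin n → ℕ) =>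
      picks (tubeMem a w c lo s y.1.1) (2 ^ y.1.2.2) (2 ^ (y.1.2.1 + 1))
        (2 ^ ((y.1.1 + s) * (n + 1))) y.2 := by
    refine primrec_picks (γ := ℕ × ℕ × ℕ) (mem := fun y => tubeMem a w c lo s y.1)
      (X := fun y => 2 ^ y.2.2) (N := fun y => 2 ^ (y.2.1 + 1))
      (J := fun y => 2 ^ ((y.1 + s) * (n + 1))) ?_ ?_ ?_ ?_
    · exact (primrec_tubeMem a w c lo s).comp (Primrec.pair (Primrec.fst.comp Primrec.fst)
        Primrec.snd)
    · exact primrec_nat_pow.comp (Primrec.const 2) (Primrec.snd.comp Primrec.snd)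
    · exact primrec_nat_pow.comp (Primrec.const 2)
        (Primrec.succ.comp (Primrec.fst.comp Primrec.snd))
    · exact primrec_nat_pow.comp (Primrec.const 2) (Primrec.nat_mul.comp
        (Primrec.nat_add.comp Primrec.fst (Primrec.const s)) (Primrec.const (n + 1)))
  have hstage : Primrec fun y : (ℕ × ℕ × ℕ) × ℕ => stage (y.1.2.1, y.1.1) y.2 :=
    hst.comp (Primrec.pair (Primrec.fst.comp (Primrec.snd.comp Primrec.fst))
      (Primrec.fst.comp Primrec.fst)) Primrec.snd
  have hL : Primrec₂ fun (y : ℕ × ℕ × ℕ) (T : ℕ) =>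
      picks (tubeMem a w c lo s y.1) (2 ^ y.2.2) (2 ^ (y.2.1 + 1))
        (2 ^ ((y.1 + s) * (n + 1))) (stage (y.2.1, y.1) T) :=
    hpicks.comp (Primrec.pair Primrec.fst hstage)
  -- The list of picks depends on R, k and x only, not on the tube `j`; a picked point is therefore
  -- described without any reference to the direction.
  obtain ⟨C, hC⟩ := hU.exists_ratVecK_le_of_mem_list A M (Primrec.fst (α := ℕ) (β := ℕ × ℕ))
    hL fun b S T hST => picks_suffix _ _ _ _ (hsuf _ S T hST)
  refine ⟨C, fun B R k x S j m hj hm hcount => ?_⟩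
  obtain ⟨G, hG, hGj⟩ := exists_mem_picks (N := 2 ^ (k + 1)) (by positivity : 0 < 2 ^ x)
    (by positivity) (hlen (k, R) S) hj hm hcount
  have hlen' := length_picks_mul_le (mem := tubeMem a w c lo s R) (N := 2 ^ (k + 1))
    (J := 2 ^ ((R + s) * (n + 1))) (by positivity : 0 < 2 ^ x) (by positivity) (hlen (k, R) S)
  have h2 : 2 * 2 ^ (k + 1) = 2 ^ (k + 2) := by ring
  rw [h2] at hlen'
  -- At least one point was picked, and the number of picks times 2^x is at most 2^(k+2).
  have hx : x ≤ k + 2 := by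
    refine (Nat.pow_le_pow_iff_right (le_refl 2)).1 (le_trans ?_ hlen')
    exact Nat.le_mul_of_pos_left _ (List.length_pos_of_mem hG)
  refine ⟨hx, G, hGj, hC B (R, k, x) S (k + 2 - x) G hG ?_⟩
  refine Nat.le_of_mul_le_mul_right ?_ (by positivity : 0 < 2 ^ x)
  rwa [← pow_add, Nat.sub_add_cancel hx]

end Machines

/-! ### Descriptions that run a program with the oracle. -/

section OracleMachines

variable {U : OracleMachine} {n : ℕ}

theorem mem_pair_part {p q : Part ℕ} {a b : ℕ} (ha : a ∈ p) (hb : b ∈ q) :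
    Nat.pair a b ∈ Nat.pair <$> p <*> q := by
  rw [← Part.eq_some_iff] at ha hb
  subst ha hb
  simp [Seq.seq]

/-- A description may consist of a program that is run with the oracle, and further data. The
oracle is also consulted for the digits of a direction. -/
theorem OracleMachine.IsUniversal.exists_strK_le_of_query (hU : U.IsUniversal)
    {γ : Type*} [Primcodable γ] {len prec : γ → ℕ} (hlen : Primrec len) (hprec : Primrec prec)
    {post : (γ × List Bool) × List Bool × List ℕ →. List Bool} (hpost : Partrec post) :
    ∃ C : ℕ, ∀ (B : Set ℕ) (e : EuclideanSpace ℝ (Fin n)), (∀ i, |e i| ≤ 1) →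
      ∀ (g : γ) (π ρ u σ : List Bool), π.length = len g →
      u ∈ U (joinOracle B (pointOracle e)) π [] →
      σ ∈ post ((g, ρ), u, List.ofFn (dirDigits e (prec g))) →
      strK U (joinOracle B (pointOracle e)) σ ≤ π.length + ρ.length +
        4 * (Nat.size (encode g) + Nat.size (π.length + ρ.length)) + C := by
  have hdecode : ∀ {f : γ × List Bool → ℕ}, Primrec f →
      Primrec fun x : ℕ => ((decode x : Option (γ × List Bool)).map f).getD 0 := fun hf =>
    Primrec.option_getD.comp (Primrec.option_map Primrec.decode (hf.comp Primrec.snd).to₂)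
      (Primrec.const 0)
  -- The description is π ++ ρ with the length of π stored in the header, so `take` and `drop`
  -- separate the two parts.
  have hpre : Primrec fun y : γ × List Bool =>
      Nat.pair (encode (y.2.take (len y.1))) (encode ([] : List Bool)) :=
    Primrec₂.natPair.comp (Primrec.encode.comp (Primrec.list_take.comp
      (hlen.comp Primrec.fst) Primrec.snd)) (Primrec.const _)
  obtain ⟨cU, hcU⟩ := hU.isComputable
  have hUc : OracleComputable fun B x => (Part.some (((decode x : Option (γ × List Bool)).map
      fun y => Nat.pair (encode (y.2.take (len y.1))) (encode ([] : List Bool))).getD 0)).bind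
        (cU.eval B) :=
    OracleComputable.comp (F := fun B => cU.eval B) ⟨cU, fun _ => rfl⟩
      (OracleTotal.of_primrec (hdecode hpre))
  have hdig : OracleTotal fun B x => encode ((List.ofFn fun i : Fin n => oracleDigits i).map
      fun f => f B (((decode x : Option (γ × List Bool)).map fun y => prec y.1).getD 0)) := by
    refine OracleTotal.comp (oracleTotal_encode_map fun f hf => ?_)
      (OracleTotal.of_primrec (hdecode (hprec.comp Primrec.fst)))
    obtain ⟨i, rfl⟩ := (List.mem_ofFn' _ _).1 hf
    exact oracleTotal_oracleDigits i
  have hpost' : Partrec fun y : (γ × List Bool) × List Bool × List ℕ =>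
      post ((y.1.1, y.1.2.drop (len y.1.1)), y.2) := by
    refine hpost.comp (Primrec.to_comp (Primrec.pair (Primrec.pair
      (Primrec.fst.comp Primrec.fst) ?_) Primrec.snd))
    exact Primrec.list_drop.comp (hlen.comp (Primrec.fst.comp Primrec.fst))
      (Primrec.snd.comp Primrec.fst)
  obtain ⟨C, hC⟩ := hU.exists_strK_le ((OracleComputable.of_partrec hpost').comp
    (OracleComputable.pair (OracleTotal.of_primrec Primrec.id) (OracleComputable.pair hUc hdig)))
  refine ⟨C, fun B e he g π ρ u σ hπ hu hσ => ?_⟩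
  have hdigits : ((List.ofFn fun i : Fin n => oracleDigits i).map fun f =>
      f (joinOracle B (pointOracle e)) (prec g)) = List.ofFn (dirDigits e (prec g)) := by
    rw [List.map_ofFn]
    congr 1
    funext i
    exact oracleDigits_eq B e i (he i) (prec g)
  have h := hC (joinOracle B (pointOracle e)) (encode g) (π ++ ρ) σ ?_
  · rwa [List.length_append] at h
  · have hdec : (decode (Nat.pair (encode g) (encode (π ++ ρ))) : Option (γ × List Bool)) =
        some (g, π ++ ρ) := by
      rw [← encode_prod_val, encodek]
    refine Part.mem_bind_iff.2 ⟨Nat.pair (Nat.pair (encode g) (encode (π ++ ρ)))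
      (Nat.pair (encode u) (encode (List.ofFn (dirDigits e (prec g))))), ?_, ?_⟩
    · refine mem_pair_part (Part.mem_some _) (mem_pair_part ?_ ?_)
      · refine Part.mem_bind_iff.2 ⟨_, Part.mem_some _, ?_⟩
        rw [hdec]
        simp only [Option.map_some, Option.getD_some, ← hπ, List.take_left']
        rw [hcU]
        exact Part.mem_map _ hu
      · beta_reduce
        rw [hdec]
        simp only [Option.map_some, Option.getD_some, hdigits]
        exact Part.mem_some _
    · refine Part.mem_bind_iff.2 ⟨((g, π ++ ρ), u, List.ofFn (dirDigits e (prec g))), ?_, ?_⟩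
      · have hdec' : (decode (Nat.pair (Nat.pair (encode g) (encode (π ++ ρ)))
            (Nat.pair (encode u) (encode (List.ofFn (dirDigits e (prec g)))))) :
              Option ((γ × List Bool) × List Bool × List ℕ)) =
            some ((g, π ++ ρ), u, List.ofFn (dirDigits e (prec g))) := by
          rw [← encode_prod_val, ← encode_prod_val, ← encode_prod_val, encodek]
        rw [hdec']
        exact Part.mem_some _
      · refine Part.mem_map _ ?_
        simp only [← hπ, List.drop_left']
        exact hσ

theorem partrec_string_listOutput {ι β : Type*} [Primcodable ι] [Primcodable β] {R : β → ℕ}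
    {L : β → ℕ → List (Fin n → ℕ)} (A : ℕ) (hR : Primrec R) (hL : Primrec₂ L)
    {arg : ι → (β × (Fin n → ℕ) × (Fin n → ℕ)) × ℕ} (harg : Primrec arg) :
    Partrec fun y => (listOutput R L (arg y)).map fun z => ratVecString (gridVec A z.1 z.2) := by
  have hstr : Computable fun y : ℕ × (Fin n → ℕ) => ratVecString (gridVec A y.1 y.2) :=
    (primrec_ratVecString_gridVec A n).to_comp
  exact ((partrec_listOutput hR hL).comp harg.to_comp).map (hstr.comp Computable.snd).to₂

theorem primrec_fin_apply {α : Type*} [Primcodable α] {m : ℕ} {f : α → Fin m → ℕ}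
    (hf : Primrec f) (j : Fin m) : Primrec fun y => f y j :=
  Primrec.fin_app.comp hf (Primrec.const j)

theorem primrec_stringFloor_apply (A : ℕ) {α : Type*} [Primcodable α] {m : ℕ} (j : Fin m)
    {R : α → ℕ} {σ : α → List Bool} (hR : Primrec R) (hσ : Primrec σ) :
    Primrec fun y => (stringFloor A (R y) (σ y) : Fin m → ℕ) j := by
  have h := Primrec.comp (primrec_stringFloor A m) (Primrec.pair hR hσ)
  exact primrec_fin_apply h j

/-- This rebuilds the tube from what the machine has: the coefficients are the digits read from the
oracle, and the constant term comes from the rational number printed by the program. The summand A ·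
ΣE compensates for the shift of the grid by A. -/
theorem primrec_tubeArg (A A₁ : ℕ) {γ δ : Type*} [Primcodable γ] [Primcodable δ] {R k : γ → ℕ}
    {p : γ → δ} (hR : Primrec R) (hk : Primrec k) (hp : Primrec p) :
    Primrec fun y : (γ × List Bool) × List Bool × List ℕ =>
      ((((R y.1.1, k y.1.1), (fun i : Fin n => y.2.2.getD i 0),
        (stringFloor A₁ (R y.1.1) y.2.1 : Fin 1 → ℕ) 0 + A * ∑ i : Fin n, y.2.2.getD i 0),
        p y.1.1), ofBits y.1.2) := by
  have hg : Primrec fun y : (γ × List Bool) × List Bool × List ℕ => y.1.1 :=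
    Primrec.fst.comp Primrec.fst
  have hd : Primrec fun y : (γ × List Bool) × List Bool × List ℕ => y.2.2 :=
    Primrec.snd.comp Primrec.snd
  have hget : ∀ i : ℕ, Primrec fun y : (γ × List Bool) × List Bool × List ℕ => y.2.2.getD i 0 :=
    fun i => (Primrec.list_getD 0).comp hd (Primrec.const i)
  have hE : Primrec fun y : (γ × List Bool) × List Bool × List ℕ =>
      (fun i : Fin n => y.2.2.getD i 0) := Primrec.fin_curry.2
    ((Primrec.list_getD 0).comp (hd.comp Primrec.fst) (Primrec.fin_val.comp Primrec.snd))
  have hs0 : Primrec fun y : (γ × List Bool) × List Bool × List ℕ =>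
      (stringFloor A₁ (R y.1.1) y.2.1 : Fin 1 → ℕ) 0 :=
    primrec_stringFloor_apply A₁ 0 (hR.comp hg) (Primrec.fst.comp Primrec.snd)
  have hb := Primrec.nat_add.comp hs0 (Primrec.nat_mul.comp (Primrec.const A)
    (primrec_fin_sum fun i : Fin n => hget i))
  exact Primrec.pair (Primrec.pair (Primrec.pair (Primrec.pair (hR.comp hg) (hk.comp hg))
    (Primrec.pair hE hb)) (hp.comp hg)) (primrec_ofBits.comp (Primrec.snd.comp Primrec.fst))

theorem primrec_filter_inTube {stage : ℕ × ℕ → ℕ → List (Fin n → ℕ)} (hst : Primrec₂ stage)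
    (a w c : ℕ) (lo : Fin n → ℕ) :
    Primrec₂ fun (y : (ℕ × ℕ) × (Fin n → ℕ) × ℕ) (T : ℕ) =>
      (stage (y.1.2, y.1.1) T).filter fun G => decide (InTube a w c lo y.1.1 y.2.1 y.2.2 G) := by
  let β := (ℕ × ℕ) × (Fin n → ℕ) × ℕ
  have hl : Primrec fun y : β × ℕ => stage (y.1.1.2, y.1.1.1) y.2 :=
    hst.comp (Primrec.pair (Primrec.snd.comp (Primrec.fst.comp Primrec.fst))
      (Primrec.fst.comp (Primrec.fst.comp Primrec.fst))) Primrec.snd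
  have hin : PrimrecPred fun y : (β × ℕ) × (Fin n → ℕ) =>
      InTube a w c lo y.1.1.1.1 y.1.1.2.1 y.1.1.2.2 y.2 :=
    (primrecPred_inTube a w c lo).comp (Primrec.pair
      (Primrec.fst.comp (Primrec.fst.comp (Primrec.fst.comp Primrec.fst)))
      (Primrec.pair (Primrec.fst.comp (Primrec.snd.comp (Primrec.fst.comp Primrec.fst)))
        (Primrec.pair (Primrec.snd.comp (Primrec.snd.comp (Primrec.fst.comp Primrec.fst)))
          Primrec.snd)))
  have h := Primrec.listFilterMap hl (g := fun y G =>
    if InTube a w c lo y.1.1.1 y.1.2.1 y.1.2.2 G then some G else none)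
    (Primrec.ite hin (Primrec.option_some.comp Primrec.snd) (Primrec.const none))
  refine h.of_eq fun y => ?_
  change _ = (stage (y.1.1.2, y.1.1.1) y.2).filter _
  rw [← List.filterMap_eq_filter]
  congr 1
  funext G
  simp [Option.guard]

/-- With access to a direction `e`, a grid point of an enumeration that lies in a tube orthogonal
to `e` can be described by an approximation `v` of the position of the tube and an index. -/
theorem OracleMachine.IsUniversal.exists_ratVecK_le_of_inTube (hU : U.IsUniversal)
    {stage : ℕ × ℕ → ℕ → List (Fin n → ℕ)} (hst : Primrec₂ stage)
    (hsuf : ∀ x S T, S ≤ T → stage x S <:+ stage x T) (A A₁ M a w c : ℕ) (lo : Fin n → ℕ) :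
    ∃ C : ℕ, ∀ (B : Set ℕ) (e : EuclideanSpace ℝ (Fin n)), (∀ i, |e i| ≤ 1) →
      ∀ (v : ℚ) (R k S m b : ℕ) (G : Fin n → ℕ), G ∈ stage (k, R) S →
      b = ⌊(2 : ℚ) ^ R * (v + A₁)⌋₊ + A * ∑ i, dirDigits e R i →
      InTube a w c lo R (dirDigits e R) b G →
      (stage (k, R) S).countP (fun G => decide (InTube a w c lo R (dirDigits e R) b G)) ≤ 2 ^ m →
      ∀ p q : Fin n → ℕ, (∀ i, p i ≤ M) → (∀ i, q i ≤ M) →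
        ratVecK U (joinOracle B (pointOracle e)) (gridVec A R fun i => G i + p i - q i) ≤
          ratVecK U (joinOracle B (pointOracle e)) ![v] + m +
          8 * (Nat.size (Nat.pair R (Nat.pair k
            (ratVecK U (joinOracle B (pointOracle e)) ![v]))) +
            Nat.size (ratVecK U (joinOracle B (pointOracle e)) ![v] + m)) + C := by
  let γ := (ℕ × ℕ × ℕ) × (Fin n → ℕ) × (Fin n → ℕ)
  have hmono : ∀ (y : (ℕ × ℕ) × (Fin n → ℕ) × ℕ) (S T : ℕ), S ≤ T →
      (stage (y.1.2, y.1.1) S).filter (fun G => decide (InTube a w c lo y.1.1 y.2.1 y.2.2 G)) <:+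
      (stage (y.1.2, y.1.1) T).filter (fun G => decide (InTube a w c lo y.1.1 y.2.1 y.2.2 G)) :=
    fun y S T hST => List.IsSuffix.filter _ (hsuf _ S T hST)
  have harg := primrec_tubeArg (n := n) A A₁ (γ := γ) (R := fun g => g.1.1)
    (k := fun g => g.1.2.1) (p := fun g => g.2) (Primrec.fst.comp Primrec.fst)
    (Primrec.fst.comp (Primrec.snd.comp Primrec.fst)) Primrec.snd
  have hpost := partrec_string_listOutput A (R := fun y : (ℕ × ℕ) × (Fin n → ℕ) × ℕ => y.1.1)
    (Primrec.fst.comp Primrec.fst) (primrec_filter_inTube hst a w c lo) harg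
  obtain ⟨C, hC⟩ := hU.exists_strK_le_of_query (n := n) (γ := γ) (len := fun g => g.1.2.2)
    (prec := fun g => g.1.1) (Primrec.snd.comp (Primrec.snd.comp Primrec.fst))
    (Primrec.fst.comp Primrec.fst) hpost
  obtain ⟨D, hD⟩ := exists_size_encode_le n M
  refine ⟨C + 4 * D, fun B e he v R k S m b G hG hb hin hm p q hp hq => ?_⟩
  obtain ⟨π, hπ, hπv⟩ := hU.exists_shortest (joinOracle B (pointOracle e)) (ratVecString ![v])
  rw [List.countP_eq_length_filter] at hm
  obtain ⟨ρ, hρ, h⟩ := exists_mem_listOutput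
    (R := fun y : (ℕ × ℕ) × (Fin n → ℕ) × ℕ => y.1.1) hmono
    (b := ((R, k), dirDigits e R, b)) (S := S)
    (List.mem_filter.2 ⟨hG, decide_eq_true hin⟩) hm
  have key := hC B e he ((R, k, π.length), p, q) π ρ _
    (ratVecString (gridVec A R fun i => G i + p i - q i)) rfl hπv
    ((Part.mem_map_iff _).2 ⟨(R, fun i => G i + p i - q i), ?_, rfl⟩)
  · have h2 := hD (ℕ × ℕ × ℕ) (R, k, π.length) p q hp hq
    have h3 : ratVecK U (joinOracle B (pointOracle e)) ![v] = π.length := hπ.symm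
    rw [h3]
    refine key.trans ?_
    rw [hρ]
    have h4 : encode (R, k, π.length) = Nat.pair R (Nat.pair k π.length) := rfl
    rw [h4] at h2
    omega
  · have e1 : (fun i : Fin n => (List.ofFn (dirDigits e R)).getD i 0) = dirDigits e R := by
      funext i
      simp
    have e2 : ∑ i : Fin n, (List.ofFn (dirDigits e R)).getD i 0 = ∑ i, dirDigits e R i := by
      rw [← e1]
      simp
    have h5 := h p q
    simp only [stringFloor_ratVecString, e1, e2]
    rw [hb] at h5
    exact h5

end OracleMachines

/-! ### Complexity of points and grid approximations. -/

section Points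

variable {U : OracleMachine} {n : ℕ}

theorem pointK_le {B : Set ℕ} {r : ℕ} {x : EuclideanSpace ℝ (Fin n)} {p : Fin n → ℚ}
    (h : ratPoint p ∈ Metric.ball x ((2 : ℝ) ^ (-(r : ℤ)))) : pointK U B r x ≤ ratVecK U B p :=
  Nat.sInf_le ⟨p, h, rfl⟩

/-- The index of the grid point next to `x`. -/
noncomputable def gridIndex (A R : ℕ) (x : EuclideanSpace ℝ (Fin n)) (i : Fin n) : ℕ :=
  ⌊(2 : ℝ) ^ R * (x i + A)⌋₊

theorem gridIndex_le {A : ℕ} (R : ℕ) {x : EuclideanSpace ℝ (Fin n)} {i : Fin n}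
    (hx : 0 ≤ x i + A) : (gridIndex A R x i : ℝ) ≤ 2 ^ R * (x i + A) :=
  Nat.floor_le (by positivity)

theorem lt_gridIndex_add_one (A R : ℕ) (x : EuclideanSpace ℝ (Fin n)) (i : Fin n) :
    2 ^ R * (x i + A) < gridIndex A R x i + 1 :=
  Nat.lt_floor_add_one _

/-- The n additional digits absorb the factor √n between maximum norm and Euclidean norm, as n <
4^n. This is why grids have mesh 2^(-(r+n)) below. -/
theorem ratPoint_mem_ball {r : ℕ} {x : EuclideanSpace ℝ (Fin n)} {p : Fin n → ℚ}
    (h : ∀ i, |(p i : ℝ) - x i| ≤ 1 / 2 ^ (r + n)) :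
    ratPoint p ∈ Metric.ball x ((2 : ℝ) ^ (-(r : ℤ))) := by
  have hr : (0 : ℝ) < 2 ^ r := by positivity
  rw [Metric.mem_ball, dist_eq_norm, zpow_neg, zpow_natCast]
  refine lt_of_pow_lt_pow_left₀ 2 (by positivity) ?_
  rw [EuclideanSpace.norm_sq_eq]
  have h1 : ∑ i, ‖(ratPoint p - x) i‖ ^ 2 ≤ ∑ _i : Fin n, ((1 : ℝ) / 2 ^ (r + n)) ^ 2 := by
    refine Finset.sum_le_sum fun i _ => ?_
    rw [Real.norm_eq_abs]
    exact pow_le_pow_left₀ (abs_nonneg _) (h i) 2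
  refine h1.trans_lt ?_
  rw [Finset.sum_const, Finset.card_univ, Fintype.card_fin, nsmul_eq_mul, inv_eq_one_div]
  have hn : (n : ℝ) < 2 ^ n := by exact_mod_cast Nat.lt_two_pow_self
  have hn1 : (1 : ℝ) ≤ 2 ^ n := one_le_pow₀ (by norm_num)
  rw [div_pow, div_pow, pow_add, mul_pow, one_pow, mul_one_div,
    div_lt_div_iff₀ (by positivity) (by positivity), one_mul, mul_comm (n : ℝ)]
  refine mul_lt_mul_of_pos_left ?_ (by positivity)
  nlinarith

theorem abs_gridVec_gridIndex_sub_le {A : ℕ} (R : ℕ) {x : EuclideanSpace ℝ (Fin n)} {i : Fin n}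
    (hx : 0 ≤ x i + A) : |(gridVec A R (gridIndex A R x) i : ℝ) - x i| ≤ 1 / 2 ^ R := by
  have hR : (0 : ℝ) < 2 ^ R := by positivity
  have h1 := gridIndex_le R hx
  have h2 := lt_gridIndex_add_one A R x i
  rw [gridVec]
  push_cast
  have e : (gridIndex A R x i : ℝ) / 2 ^ R - A - x i =
      ((gridIndex A R x i : ℝ) - 2 ^ R * (x i + A)) / 2 ^ R := by
    field_simp
    ring
  rw [e, abs_div, abs_of_pos hR]
  refine (div_le_div_iff_of_pos_right hR).2 ?_
  rw [abs_le]
  constructor <;> linarith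

theorem exists_offset (x : EuclideanSpace ℝ (Fin n)) (c : ℝ) : ∃ A : ℕ, ∀ i, |x i| + c ≤ A := by
  obtain ⟨A, hA⟩ := exists_nat_ge (‖x‖ + c)
  refine ⟨A, fun i => le_trans ?_ hA⟩
  have := PiLp.norm_apply_le x i
  rw [Real.norm_eq_abs] at this
  linarith

/-- The ball contains a grid point, so the infimum is over a nonempty set and is attained. -/
theorem exists_ratVecK_eq_pointK (U : OracleMachine) (B : Set ℕ) (r : ℕ)
    (x : EuclideanSpace ℝ (Fin n)) :
    ∃ p : Fin n → ℚ, ratPoint p ∈ Metric.ball x ((2 : ℝ) ^ (-(r : ℤ))) ∧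
      ratVecK U B p = pointK U B r x := by
  obtain ⟨A, hA⟩ := exists_offset x 0
  refine Nat.sInf_mem (s := {l : ℕ | ∃ p : Fin n → ℚ,
    ratPoint p ∈ Metric.ball x ((2 : ℝ) ^ (-(r : ℤ))) ∧ ratVecK U B p = l}) ⟨_, _,
      ratPoint_mem_ball (p := gridVec A (r + n) (gridIndex A (r + n) x)) fun i =>
        abs_gridVec_gridIndex_sub_le _ ?_, rfl⟩
  have := neg_abs_le (x i)
  have := hA i
  linarith

theorem exists_ratVecK_eq_realK (U : OracleMachine) (B : Set ℕ) (r : ℕ) (x : ℝ) :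
    ∃ q : ℚ, |(q : ℝ) - x| < 1 / 2 ^ r ∧ ratVecK U B ![q] = realK U B r x := by
  obtain ⟨p, hp, h⟩ := exists_ratVecK_eq_pointK U B r (!₂[x] : EuclideanSpace ℝ (Fin 1))
  refine ⟨p 0, ?_, ?_⟩
  · rw [Metric.mem_ball, dist_eq_norm, zpow_neg, zpow_natCast] at hp
    have h1 := (PiLp.norm_apply_le (ratPoint p - !₂[x]) 0).trans_lt hp
    rw [Real.norm_eq_abs] at h1
    rw [one_div]
    simpa [ratPoint] using h1
  · have : ![p 0] = p := by
      funext i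
      fin_cases i
      rfl
    rw [this, h, realK]

theorem abs_sub_le_of_mem_ball {r : ℕ} {x : EuclideanSpace ℝ (Fin n)} {p : Fin n → ℚ}
    (h : ratPoint p ∈ Metric.ball x ((2 : ℝ) ^ (-(r : ℤ)))) (i : Fin n) :
    |(p i : ℝ) - x i| ≤ 1 / 2 ^ r := by
  rw [Metric.mem_ball, dist_eq_norm, zpow_neg, zpow_natCast] at h
  have h1 := (PiLp.norm_apply_le (ratPoint p - x) i).trans h.le
  rw [Real.norm_eq_abs] at h1
  rw [one_div]
  exact h1

/-- A bound for the complexity of all grid points near `G` is a bound for the complexity of all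
points near `G`. -/
theorem pointK_le_of_near {B : Set ℕ} {A r M X : ℕ} {x : EuclideanSpace ℝ (Fin n)}
    {G : Fin n → ℕ} (hx : ∀ i, 0 ≤ x i + A)
    (hG : ∀ i, |(gridVec A (r + n) G i : ℝ) - x i| ≤ M / 2 ^ (r + n))
    (h : ∀ p q : Fin n → ℕ, (∀ i, p i ≤ M + 1) → (∀ i, q i ≤ M + 1) →
      ratVecK U B (gridVec A (r + n) fun i => G i + p i - q i) ≤ X) :
    pointK U B r x ≤ X := by
  have hR : (0 : ℝ) < 2 ^ (r + n) := by positivity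
  have key : ∀ i, gridIndex A (r + n) x i ≤ G i + (M + 1) ∧
      G i ≤ gridIndex A (r + n) x i + (M + 1) := by
    intro i
    have h1 := gridIndex_le (r + n) (hx i)
    have h2 := lt_gridIndex_add_one A (r + n) x i
    have h3 := hG i
    rw [gridVec] at h3
    push_cast at h3
    have e : (G i : ℝ) / 2 ^ (r + n) - A - x i =
        ((G i : ℝ) - 2 ^ (r + n) * (x i + A)) / 2 ^ (r + n) := by
      field_simp
      ring
    rw [e, abs_div, abs_of_pos hR, div_le_div_iff_of_pos_right hR, abs_le] at h3
    have h4 : (gridIndex A (r + n) x i : ℝ) ≤ ((G i + (M + 1) : ℕ) : ℝ) := by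
      push_cast
      linarith
    have h5 : (G i : ℝ) ≤ ((gridIndex A (r + n) x i + (M + 1) : ℕ) : ℝ) := by
      push_cast
      linarith
    exact ⟨by exact_mod_cast h4, by exact_mod_cast h5⟩
  -- The two displacements are the positive and the negative part of the difference of the indices.
  have h1 := h (fun i => gridIndex A (r + n) x i - G i) (fun i => G i - gridIndex A (r + n) x i)
    (fun i => by have := key i; omega) (fun i => by have := key i; omega)
  have e : (fun i => G i + (gridIndex A (r + n) x i - G i) - (G i - gridIndex A (r + n) x i)) =
      gridIndex A (r + n) x := by
    funext i
    omega
  rw [e] at h1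
  exact (pointK_le (ratPoint_mem_ball fun i => abs_gridVec_gridIndex_sub_le _ (hx i))).trans h1

theorem OracleMachine.IsUniversal.exists_pointK_le_empty (hU : U.IsUniversal) :
    ∃ C : ℕ, ∀ (B : Set ℕ) (r : ℕ) (n : ℕ) (x : EuclideanSpace ℝ (Fin n)),
      pointK U B r x ≤ pointK U ∅ r x + C := by
  obtain ⟨C, hC⟩ := hU.exists_strK_le_empty
  refine ⟨C, fun B r n x => ?_⟩
  obtain ⟨p, hp, h⟩ := exists_ratVecK_eq_pointK U ∅ r x
  rw [← h]
  exact (pointK_le hp).trans (hC B _)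

/-- A grid point all of whose indices have at most `R + c` digits. -/
theorem OracleMachine.IsUniversal.exists_ratVecK_gridVec_le_of_lt (hU : U.IsUniversal)
    (A n c : ℕ) : ∃ C : ℕ, ∀ (B : Set ℕ) (R : ℕ) (G : Fin n → ℕ), (∀ i, G i < 2 ^ (R + c)) →
      ratVecK U B (gridVec A R G) ≤
        (R + c) * n + 4 * (Nat.size R + Nat.size ((R + c) * n)) + C := by
  have hQ : Primrec fun x : ℕ × List Bool => 2 ^ (x.1 + c) :=
    primrec_nat_pow.comp (Primrec.const 2) (Primrec.nat_add.comp Primrec.fst (Primrec.const c))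
  have hd : ∀ i, Primrec fun x : ℕ × List Bool => digit (2 ^ (x.1 + c)) (ofBits x.2) i := fun i =>
    Primrec.nat_mod.comp (Primrec.nat_div.comp (primrec_ofBits.comp Primrec.snd)
      (primrec_nat_pow.comp hQ (Primrec.const i))) hQ
  have hf : Primrec fun x : ℕ × List Bool =>
      (x.1, fun i : Fin n => digit (2 ^ (x.1 + c)) (ofBits x.2) i) :=
    Primrec.pair Primrec.fst (Primrec.fin_curry.2
      ((Primrec.fin_curry₁.2 fun i => hd i).comp₂ Primrec₂.right Primrec₂.left))
  obtain ⟨C, hC⟩ := hU.exists_ratVecK_gridVec_le A hf.to_comp.partrec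
  refine ⟨C, fun B R G hG => ?_⟩
  obtain ⟨j, hj, h⟩ := exists_digits (Q := 2 ^ (R + c)) (by positivity) n
    (fun i => if h : i < n then G ⟨i, h⟩ else 0) fun i hi => by rw [dif_pos hi]; exact hG _
  rw [← pow_mul] at hj
  obtain ⟨ρ, hρ, rfl⟩ := exists_ofBits_eq _ hj
  have h1 := hC B R ρ R G ?_
  · rw [hρ] at h1
    exact h1
  · have e : (fun i : Fin n => digit (2 ^ (R + c)) (ofBits ρ) i) = G := by
      funext i
      rw [h i i.2, dif_pos i.2]
    rw [← e]
    exact Part.mem_some _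

/-- A grid point on a line that is parallel to a coordinate axis and passes through a point of a
fixed finite set. -/
theorem OracleMachine.IsUniversal.exists_ratVecK_gridVec_le_of_axis (hU : U.IsUniversal)
    (A n c M : ℕ) : ∃ C : ℕ, ∀ (B : Set ℕ) (R m : ℕ) (i : Fin n) (g : Fin n → ℕ) (v : ℕ),
      (∀ j, g j ≤ M) → v < 2 ^ m →
      ratVecK U B (gridVec A (R + c) fun j => if j = i then v else g j * 2 ^ R) ≤
        m + 16 * (Nat.size R + Nat.size m) + C := by
  have hf : Primrec fun x : ((ℕ × ℕ) × (Fin n → ℕ) × (Fin n → ℕ)) × List Bool =>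
      (x.1.1.1 + c, fun j : Fin n =>
        if (j : ℕ) = x.1.1.2 then ofBits x.2 else x.1.2.1 j * 2 ^ x.1.1.1) := by
    refine Primrec.pair (Primrec.nat_add.comp (Primrec.fst.comp (Primrec.fst.comp Primrec.fst))
      (Primrec.const c)) (Primrec.fin_curry.2 (Primrec.ite ?_ ?_ ?_))
    · exact Primrec.eq.comp (Primrec.fin_val.comp Primrec.snd)
        (Primrec.snd.comp (Primrec.fst.comp (Primrec.fst.comp Primrec.fst)))
    · exact primrec_ofBits.comp (Primrec.snd.comp Primrec.fst)
    · refine Primrec.nat_mul.comp (Primrec.fin_app.comp (Primrec.fst.comp (Primrec.snd.comp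
        (Primrec.fst.comp Primrec.fst))) Primrec.snd) (primrec_nat_pow.comp (Primrec.const 2)
          (Primrec.fst.comp (Primrec.fst.comp (Primrec.fst.comp Primrec.fst))))
  obtain ⟨C, hC⟩ := hU.exists_ratVecK_gridVec_le A hf.to_comp.partrec
  obtain ⟨D, hD⟩ := exists_size_encode_le n M
  refine ⟨C + 4 * D + 16 * Nat.size n, fun B R m i g v hg hv => ?_⟩
  obtain ⟨ρ, hρ, rfl⟩ := exists_ofBits_eq _ hv
  have h1 := hC B ((R, (i : ℕ)), g, fun _ => 0) ρ (R + c)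
    (fun j => if j = i then ofBits ρ else g j * 2 ^ R) ?_
  · have h2 := hD (ℕ × ℕ) (R, (i : ℕ)) g (fun _ => 0) hg fun _ => Nat.zero_le _
    have h3 : Nat.size (encode (R, (i : ℕ))) ≤ 2 * (Nat.size R + Nat.size i) := size_pair_le R i
    have h4 : Nat.size i ≤ Nat.size n := Nat.size_le_size i.2.le
    refine h1.trans ?_
    rw [hρ]
    omega
  · simp only [Fin.ext_iff]
    exact Part.mem_some _

end Points

/-! ### The geometry of tubes. -/

section Geometry

variable {n : ℕ}

/-- The linear form in the definition of a tube is the inner product with a direction, up to an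
error of the order of the mesh. -/
theorem abs_tubeForm_sub_le {A A₁ R : ℕ} {e : EuclideanSpace ℝ (Fin n)} (he : ∀ i, |e i| ≤ 1)
    {q : ℚ} (hq : 0 ≤ (q : ℝ) + A₁) {G : Fin n → ℕ}
    (hG : ∀ i, |(gridVec A R G i : ℝ)| ≤ A) {b : ℕ}
    (hb : b = ⌊(2 : ℚ) ^ R * (q + A₁)⌋₊ + A * ∑ i, dirDigits e R i) :
    |((∑ i, (dirDigits e R i : ℝ) * G i) + 4 ^ R * (n * A + A₁ : ℕ) -
      2 ^ R * ((∑ i, (G i : ℝ)) + b)) -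
      4 ^ R * ((∑ i, e i * (gridVec A R G i : ℝ)) - q)| ≤ 2 ^ R * (n * A + 1) := by
  set P : ℝ := 2 ^ R with hP
  have hPpos : 0 < P := by positivity
  have h4 : (4 : ℝ) ^ R = P * P := by
    rw [hP, ← mul_pow]
    norm_num
  set x : Fin n → ℝ := fun i => (gridVec A R G i : ℝ) with hx
  have hGx : ∀ i, (G i : ℝ) = P * (x i + A) := by
    intro i
    simp only [hx, gridVec]
    push_cast
    rw [← hP]
    field_simp
    ring
  set θ : Fin n → ℝ := fun i => P * (e i + 1) - dirDigits e R i with hθ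
  have hθ0 : ∀ i, 0 ≤ θ i := fun i => by
    have h1 := abs_le.1 (he i)
    have : (dirDigits e R i : ℝ) ≤ P * (e i + 1) :=
      Nat.floor_le (mul_nonneg hPpos.le (by linarith))
    simp only [hθ]
    linarith
  have hθ1 : ∀ i, θ i ≤ 1 := fun i => by
    have : P * (e i + 1) < dirDigits e R i + 1 := Nat.lt_floor_add_one _
    simp only [hθ]
    linarith
  set f : ℕ := ⌊(2 : ℚ) ^ R * (q + A₁)⌋₊ with hf
  have hq' : (0 : ℚ) ≤ q + A₁ := by exact_mod_cast hq
  have hf0 : (f : ℝ) ≤ P * (q + A₁) := by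
    have : (f : ℚ) ≤ 2 ^ R * (q + A₁) := Nat.floor_le (by positivity)
    have h2 : ((f : ℚ) : ℝ) ≤ ((2 ^ R * (q + A₁) : ℚ) : ℝ) := by exact_mod_cast this
    push_cast at h2
    exact h2
  have hf1 : P * (q + A₁) < f + 1 := by
    have : 2 ^ R * (q + A₁) < (f : ℚ) + 1 := Nat.lt_floor_add_one _
    have h2 : ((2 ^ R * (q + A₁) : ℚ) : ℝ) < ((f + 1 : ℚ) : ℝ) := by exact_mod_cast this
    push_cast at h2
    exact h2
  have hsum : (∑ i, (dirDigits e R i : ℝ) * G i) - P * (∑ i, (G i : ℝ)) -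
      P * A * (∑ i, (dirDigits e R i : ℝ)) =
      P * P * (∑ i, e i * x i) - P * (∑ i, θ i * x i) - P * P * (n * A) := by
    have : P * P * (n * A) = ∑ _i : Fin n, P * P * A := by
      rw [Finset.sum_const, Finset.card_univ, Fintype.card_fin, nsmul_eq_mul]
      ring
    rw [this, Finset.mul_sum, Finset.mul_sum, Finset.mul_sum, Finset.mul_sum,
      ← Finset.sum_sub_distrib, ← Finset.sum_sub_distrib, ← Finset.sum_sub_distrib,
      ← Finset.sum_sub_distrib]
    refine Finset.sum_congr rfl fun i _ => ?_
    have hE : (dirDigits e R i : ℝ) = P * (e i + 1) - θ i := by simp only [hθ]; ring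
    rw [hGx i, hE]
    ring
  have hθx : |∑ i, θ i * x i| ≤ n * A := by
    refine (Finset.abs_sum_le_sum_abs _ _).trans ?_
    have : (n * A : ℝ) = ∑ _i : Fin n, (A : ℝ) := by
      rw [Finset.sum_const, Finset.card_univ, Fintype.card_fin, nsmul_eq_mul]
    rw [this]
    refine Finset.sum_le_sum fun i _ => ?_
    rw [abs_mul, abs_of_nonneg (hθ0 i)]
    calc θ i * |x i| ≤ 1 * A := mul_le_mul (hθ1 i) (hG i) (abs_nonneg _) zero_le_one
      _ = A := one_mul _
  have hbR : (b : ℝ) = f + A * ∑ i, (dirDigits e R i : ℝ) := by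
    rw [hb]
    push_cast
    rfl
  -- All shifts cancel, and what remains comes from two roundings: that of q, less than 1, and that
  -- of the direction, at most nA.
  have key : ((∑ i, (dirDigits e R i : ℝ) * G i) + 4 ^ R * (n * A + A₁ : ℕ) -
      P * ((∑ i, (G i : ℝ)) + b)) - 4 ^ R * ((∑ i, e i * x i) - q) =
      P * ((P * (q + A₁) - f) - ∑ i, θ i * x i) := by
    rw [hbR, h4]
    push_cast
    linear_combination hsum
  rw [key, abs_mul, abs_of_pos hPpos]
  refine mul_le_mul_of_nonneg_left ?_ hPpos.le
  refine (abs_sub _ _).trans ?_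
  rw [abs_of_nonneg (by linarith : (0 : ℝ) ≤ P * (q + A₁) - f)]
  linarith

theorem abs_gridVec_floor_sub_le {A : ℕ} (R : ℕ) {p : Fin n → ℚ} {i : Fin n}
    (hp : 0 ≤ (p i : ℝ) + A) :
    |(gridVec A R (fun i => ⌊2 ^ R * (p i + A)⌋₊) i : ℝ) - p i| ≤ 1 / 2 ^ R := by
  have h1 := abs_gridVec_gridIndex_sub_le (A := A) R (x := ratPoint p) (i := i) hp
  have h2 : gridIndex A R (ratPoint p) i = ⌊2 ^ R * (p i + A)⌋₊ := by
    rw [gridIndex, ratPoint, ← Int.floor_toNat, ← Int.floor_toNat, ← Rat.floor_cast (α := ℝ)]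
    push_cast
    rfl
  simp only [gridVec, h2] at h1 ⊢
  exact h1

theorem cast_inTube_iff {a w c R b : ℕ} {lo E G : Fin n → ℕ} :
    InTube a w c lo R E b G ↔ (∀ i, (lo i : ℝ) ≤ G i / 2 ^ R * 2 ^ c ∧
      (G i : ℝ) / 2 ^ R * 2 ^ c < lo i + 2) ∧
      |(∑ i, (E i : ℝ) * G i) + 4 ^ R * a - 2 ^ R * ((∑ i, (G i : ℝ)) + b)| ≤ 2 ^ R * w := by
  have hR : (0 : ℝ) < 2 ^ R := by positivity
  have h1 : ∀ i, lo i * 2 ^ R ≤ G i * 2 ^ c ↔ (lo i : ℝ) ≤ G i / 2 ^ R * 2 ^ c := fun i => by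
    rw [div_mul_eq_mul_div, le_div_iff₀ hR]
    exact_mod_cast Iff.rfl
  have h2 : ∀ i, G i * 2 ^ c < (lo i + 2) * 2 ^ R ↔ (G i : ℝ) / 2 ^ R * 2 ^ c < lo i + 2 :=
    fun i => by
    rw [div_mul_eq_mul_div, div_lt_iff₀ hR]
    exact_mod_cast Iff.rfl
  rw [InTube]
  simp only [h1, h2]
  refine and_congr_right fun _ => ?_
  rw [abs_le, ← Nat.cast_le (α := ℝ), ← Nat.cast_le (α := ℝ)]
  push_cast
  constructor
  · rintro ⟨h, h'⟩
    constructor <;> linarith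
  · rintro ⟨h, h'⟩
    constructor <;> linarith

theorem norm_le_of_forall_abs_le {x : EuclideanSpace ℝ (Fin n)} {c : ℝ} (h : ∀ i, |x i| ≤ c) :
    ‖x‖ ≤ n * c := by
  rcases Nat.eq_zero_or_pos n with rfl | hn
  · have : x = 0 := Subsingleton.elim _ _
    simp [this]
  have hc : 0 ≤ c := (abs_nonneg _).trans (h ⟨0, hn⟩)
  refine le_of_sq_le_sq ?_ (by positivity)
  rw [EuclideanSpace.norm_sq_eq]
  have h1 : ∑ i, ‖x i‖ ^ 2 ≤ ∑ _i : Fin n, c ^ 2 := Finset.sum_le_sum fun i _ => by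
    rw [Real.norm_eq_abs]
    exact pow_le_pow_left₀ (abs_nonneg _) (h i) 2
  refine h1.trans ?_
  rw [Finset.sum_const, Finset.card_univ, Fintype.card_fin, nsmul_eq_mul, mul_pow]
  refine mul_le_mul_of_nonneg_right ?_ (sq_nonneg _)
  have : (1 : ℝ) ≤ n := by exact_mod_cast hn
  nlinarith

theorem inner_eq_sum (e x : EuclideanSpace ℝ (Fin n)) : inner ℝ e x = ∑ i, e i * x i := by
  rw [PiLp.inner_apply]
  refine Finset.sum_congr rfl fun i _ => ?_
  simp [mul_comm]

theorem abs_apply_le_norm (x : EuclideanSpace ℝ (Fin n)) (i : Fin n) : |x i| ≤ ‖x‖ := by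
  have := PiLp.norm_apply_le x i
  rwa [Real.norm_eq_abs] at this

theorem abs_inner_le_of_forall_abs_le {e x : EuclideanSpace ℝ (Fin n)} (he : ‖e‖ = 1) {c : ℝ}
    (h : ∀ i, |x i| ≤ c) : |inner ℝ e x| ≤ n * c := by
  refine (abs_real_inner_le_norm e x).trans ?_
  rw [he, one_mul]
  exact norm_le_of_forall_abs_le h

/-- The tubes around the slices through `z`. -/
theorem exists_tube_parameters (z : EuclideanSpace ℝ (Fin n)) :
    ∃ (A A₁ a w c s κ : ℕ) (lo : Fin n → ℕ), (∀ i, |z i| + 1 ≤ A) ∧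
      ∀ (e : EuclideanSpace ℝ (Fin n)) (r : ℕ) (q : ℚ) (b : ℕ), ‖e‖ = 1 →
        |(q : ℝ) - inner ℝ e z| < 1 / 2 ^ r →
        b = ⌊(2 : ℚ) ^ (r + n) * (q + A₁)⌋₊ + A * ∑ i, dirDigits e (r + n) i →
        (∀ p : Fin n → ℚ, ratPoint p ∈ Metric.ball z ((2 : ℝ) ^ (-(r : ℤ))) → n + 5 ≤ r →
          InTube a w c lo (r + n) (dirDigits e (r + n)) b fun i => ⌊2 ^ (r + n) * (p i + A)⌋₊) ∧
        (∀ G, InTube a w c lo (r + n) (dirDigits e (r + n)) b G →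
          ‖ratPoint (gridVec A (r + n) G) - z‖ < 1 / 4 ∧
          |inner ℝ e (ratPoint (gridVec A (r + n) G) - z)| ≤ κ / 2 ^ (r + n)) ∧
        (∀ i, dirDigits e (r + n) i < 2 ^ (r + n + s)) ∧ b < 2 ^ (r + n + s) := by
  obtain ⟨A, hA⟩ := exists_offset z 1
  obtain ⟨A₁, hA₁⟩ := exists_nat_ge (‖z‖ + 1)
  have h2n : (n : ℝ) < 2 ^ n := by exact_mod_cast Nat.lt_two_pow_self
  have h2n1 : (1 : ℝ) ≤ 2 ^ n := one_le_pow₀ (by norm_num)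
  have hcpos : (0 : ℝ) < 2 ^ (n + 3) := by positivity
  have hc8 : (2 : ℝ) ^ (n + 3) = 8 * 2 ^ n := by ring
  -- The box consists of two adjacent cells of side 2^(-(n+3)) in each coordinate, chosen so that z
  -- keeps at least half a cell of distance from the boundary.
  set lo : Fin n → ℕ := fun i => ⌊(2 : ℝ) ^ (n + 3) * (z i + A) - 1 / 2⌋₊ with hlo
  have hzA : ∀ i, 1 ≤ z i + A := fun i => by
    have := neg_abs_le (z i)
    have := hA i
    linarith
  have hlo1 : ∀ i, (lo i : ℝ) + 1 / 2 ≤ 2 ^ (n + 3) * (z i + A) := fun i => by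
    have h1 : (lo i : ℝ) ≤ 2 ^ (n + 3) * (z i + A) - 1 / 2 := Nat.floor_le (by
      have := hzA i
      nlinarith)
    linarith
  have hlo2 : ∀ i, 2 ^ (n + 3) * (z i + A) < lo i + 3 / 2 := fun i => by
    have h1 : (2 : ℝ) ^ (n + 3) * (z i + A) - 1 / 2 < lo i + 1 := Nat.lt_floor_add_one _
    linarith
  -- The constant a = nA + A₁ undoes the shifts. The width w adds the error nA + 1 of the linear
  -- form, the rounding n of a point to the grid, and 2^n twice, for the distances of p from z and
  -- of q from e·z, since 2^(-r) = 2^n · 2^(-(r+n)). The box scale c = n + 3 keeps the tube within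
  -- 1/4 of z. The number s bounds the additional digits of the tube parameters. Finally κ is w plus
  -- the error of the form plus 2^n for passing from q back to e·z.
  refine ⟨A, A₁, n * A + A₁, n * A + 1 + n + 2 * 2 ^ n, n + 3, 2 * A₁ + 2 * (n * A) + 2,
    (n * A + 1 + n + 2 * 2 ^ n) + (n * A + 1) + 2 ^ n, lo, hA, fun e r q b he hq hb => ?_⟩
  set R := r + n with hR
  have hP : (0 : ℝ) < 2 ^ R := by positivity
  have hPr : (1 : ℝ) / 2 ^ r = 2 ^ n / 2 ^ R := by
    rw [hR, pow_add]
    field_simp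
  have h4 : (4 : ℝ) ^ R = 2 ^ R * 2 ^ R := by
    rw [← mul_pow]
    norm_num
  have he1 : ∀ i, |e i| ≤ 1 := fun i => he ▸ abs_apply_le_norm e i
  have hr1 : (1 : ℝ) / 2 ^ r ≤ 1 := by
    rw [div_le_one (by positivity)]
    exact one_le_pow₀ (by norm_num)
  have hez : |inner ℝ e z| ≤ ‖z‖ := by
    have := abs_real_inner_le_norm e z
    rwa [he, one_mul] at this
  have hqlt := abs_lt.1 hq
  have hezle := abs_le.1 hez
  have hq0 : 0 ≤ (q : ℝ) + A₁ := by linarith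
  have hqA : (q : ℝ) ≤ A₁ := by linarith
  have hform := fun (G : Fin n → ℕ) (hG : ∀ i, |(gridVec A R G i : ℝ)| ≤ A) =>
    abs_tubeForm_sub_le he1 hq0 hG hb
  have hinner : ∀ G : Fin n → ℕ, (∑ i, e i * (gridVec A R G i : ℝ)) =
      inner ℝ e (ratPoint (gridVec A R G)) := fun G => by rw [inner_eq_sum]; rfl
  have hbound : ∀ G : Fin n → ℕ, (∀ i, |(gridVec A R G i : ℝ) - z i| ≤ 1) →
      ∀ i, |(gridVec A R G i : ℝ)| ≤ A := fun G hG i => by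
    have h1 := abs_le.1 (hG i)
    have h2 := neg_abs_le (z i)
    have h3 := le_abs_self (z i)
    have := hA i
    rw [abs_le]
    constructor <;> linarith
  have hy : ∀ (G : Fin n → ℕ) i, (G i : ℝ) / 2 ^ R = (gridVec A R G i : ℝ) + A := fun G i => by
    rw [gridVec]
    push_cast
    ring
  have hE2 : ∀ i, (dirDigits e R i : ℝ) ≤ 2 ^ R * 2 := fun i => by
    have h1 := abs_le.1 (he1 i)
    have : (dirDigits e R i : ℝ) ≤ 2 ^ R * (e i + 1) :=
      Nat.floor_le (mul_nonneg hP.le (by linarith))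
    exact this.trans (mul_le_mul_of_nonneg_left (by linarith) hP.le)
  have hs : 2 ^ R * ((2 * A₁ + 2 * (n * A) + 2 : ℕ) : ℝ) <
      ((2 ^ (R + (2 * A₁ + 2 * (n * A) + 2)) : ℕ) : ℝ) := by
    push_cast
    rw [pow_add _ R]
    refine mul_lt_mul_of_pos_left ?_ hP
    have h : ((2 * A₁ + 2 * (n * A) + 2 : ℕ) : ℝ) < ((2 ^ (2 * A₁ + 2 * (n * A) + 2) : ℕ) : ℝ) :=
      Nat.cast_lt.2 Nat.lt_two_pow_self
    exact_mod_cast h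
  refine ⟨fun p hp hr => ?_, fun G hG => ?_, fun i => ?_, ?_⟩
  · set G : Fin n → ℕ := fun i => ⌊2 ^ R * (p i + A)⌋₊ with hGdef
    have hr2 : (1 : ℝ) / 2 ^ r ≤ 1 / 4 * (1 / 2 ^ (n + 3)) := by
      have : (2 : ℝ) ^ (n + 5) ≤ 2 ^ r := pow_le_pow_right₀ (by norm_num) hr
      have h5 : (1 : ℝ) / 4 * (1 / 2 ^ (n + 3)) = 1 / 2 ^ (n + 5) := by
        rw [pow_add, pow_add]
        field_simp
        norm_num
      rw [h5]
      exact one_div_le_one_div_of_le (by positivity) this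
    have hpz := abs_sub_le_of_mem_ball hp
    have hxp : ∀ i, |(gridVec A R G i : ℝ) - p i| ≤ 1 / 2 ^ R := fun i =>
      abs_gridVec_floor_sub_le R (by
        have h1 := abs_le.1 (hpz i)
        have := hzA i
        linarith)
    have hRr : (1 : ℝ) / 2 ^ R ≤ 1 / 2 ^ r :=
      one_div_le_one_div_of_le (by positivity) (pow_le_pow_right₀ (by norm_num) (by omega))
    have hxz : ∀ i, |(gridVec A R G i : ℝ) - z i| ≤ 2 * (1 / 2 ^ r) := fun i => by
      have h1 := abs_sub_le (gridVec A R G i : ℝ) (p i) (z i)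
      have h2 := hxp i
      have h3 := hpz i
      linarith
    rw [cast_inTube_iff]
    refine ⟨fun i => ?_, ?_⟩
    · have h1 := abs_le.1 ((hxz i).trans (mul_le_mul_of_nonneg_left hr2 zero_le_two))
      have h2 := hlo1 i
      have h3 := hlo2 i
      rw [hy]
      have h5 : (2 : ℝ) * (1 / 4 * (1 / 2 ^ (n + 3))) * 2 ^ (n + 3) = 1 / 2 := by
        field_simp
        norm_num
      have h6 : 2 ^ (n + 3) * (gridVec A R G i - z i : ℝ) ≤ 1 / 2 := by
        have := mul_le_mul_of_nonneg_left h1.2 hcpos.le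
        linarith
      have h7 : -(1 / 2) ≤ 2 ^ (n + 3) * (gridVec A R G i - z i : ℝ) := by
        have := mul_le_mul_of_nonneg_left h1.1 hcpos.le
        linarith
      constructor <;> linarith
    · have h1 := hform G (hbound G fun i => (hxz i).trans (by
        have : (1 : ℝ) / 2 ^ (n + 3) ≤ 1 := by
          rw [div_le_one hcpos]
          exact one_le_pow₀ (by norm_num)
        linarith))
      rw [hinner] at h1
      have h2 : |inner ℝ e (ratPoint (gridVec A R G)) - (q : ℝ)| ≤
          (n + 2 * 2 ^ n) / 2 ^ R := by
        have e1 : inner ℝ e (ratPoint (gridVec A R G)) - (q : ℝ) =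
            inner ℝ e (ratPoint (gridVec A R G) - ratPoint p) + inner ℝ e (ratPoint p - z) +
              (inner ℝ e z - (q : ℝ)) := by
          rw [inner_sub_right, inner_sub_right]
          ring
        have h3 : |inner ℝ e (ratPoint (gridVec A R G) - ratPoint p)| ≤ n * (1 / 2 ^ R) :=
          abs_inner_le_of_forall_abs_le he fun i => hxp i
        have h5 : |inner ℝ e (ratPoint p - z)| ≤ 1 / 2 ^ r := by
          have := abs_real_inner_le_norm e (ratPoint p - z)
          rw [he, one_mul] at this
          rw [Metric.mem_ball, dist_eq_norm, zpow_neg, zpow_natCast] at hp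
          rw [one_div]
          exact this.trans hp.le
        rw [e1]
        refine (abs_add_three _ _ _).trans ?_
        rw [abs_sub_comm (inner ℝ e z)]
        have e2 : ((n : ℝ) + 2 * 2 ^ n) / 2 ^ R = n * (1 / 2 ^ R) + 2 * (2 ^ n / 2 ^ R) := by
          ring
        rw [e2, ← hPr]
        linarith [hq.le]
      have h3 : |4 ^ R * (inner ℝ e (ratPoint (gridVec A R G)) - (q : ℝ))| ≤
          2 ^ R * (n + 2 * 2 ^ n) := by
        rw [abs_mul, abs_of_pos (by positivity : (0 : ℝ) < 4 ^ R), h4, mul_assoc]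
        refine mul_le_mul_of_nonneg_left ?_ hP.le
        rwa [le_div_iff₀ hP, mul_comm] at h2
      have h5 := abs_le.1 h1
      have h6 := abs_le.1 h3
      rw [abs_le]
      push_cast at h5 ⊢
      constructor <;> linarith
  · rw [cast_inTube_iff] at hG
    obtain ⟨hbox, hlin⟩ := hG
    have hxz : ∀ i, |(gridVec A R G i : ℝ) - z i| ≤ 3 / 2 * (1 / 2 ^ (n + 3)) := fun i => by
      obtain ⟨h1, h2⟩ := hbox i
      rw [hy] at h1 h2
      have h3 := hlo1 i
      have h5 := hlo2 i
      rw [mul_one_div, le_div_iff₀ hcpos, ← abs_of_pos hcpos, ← abs_mul, abs_le]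
      constructor <;> linarith
    have h1 := hform G (hbound G fun i => (hxz i).trans (by
        have : (1 : ℝ) / 2 ^ (n + 3) ≤ 1 / 8 := by
          rw [hc8]
          exact one_div_le_one_div_of_le (by norm_num) (by linarith)
        linarith))
    rw [hinner] at h1
    constructor
    · refine (norm_le_of_forall_abs_le (x := ratPoint (gridVec A R G) - z) hxz).trans_lt ?_
      rw [hc8]
      have : (n : ℝ) * (3 / 2 * (1 / (8 * 2 ^ n))) = (n / 2 ^ n) * (3 / 16) := by ring
      rw [this]
      have : (n : ℝ) / 2 ^ n < 1 := by rwa [div_lt_one (by positivity)]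
      linarith
    · have h3 : |4 ^ R * (inner ℝ e (ratPoint (gridVec A R G)) - (q : ℝ))| ≤
          2 ^ R * ((n * A + 1 + n + 2 * 2 ^ n) + (n * A + 1)) := by
        have h5 := abs_le.1 h1
        have h6 := abs_le.1 hlin
        rw [abs_le]
        push_cast at h5 h6 ⊢
        constructor <;> linarith
      rw [abs_mul, abs_of_pos (by positivity : (0 : ℝ) < 4 ^ R), h4, mul_assoc] at h3
      have h5 := le_of_mul_le_mul_left h3 hP
      rw [mul_comm, ← le_div_iff₀ hP] at h5
      have e1 : inner ℝ e (ratPoint (gridVec A R G) - z) =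
          (inner ℝ e (ratPoint (gridVec A R G)) - (q : ℝ)) + ((q : ℝ) - inner ℝ e z) := by
        rw [inner_sub_right]
        ring
      rw [e1]
      refine (abs_add_le _ _).trans ?_
      push_cast
      rw [add_div]
      rw [hPr] at hq
      linarith [hq.le]
  · exact_mod_cast (hE2 i).trans_lt ((mul_le_mul_of_nonneg_left (by
      push_cast
      have : (0 : ℝ) ≤ 2 * A₁ + 2 * (n * A) := by positivity
      linarith) hP.le).trans_lt hs)
  · refine Nat.cast_lt (α := ℝ).1 (lt_of_le_of_lt ?_ hs)
    have hf : ((⌊(2 : ℚ) ^ R * (q + A₁)⌋₊ : ℕ) : ℝ) ≤ 2 ^ R * (q + A₁) := by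
      have hq' : (0 : ℚ) ≤ q + A₁ := by exact_mod_cast hq0
      have : (⌊(2 : ℚ) ^ R * (q + A₁)⌋₊ : ℚ) ≤ 2 ^ R * (q + A₁) := Nat.floor_le (by positivity)
      exact_mod_cast this
    have hS : ∑ i, (dirDigits e R i : ℝ) ≤ n * (2 ^ R * 2) := by
      refine (Finset.sum_le_sum fun i _ => hE2 i).trans ?_
      rw [Finset.sum_const, Finset.card_univ, Fintype.card_fin, nsmul_eq_mul]
    rw [hb]
    push_cast
    have h1 := mul_le_mul_of_nonneg_left hS (Nat.cast_nonneg (α := ℝ) A)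
    have h2 := mul_le_mul_of_nonneg_left hqA hP.le
    nlinarith

end Geometry

/-! ### Points on a slice and the size of a tube. -/

theorem size_mul_le (a b : ℕ) : Nat.size (a * b) ≤ Nat.size a + Nat.size b := by
  rw [Nat.size_le, pow_add]
  exact Nat.mul_lt_mul'' (Nat.lt_size_self a) (Nat.lt_size_self b)

theorem one_le_size {r : ℕ} (hr : 1 ≤ r) : 1 ≤ Nat.size r := Nat.size_pos.2 hr

theorem size_le_of_le_mul {c r N : ℕ} (hr : 1 ≤ r) (h : N ≤ c * r) :
    Nat.size N ≤ (Nat.size c + 1) * Nat.size r := by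
  have h1 := (Nat.size_le_size h).trans (size_mul_le c r)
  have h2 := one_le_size hr
  nlinarith

section Slices

variable {n : ℕ}

theorem exists_abs_apply_ge {e : EuclideanSpace ℝ (Fin n)} (he : ‖e‖ = 1) :
    ∃ i, 1 ≤ n * |e i| := by
  rcases Nat.eq_zero_or_pos n with rfl | hn
  · have : e = 0 := Subsingleton.elim _ _
    simp [this] at he
  obtain ⟨i, -, hi⟩ := Finset.exists_max_image Finset.univ (fun i => |e i|)
    ⟨(⟨0, hn⟩ : Fin n), Finset.mem_univ _⟩
  exact ⟨i, he ▸ norm_le_of_forall_abs_le fun j => hi j (Finset.mem_univ j)⟩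

theorem exists_unit_orthogonal (hn : 2 ≤ n) (e : EuclideanSpace ℝ (Fin n)) :
    ∃ v : EuclideanSpace ℝ (Fin n), ‖v‖ = 1 ∧ inner ℝ e v = 0 := by
  obtain ⟨u, hu, hu0⟩ : ∃ u ∈ (Submodule.span ℝ {e})ᗮ, u ≠ 0 := by
    refine Submodule.exists_mem_ne_zero_of_ne_bot fun h => ?_
    have h1 := Submodule.finrank_add_finrank_orthogonal (Submodule.span ℝ {e})
    rw [h, finrank_bot, finrank_euclideanSpace_fin] at h1
    have h2 := finrank_span_le_card (R := ℝ) ({e} : Set (EuclideanSpace ℝ (Fin n)))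
    simp at h2
    omega
  refine ⟨(‖u‖⁻¹ : ℝ) • u, ?_, ?_⟩
  · rw [norm_smul, norm_inv, norm_norm, inv_mul_cancel₀ (norm_ne_zero_iff.2 hu0)]
  · rw [inner_smul_right, Submodule.mem_orthogonal_singleton_iff_inner_right.1 hu, mul_zero]

/-- A point near `z` can be moved into the slice through `z` orthogonal to `e`, and away from
`z`. -/
theorem exists_mem_slice_near (hn : 2 ≤ n) {e : EuclideanSpace ℝ (Fin n)} (he : ‖e‖ = 1)
    (z : EuclideanSpace ℝ (Fin n)) {x : EuclideanSpace ℝ (Fin n)} {d : ℝ} (hd : 0 < d)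
    (hd' : d ≤ 1 / 4) (hx : ‖x - z‖ < 1 / 4) :
    ∃ w : EuclideanSpace ℝ (Fin n), inner ℝ e w = inner ℝ e z ∧ d ≤ ‖w - z‖ ∧ ‖w - z‖ < 1 ∧
      ‖x - w‖ ≤ |inner ℝ e (x - z)| + 2 * d := by
  have hee : inner ℝ e e = (1 : ℝ) := by rw [real_inner_self_eq_norm_sq, he, one_pow]
  set s : ℝ := inner ℝ e (x - z) with hs
  have hsn : |s| ≤ ‖x - z‖ := by
    have := abs_real_inner_le_norm e (x - z)
    rwa [he, one_mul] at this
  have hy1 : inner ℝ e (x - s • e) = inner ℝ e z := by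
    rw [inner_sub_right, inner_smul_right, hee, hs, inner_sub_right]
    ring
  have hxy : ‖x - (x - s • e)‖ = |s| := by
    rw [sub_sub_cancel, norm_smul, he, mul_one, Real.norm_eq_abs]
  have hyz : ‖(x - s • e) - z‖ < 1 / 2 := by
    have h1 := norm_sub_le (x - z) (s • e)
    rw [norm_smul, he, mul_one, Real.norm_eq_abs] at h1
    rw [sub_right_comm]
    linarith
  -- The point is first projected to the slice along e. If the projection is closer than d to z, a
  -- step of length 2d within the slice takes it away; this needs a vector orthogonal to e, hence n
  -- ≥ 2.
  by_cases h : d ≤ ‖(x - s • e) - z‖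
  · exact ⟨x - s • e, hy1, h, by linarith, by linarith⟩
  · obtain ⟨v, hv, hev⟩ := exists_unit_orthogonal hn e
    have h2v : ‖(2 * d) • v‖ = 2 * d := by
      rw [norm_smul, hv, mul_one, Real.norm_eq_abs, abs_of_pos (by linarith)]
    push Not at h
    refine ⟨(x - s • e) + (2 * d) • v, ?_, ?_, ?_, ?_⟩
    · rw [inner_add_right, hy1, inner_smul_right, hev, mul_zero, add_zero]
    · have h1 := norm_sub_norm_le ((2 * d) • v) (-((x - s • e) - z))
      rw [norm_neg, h2v, sub_neg_eq_add] at h1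
      have e1 : (x - s • e) + (2 * d) • v - z = (2 * d) • v + ((x - s • e) - z) := by abel
      rw [e1]
      linarith
    · have h1 := norm_add_le ((2 * d) • v) ((x - s • e) - z)
      have e1 : (x - s • e) + (2 * d) • v - z = (2 * d) • v + ((x - s • e) - z) := by abel
      rw [e1]
      linarith
    · have h1 := norm_sub_le (x - (x - s • e)) ((2 * d) • v)
      rw [← sub_sub]
      linarith

/-- Some coordinate of e has modulus at least 1/n. Once the other coordinates of a point of the tube
are fixed, the corresponding index varies by at most 2nκ, so its residue modulo 2nκ + 1 determines
it. -/
theorem card_tube_le {e z : EuclideanSpace ℝ (Fin n)} (he : ‖e‖ = 1) {A R κ K : ℕ}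
    {S : Finset (Fin n → ℕ)} (hbox : ∀ G ∈ S, ∀ i, G i < K * 2 ^ R)
    (hS : ∀ G ∈ S, |inner ℝ e (ratPoint (gridVec A R G) - z)| ≤ κ / 2 ^ R) :
    S.card ≤ (2 * n * κ + 1) * (K * 2 ^ R) ^ (n - 1) := by
  obtain ⟨i₀, hi₀⟩ := exists_abs_apply_ge he
  have hP : (0 : ℝ) < 2 ^ R := by positivity
  set Q := 2 * n * κ + 1 with hQ
  have hmaps : ∀ G ∈ S, Function.update G i₀ (G i₀ % Q) ∈
      Fintype.piFinset (Function.update (fun _ : Fin n => Finset.range (K * 2 ^ R)) i₀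
        (Finset.range Q)) := by
    intro G hG
    rw [Fintype.mem_piFinset]
    intro j
    by_cases hj : j = i₀
    · subst hj
      simp only [Function.update_self, Finset.mem_range]
      exact Nat.mod_lt _ (by omega)
    · simp only [Function.update_of_ne hj, Finset.mem_range]
      exact hbox G hG j
  have hinj : Set.InjOn (fun G : Fin n → ℕ => Function.update G i₀ (G i₀ % Q)) S := by
    intro G hG G' hG' h
    have hne : ∀ j, j ≠ i₀ → G j = G' j := fun j hj => by
      have := congrFun h j
      simpa only [Function.update_of_ne hj] using this
    have hmod : G i₀ % Q = G' i₀ % Q := by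
      have := congrFun h i₀
      simpa only [Function.update_self] using this
    have h1 : inner ℝ e (ratPoint (gridVec A R G) - z) -
        inner ℝ e (ratPoint (gridVec A R G') - z) = e i₀ * (((G i₀ : ℝ) - G' i₀) / 2 ^ R) := by
      rw [← inner_sub_right, inner_eq_sum, Finset.sum_eq_single i₀]
      · simp only [PiLp.sub_apply, ratPoint, gridVec]
        push_cast
        ring
      · intro j _ hj
        simp [ratPoint, gridVec, hne j hj]
      · simp
    have h2 : |e i₀| * |(G i₀ : ℝ) - G' i₀| ≤ 2 * κ := by
      have h3 := abs_sub (inner ℝ e (ratPoint (gridVec A R G) - z))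
        (inner ℝ e (ratPoint (gridVec A R G') - z))
      rw [h1, abs_mul, abs_div, abs_of_pos hP] at h3
      have h4 := h3.trans (add_le_add (hS G hG) (hS G' hG'))
      rw [← mul_div_assoc, ← add_div, div_le_div_iff_of_pos_right hP] at h4
      linarith
    have h3 : |(G i₀ : ℝ) - G' i₀| ≤ 2 * n * κ := by
      have h0 := abs_nonneg ((G i₀ : ℝ) - G' i₀)
      calc |(G i₀ : ℝ) - G' i₀| ≤ (n * |e i₀|) * |(G i₀ : ℝ) - G' i₀| :=
            le_mul_of_one_le_left h0 hi₀
        _ = n * (|e i₀| * |(G i₀ : ℝ) - G' i₀|) := by ring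
        _ ≤ n * (2 * κ) := mul_le_mul_of_nonneg_left h2 (Nat.cast_nonneg n)
        _ = 2 * n * κ := by ring
    have h4 : |(G i₀ : ℤ) - G' i₀| < Q := by
      have : |(G i₀ : ℤ) - G' i₀| ≤ ((2 * n * κ : ℕ) : ℤ) := by
        have h5 : ((|(G i₀ : ℤ) - G' i₀| : ℤ) : ℝ) ≤ (((2 * n * κ : ℕ) : ℤ) : ℝ) := by
          push_cast
          exact h3
        exact_mod_cast h5
      rw [hQ]
      push_cast at this ⊢
      linarith
    have h5 : G i₀ = G' i₀ := by
      have h6 : (Q : ℤ) ∣ (G i₀ : ℤ) - G' i₀ :=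
        (Nat.modEq_iff_dvd.1 (Nat.ModEq.symm hmod))
      have h7 := Int.eq_zero_of_abs_lt_dvd h6 h4
      omega
    funext j
    by_cases hj : j = i₀
    · rw [hj, h5]
    · exact hne j hj
  refine (Finset.card_le_card_of_injOn _ hmaps hinj).trans ?_
  rw [Fintype.card_piFinset]
  have h : ∀ j, (Function.update (fun _ : Fin n => Finset.range (K * 2 ^ R)) i₀
      (Finset.range Q) j).card = Function.update (fun _ : Fin n => K * 2 ^ R) i₀ Q j := fun j => by
    by_cases hj : j = i₀
    · subst hj
      simp
    · simp [Function.update_of_ne hj]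
  simp only [h]
  rw [Finset.prod_update_of_mem (Finset.mem_univ _), Finset.prod_const,
    Finset.sdiff_singleton_eq_erase, Finset.card_erase_of_mem (Finset.mem_univ _),
    Finset.card_univ, Fintype.card_fin]

end Slices

section Slices

variable {U : OracleMachine} {n : ℕ}

/-- A point of the grid of mesh `2 ^ (-c)` can be moved along a coordinate axis into the slice
through `u` orthogonal to `e`. -/
theorem exists_mem_slice_axis {e : EuclideanSpace ℝ (Fin n)} (he : ‖e‖ = 1)
    {u : EuclideanSpace ℝ (Fin n)} {A c : ℕ} (hu : ∀ i, 0 ≤ u i + A) :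
    ∃ (i₀ : Fin n) (w : EuclideanSpace ℝ (Fin n)), inner ℝ e w = inner ℝ e u ∧
      (∀ j, j ≠ i₀ → w j = gridVec A c (gridIndex A c u) j) ∧ ‖w - u‖ ≤ 2 * n ^ 2 / 2 ^ c := by
  obtain ⟨i₀, hi₀⟩ := exists_abs_apply_ge he
  have hn : (1 : ℝ) ≤ n := by exact_mod_cast (Fin.pos i₀)
  have hei : 0 < |e i₀| := by
    by_contra h
    have : |e i₀| = 0 := le_antisymm (not_lt.1 h) (abs_nonneg _)
    rw [this, mul_zero] at hi₀
    linarith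
  set x : EuclideanSpace ℝ (Fin n) := ratPoint (gridVec A c (gridIndex A c u)) with hx
  have hxu : ∀ i, |(x - u) i| ≤ 1 / 2 ^ c := fun i => abs_gridVec_gridIndex_sub_le c (hu i)
  set s : ℝ := inner ℝ e (x - u) with hs
  have hsn : |s| ≤ n * (1 / 2 ^ c) := abs_inner_le_of_forall_abs_le he hxu
  -- Division by the large coordinate of e enlarges the correction by at most a factor n.
  set v : EuclideanSpace ℝ (Fin n) := EuclideanSpace.single i₀ (s / e i₀) with hv
  have hev : inner ℝ e v = s := by
    rw [hv, EuclideanSpace.inner_single_right]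
    simp only [conj_trivial]
    exact div_mul_cancel₀ s (abs_pos.1 hei)
  refine ⟨i₀, x - v, ?_, fun j hj => ?_, ?_⟩
  · rw [inner_sub_right, hev, hs, inner_sub_right]
    ring
  · rw [PiLp.sub_apply, hv]
    simp [hj, hx, ratPoint]
  · have h1 : ‖v‖ ≤ n ^ 2 / 2 ^ c := by
      rw [hv, PiLp.norm_single, Real.norm_eq_abs, abs_div, div_le_iff₀ hei]
      refine hsn.trans ?_
      have h3 : (n : ℝ) ^ 2 / 2 ^ c * |e i₀| = n * (1 / 2 ^ c) * (n * |e i₀|) := by ring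
      rw [h3]
      exact le_mul_of_one_le_right (by positivity) hi₀
    have h2 : ‖x - u‖ ≤ n ^ 2 / 2 ^ c := by
      refine (norm_le_of_forall_abs_le hxu).trans ?_
      rw [mul_one_div]
      refine div_le_div_of_nonneg_right ?_ (by positivity)
      nlinarith
    have h3 := norm_sub_le (x - u) v
    rw [sub_right_comm, mul_div_assoc]
    linarith

/-- Every slice through `z` contains a point at a distance of the order of `1` from `z` that has a
simple approximation. -/
theorem OracleMachine.IsUniversal.exists_simple_mem_slice (hU : U.IsUniversal) (hn : 2 ≤ n)
    (z : EuclideanSpace ℝ (Fin n)) :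
    ∃ C r₀ : ℕ, ∀ (B : Set ℕ) (e : EuclideanSpace ℝ (Fin n)) (r : ℕ), ‖e‖ = 1 → r₀ ≤ r →
      ∃ w : EuclideanSpace ℝ (Fin n), inner ℝ e w = inner ℝ e z ∧ 1 / 2 ≤ ‖w - z‖ ∧ ‖w - z‖ < 1 ∧
        pointK U B r w ≤ r + C * Nat.size r := by
  obtain ⟨A, hA⟩ := exists_offset z 1
  obtain ⟨C, hC⟩ := hU.exists_ratVecK_gridVec_le_of_axis A n (2 * n + 3) (2 ^ (2 * n + 3) * (2 * A))
  refine ⟨C + n + (2 * A + 1) + 16 * ((Nat.size (1 + n) + 1) +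
    (Nat.size (1 + n + 2 * A + 1) + 1)), 2 * n + 3, fun B e r he hr => ?_⟩
  obtain ⟨v, hv, hev⟩ := exists_unit_orthogonal hn e
  -- The target lies in the slice at distance 3/4. The adjustment below is at most 2n² / 2^(2n+3) <
  -- 1/4, so the distance stays strictly between 1/2 and 1.
  set u := z + (3 / 4 : ℝ) • v with hu
  have huz : ‖u - z‖ = 3 / 4 := by
    rw [hu, add_sub_cancel_left, norm_smul, hv, mul_one, Real.norm_eq_abs]
    norm_num
  have hui : ∀ i, |u i| ≤ A := fun i => by
    have h1 := abs_apply_le_norm (u - z) i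
    rw [huz] at h1
    have h2 := abs_add_le (z i) ((u - z) i)
    have e1 : z i + (u - z) i = u i := by simp
    rw [e1] at h2
    have := hA i
    linarith
  have hu0 : ∀ i, 0 ≤ u i + A := fun i => by
    have := (abs_le.1 (hui i)).1
    linarith
  obtain ⟨i₀, w, hew, hw, hwu⟩ := exists_mem_slice_axis (c := 2 * n + 3) he hu0
  have hwu' : ‖w - u‖ < 1 / 4 := by
    refine hwu.trans_lt ?_
    have h2n : (n : ℝ) < 2 ^ n := by exact_mod_cast Nat.lt_two_pow_self
    have h3 : (n : ℝ) ^ 2 < (2 ^ n) ^ 2 := pow_lt_pow_left₀ h2n (Nat.cast_nonneg n) (by norm_num)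
    rw [div_lt_iff₀ (by positivity), pow_add, mul_comm 2 n, pow_mul]
    linarith
  have hwz : |‖w - z‖ - 3 / 4| < 1 / 4 := by
    have h1 := abs_norm_sub_norm_le (w - z) (u - z)
    rw [sub_sub_sub_cancel_right, huz] at h1
    linarith
  have hwz' := abs_lt.1 hwz
  refine ⟨w, ?_, by linarith, by linarith, ?_⟩
  · rw [hew, hu, inner_add_right, inner_smul_right, hev, mul_zero, add_zero]
  have hwi : ∀ i, |w i - z i| ≤ 1 := fun i => by
    have h1 := abs_apply_le_norm (w - z) i
    rw [PiLp.sub_apply] at h1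
    linarith
  have hw0 : ∀ i, 0 ≤ w i + A := fun i => by
    have := (abs_le.1 (hwi i)).1
    have := neg_abs_le (z i)
    have := hA i
    linarith
  -- Points of the coarse grid have indices divisible by 2^R in the fine grid; only the coordinate
  -- `i₀` needs about r bits.
  set R := r + n - (2 * n + 3) with hR
  have hRr : R + (2 * n + 3) = r + n := by omega
  have hG : (gridVec A (r + n) fun j => if j = i₀ then gridIndex A (r + n) w j else
      gridIndex A (2 * n + 3) u j * 2 ^ R) =
      fun j => if j = i₀ then gridVec A (r + n) (gridIndex A (r + n) w) j else
        gridVec A (2 * n + 3) (gridIndex A (2 * n + 3) u) j := by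
    funext j
    by_cases hj : j = i₀
    · simp only [gridVec, if_pos hj]
    · simp only [gridVec, if_neg hj]
      rw [← hRr, pow_add]
      push_cast
      field_simp
  have hball : ratPoint (gridVec A (r + n) fun j => if j = i₀ then gridIndex A (r + n) w j else
      gridIndex A (2 * n + 3) u j * 2 ^ R) ∈ Metric.ball w ((2 : ℝ) ^ (-(r : ℤ))) := by
    refine ratPoint_mem_ball fun j => ?_
    rw [hG]
    by_cases hj : j = i₀
    · simp only [if_pos hj]
      exact abs_gridVec_gridIndex_sub_le _ (hw0 j)
    · simp only [if_neg hj]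
      rw [hw j hj, sub_self, abs_zero]
      positivity
  have hv0 : gridIndex A (r + n) w i₀ < 2 ^ (r + n + (2 * A + 1)) := by
    have h1 := gridIndex_le (r + n) (hw0 i₀)
    have h2 : w i₀ + A ≤ 2 * A := by
      have := (abs_le.1 (hwi i₀)).2
      have := le_abs_self (z i₀)
      have := hA i₀
      linarith
    have h3 : (2 * A : ℝ) < 2 ^ (2 * A + 1) := by
      have : 2 * A < 2 ^ (2 * A + 1) := by
        have := Nat.lt_two_pow_self (n := 2 * A + 1)
        omega
      exact_mod_cast this
    have h4 : (gridIndex A (r + n) w i₀ : ℝ) < 2 ^ (r + n + (2 * A + 1)) := by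
      rw [pow_add _ (r + n)]
      have hP : (0 : ℝ) < 2 ^ (r + n) := by positivity
      exact h1.trans_lt (mul_lt_mul_of_pos_left (h2.trans_lt h3) hP)
    exact_mod_cast h4
  have hg : ∀ j, gridIndex A (2 * n + 3) u j ≤ 2 ^ (2 * n + 3) * (2 * A) := fun j => by
    have h1 := gridIndex_le (2 * n + 3) (hu0 j)
    have h2 : u j + A ≤ 2 * A := by
      have := (abs_le.1 (hui j)).2
      linarith
    have h3 : (gridIndex A (2 * n + 3) u j : ℝ) ≤ 2 ^ (2 * n + 3) * (2 * A) :=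
      h1.trans (mul_le_mul_of_nonneg_left h2 (by positivity))
    exact_mod_cast h3
  have key := hC B R (r + n + (2 * A + 1)) i₀ (gridIndex A (2 * n + 3) u)
    (gridIndex A (r + n) w i₀) hg hv0
  have hGe : (fun j => if j = i₀ then gridIndex A (r + n) w i₀ else
      gridIndex A (2 * n + 3) u j * 2 ^ R) = fun j => if j = i₀ then gridIndex A (r + n) w j else
      gridIndex A (2 * n + 3) u j * 2 ^ R := by
    funext j
    by_cases hj : j = i₀
    · simp [hj]
    · simp [hj]
  rw [hRr, hGe] at key
  refine (pointK_le hball).trans (key.trans ?_)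
  have hr1 : 1 ≤ r := by omega
  have s1 : Nat.size R ≤ (Nat.size (1 + n) + 1) * Nat.size r := by
    refine size_le_of_le_mul hr1 ?_
    have : n * 1 ≤ n * r := Nat.mul_le_mul_left n hr1
    rw [add_mul]
    omega
  have s2 : Nat.size (r + n + (2 * A + 1)) ≤ (Nat.size (1 + n + 2 * A + 1) + 1) * Nat.size r := by
    refine size_le_of_le_mul hr1 ?_
    have : (n + 2 * A + 1) * 1 ≤ (n + 2 * A + 1) * r := Nat.mul_le_mul_left _ hr1
    linarith
  have s3 : (C + n + (2 * A + 1)) * 1 ≤ (C + n + (2 * A + 1)) * Nat.size r :=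
    Nat.mul_le_mul_left _ (one_le_size hr1)
  linarith

end Slices

/-! ### The loss of complexity under a projection. -/

section Tubes

variable {U : OracleMachine} {n : ℕ}

theorem size_le_self (N : ℕ) : Nat.size N ≤ N := Nat.size_le.2 Nat.lt_two_pow_self

theorem OracleMachine.IsUniversal.exists_pointK_le_mul (hU : U.IsUniversal)
    (z : EuclideanSpace ℝ (Fin n)) :
    ∃ C : ℕ, ∀ (B : Set ℕ) (r : ℕ), 1 ≤ r → pointK U B r z ≤ C * r := by
  obtain ⟨A, hA⟩ := exists_offset z 0
  obtain ⟨C, hC⟩ := hU.exists_ratVecK_gridVec_le_of_lt A n (2 * A + 1)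
  have hz0 : ∀ i, 0 ≤ z i + A := fun i => by
    have := neg_abs_le (z i)
    have := hA i
    linarith
  refine ⟨5 * (n * (n + 2 * A + 2)) + 4 * (n + 1) + C, fun B r hr => ?_⟩
  refine (pointK_le (ratPoint_mem_ball (p := gridVec A (r + n) (gridIndex A (r + n) z)) fun i =>
    abs_gridVec_gridIndex_sub_le _ (hz0 i))).trans ?_
  refine (hC B (r + n) (gridIndex A (r + n) z) fun i => ?_).trans ?_
  · have h1 := gridIndex_le (r + n) (hz0 i)
    have h2 : z i + A ≤ 2 * A := by
      have := le_abs_self (z i)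
      have := hA i
      linarith
    have h3 : (2 * A : ℝ) < 2 ^ (2 * A + 1) := by
      have : 2 * A < 2 ^ (2 * A + 1) := by
        have := Nat.lt_two_pow_self (n := 2 * A + 1)
        omega
      exact_mod_cast this
    have h4 : (gridIndex A (r + n) z i : ℝ) < 2 ^ (r + n + (2 * A + 1)) := by
      rw [pow_add _ (r + n)]
      have hP : (0 : ℝ) < 2 ^ (r + n) := by positivity
      exact h1.trans_lt (mul_lt_mul_of_pos_left (h2.trans_lt h3) hP)
    exact_mod_cast h4
  · have h1 := size_le_self (r + n)
    have h2 := size_le_self ((r + n + (2 * A + 1)) * n)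
    have h3 : (r + n + (2 * A + 1)) * n ≤ n * (n + 2 * A + 2) * r := by
      have : r + n + (2 * A + 1) ≤ (n + 2 * A + 2) * r := by nlinarith
      calc (r + n + (2 * A + 1)) * n ≤ (n + 2 * A + 2) * r * n := Nat.mul_le_mul_right n this
        _ = n * (n + 2 * A + 2) * r := by ring
    have h4 : r + n ≤ (n + 1) * r := by nlinarith
    have h5 : C ≤ C * r := Nat.le_mul_of_pos_right C hr
    linarith

theorem OracleMachine.IsUniversal.partrec_map_output (hU : U.IsUniversal) {α : Type*}
    [Primcodable α] {f : ℕ × List Bool → α} (hf : Primrec f) :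
    Partrec fun x : ℕ × List Bool => (U ∅ x.2 []).map fun σ => f (x.1, σ) := by
  have h1 : Computable fun y : (ℕ × List Bool) × List Bool => f (y.1.1, y.2) :=
    Primrec.to_comp (hf.comp (Primrec.pair (Primrec.fst.comp Primrec.fst) Primrec.snd))
  exact Partrec.map (hU.partrec.comp Computable.snd) h1.to₂

/-- The grid points next to rational points of bounded complexity can be enumerated. -/
theorem OracleMachine.IsUniversal.exists_gridIndex_enumeration (hU : U.IsUniversal) (A n : ℕ) :
    ∃ stage : ℕ × ℕ → ℕ → List (Fin n → ℕ), Primrec₂ stage ∧ (∀ x S, (stage x S).Nodup) ∧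
      (∀ x S T, S ≤ T → stage x S <:+ stage x T) ∧
      (∀ (R : ℕ) (p : Fin n → ℚ), ∃ S, (fun i => ⌊2 ^ R * (p i + A)⌋₊) ∈
        stage (ratVecK U ∅ p, R) S) ∧
      ∀ x S, (stage x S).length ≤ 2 ^ (x.1 + 1) := by
  have hV := hU.partrec_map_output (primrec_stringFloor A n)
  obtain ⟨stage, hst, hnd, hsuf, hcompl, hlen⟩ := exists_enumeration hV
  refine ⟨stage, hst, hnd, hsuf, fun R p => ?_, hlen⟩
  obtain ⟨π, hπ, h⟩ := hU.exists_shortest ∅ (ratVecString p)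
  refine hcompl _ R π _ hπ.le ((Part.mem_map_iff _).2 ⟨_, h, ?_⟩)
  funext i
  exact stringFloor_ratVecString A R p i

theorem exists_tube_index {R s b : ℕ} {E : Fin n → ℕ} (hE : ∀ i, E i < 2 ^ (R + s))
    (hb : b < 2 ^ (R + s)) (a w c : ℕ) (lo : Fin n → ℕ) :
    ∃ j < 2 ^ ((R + s) * (n + 1)),
      tubeMem a w c lo s R j = fun G => decide (InTube a w c lo R E b G) := by
  obtain ⟨j, hj, h⟩ := exists_digits (Q := 2 ^ (R + s)) (by positivity) (n + 1)
    (fun i => if h : i < n then E ⟨i, h⟩ else b) fun i _ => by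
      by_cases h : i < n
      · rw [dif_pos h]
        exact hE _
      · rwa [dif_neg h]
  refine ⟨j, by rwa [pow_mul], ?_⟩
  have h1 : (fun i : Fin n => digit (2 ^ (R + s)) j i) = E := by
    funext i
    rw [h i (by omega), dif_pos i.2]
  have h2 : digit (2 ^ (R + s)) j n = b := by
    rw [h n (by omega), dif_neg (lt_irrefl n)]
  funext G
  rw [tubeMem, h1, h2]

/-- Here x is the integer part of log(N / m). Later m is linear in r, so 2^x is N up to a polynomial
factor; if N < m there is nothing to gain from the selection. -/
theorem exists_pow_mul_le (N : ℕ) {m : ℕ} (hm : 0 < m) :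
    N ≤ 2 ^ Nat.size m ∨ ∃ x, 2 ^ x * m ≤ N ∧ N ≤ 2 ^ (x + 1 + Nat.size m) := by
  by_cases h : N < m
  · exact Or.inl (h.le.trans (Nat.lt_size_self m).le)
  · refine Or.inr ⟨Nat.log 2 (N / m), ?_, ?_⟩
    · have h1 : N / m ≠ 0 := (Nat.div_pos (not_lt.1 h) hm).ne'
      exact (Nat.mul_le_mul_right m (Nat.pow_log_le_self 2 h1)).trans (Nat.div_mul_le_self N m)
    · have h1 := Nat.lt_pow_succ_log_self (b := 2) (by norm_num) (N / m)
      rw [Nat.div_lt_iff_lt_mul hm] at h1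
      rw [pow_add]
      exact h1.le.trans (Nat.mul_le_mul_left _ (Nat.lt_size_self m).le)

/-- The loss of complexity under a projection is at most the logarithm of the number of
approximations of `z` that have the same projection. This number is at most `2 ^ ((n - 1) * r)`, up
to a polynomial factor, and if it is large then the slice through `z` contains a point that is
simpler than `z`. -/
theorem OracleMachine.IsUniversal.exists_projection_bounds (hU : U.IsUniversal)
    (z : EuclideanSpace ℝ (Fin n)) :
    ∃ C r₀ : ℕ, ∀ (B₀ : Set ℕ) (e : EuclideanSpace ℝ (Fin n)) (r : ℕ), ‖e‖ = 1 → r₀ ≤ r →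
      realK U (joinOracle B₀ (pointOracle e)) r (inner ℝ e z) ≤
        pointK U (joinOracle B₀ (pointOracle e)) r z →
      pointK U (joinOracle B₀ (pointOracle e)) r z ≤
        realK U (joinOracle B₀ (pointOracle e)) r (inner ℝ e z) + (n - 1) * r + C * Nat.size r ∧
      (2 ≤ n → pointK U (joinOracle B₀ (pointOracle e)) r z ≤
          realK U (joinOracle B₀ (pointOracle e)) r (inner ℝ e z) + C * Nat.size r ∨
        ∃ w : EuclideanSpace ℝ (Fin n), inner ℝ e w = inner ℝ e z ∧ 1 / 2 ^ r ≤ ‖w - z‖ ∧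
          ‖w - z‖ < 1 ∧ pointK U (joinOracle B₀ (pointOracle e)) r z + pointK U ∅ r w ≤
            realK U (joinOracle B₀ (pointOracle e)) r (inner ℝ e z) + pointK U ∅ r z +
              C * Nat.size r) := by
  obtain ⟨A, A₁, a, w, c, s, κ, lo, hA, htube⟩ := exists_tube_parameters z
  obtain ⟨stage, hst, hnd, hsuf, hstage, hlen⟩ := hU.exists_gridIndex_enumeration A n
  obtain ⟨T, hT⟩ := hU.exists_pointK_le_mul z
  obtain ⟨C₁, hC₁⟩ := hU.exists_ratVecK_le_of_inTube hst hsuf A A₁ (2 ^ n + 1 + 1) a w c lo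
  obtain ⟨C₂, hC₂⟩ := hU.exists_simple_of_many hst hsuf hlen A (κ + 2 * 2 ^ n + 1) a w c lo s
  obtain ⟨K, hK⟩ : ∃ K, ∀ i, lo i + 2 ≤ K :=
    ⟨∑ i, lo i + 2, fun i => Nat.add_le_add_right
      (Finset.single_le_sum (fun j _ => Nat.zero_le (lo j)) (Finset.mem_univ i)) 2⟩
  obtain ⟨Z, hZ⟩ : ∃ Z, Z = (2 * n * κ + 1) + (K + n) * (n - 1) := ⟨_, rfl⟩
  -- The product D · r bounds every number whose binary size appears below, so all these sizes are
  -- at most a constant times the size of r.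
  obtain ⟨D, hD⟩ : ∃ D, D = 2 * T + 2 + (n + 1) + (Z + (n - 1)) + ((1 + n + s) * (n + 1) + 3) :=
    ⟨_, rfl⟩
  have hsize : ∀ {r N : ℕ}, 1 ≤ r → N ≤ D * r → Nat.size N ≤ (Nat.size D + 1) * Nat.size r :=
    fun hr h => size_le_of_le_mul hr h
  -- Each of the two descriptions has a logarithmic overhead of 8 · (10 + 1) = 88 units, and the
  -- size of the factor `m₀` costs one more.
  refine ⟨177 * (Nat.size D + 1) + (C₁ + C₂ + 3 + Z), n + 5, fun B₀ e r he hr hle => ?_⟩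
  have hr1 : 1 ≤ r := by omega
  set B := joinOracle B₀ (pointOracle e) with hB
  have he1 : ∀ i, |e i| ≤ 1 := fun i => he ▸ abs_apply_le_norm e i
  obtain ⟨p, hp, hpk⟩ := exists_ratVecK_eq_pointK U ∅ r z
  obtain ⟨q, hq, hql⟩ := exists_ratVecK_eq_realK U B r (inner ℝ e z)
  obtain ⟨b, hb⟩ : ∃ b, b = ⌊(2 : ℚ) ^ (r + n) * (q + A₁)⌋₊ + A * ∑ i, dirDigits e (r + n) i :=
    ⟨_, rfl⟩
  obtain ⟨hin, hout, hdig, hbdig⟩ := htube e r q b he hq hb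
  obtain ⟨S, hS⟩ := hstage (r + n) p
  rw [hpk] at hS
  have hGin := hin p hp hr
  set l := realK U B r (inner ℝ e z) with hl
  set k := pointK U ∅ r z with hk
  set KB := pointK U B r z with hKB
  set N := (stage (k, r + n) S).countP
    (fun G => decide (InTube a w c lo (r + n) (dirDigits e (r + n)) b G)) with hN
  have hkT : k ≤ T * r := hT ∅ r hr1
  have hKT : KB ≤ T * r := hT B r hr1
  have hzA : ∀ i, 1 ≤ z i + A := fun i => by
    have := neg_abs_le (z i)
    have := hA i
    linarith
  have hPr : (1 : ℝ) / 2 ^ r = 2 ^ n / 2 ^ (r + n) := by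
    rw [pow_add]
    field_simp
  have hr4 : (1 : ℝ) / 2 ^ r ≤ 1 / 4 := by
    refine one_div_le_one_div_of_le (by norm_num) ?_
    calc (4 : ℝ) = 2 ^ 2 := by norm_num
      _ ≤ 2 ^ r := pow_le_pow_right₀ (by norm_num) (by omega)
  -- A description of z relative to the oracle: a program for q and the index among the N enumerated
  -- points of the tube.
  have hcost : ∀ m, N ≤ 2 ^ m → KB ≤ l + m +
      8 * (Nat.size (Nat.pair (r + n) (Nat.pair k l)) + Nat.size (l + m)) + C₁ := fun m hm => by
    refine pointK_le_of_near (A := A) (M := 2 ^ n + 1)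
      (G := fun i => ⌊(2 : ℚ) ^ (r + n) * (p i + A)⌋₊) (fun i => by linarith [hzA i])
      (fun i => ?_) fun p' q' hp' hq' => ?_
    · have h1 := abs_sub_le_of_mem_ball hp i
      have h2 := abs_gridVec_floor_sub_le (A := A) (r + n) (p := p) (i := i) (by
        have := (abs_le.1 h1).1
        have := hzA i
        linarith)
      refine (abs_sub_le _ (p i : ℝ) _).trans ?_
      rw [hPr] at h1
      push_cast
      rw [add_div]
      linarith
    · have := hC₁ B₀ e he1 q (r + n) k S m b _ hS hb hGin hm p' q' hp' hq'
      rwa [← hB, hql] at this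
  -- The list has no repetitions, so the count is the cardinality of a set of grid points in the
  -- tube.
  have hcount : N ≤ 2 ^ ((2 * n * κ + 1) + (K + (r + n)) * (n - 1)) := by
    have h1 := card_tube_le (z := z) he (A := A) (R := r + n) (κ := κ) (K := K)
      (S := ((stage (k, r + n) S).filter fun G =>
        decide (InTube a w c lo (r + n) (dirDigits e (r + n)) b G)).toFinset) ?_ ?_
    · rw [List.toFinset_card_of_nodup ((hnd _ _).filter _), ← List.countP_eq_length_filter,
        ← hN] at h1
      refine h1.trans ?_
      rw [pow_add _ (2 * n * κ + 1), pow_mul]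
      refine Nat.mul_le_mul Nat.lt_two_pow_self.le (Nat.pow_le_pow_left ?_ _)
      rw [pow_add _ K]
      exact Nat.mul_le_mul_right _ Nat.lt_two_pow_self.le
    · intro G hG i
      rw [List.mem_toFinset, List.mem_filter, decide_eq_true_eq] at hG
      have h2 := (hG.2.1 i).2
      have h3 : (lo i + 2) * 2 ^ (r + n) ≤ K * 2 ^ (r + n) := Nat.mul_le_mul_right _ (hK i)
      have h4 : G i ≤ G i * 2 ^ c := Nat.le_mul_of_pos_right _ (by positivity)
      omega
    · intro G hG
      rw [List.mem_toFinset, List.mem_filter, decide_eq_true_eq] at hG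
      exact (hout G hG.2).2
  have hsimple : 2 ≤ n → ∀ x m, 2 * 2 ^ ((r + n + s) * (n + 1)) < 2 ^ m → 2 ^ x * m ≤ N →
      x ≤ k + 2 ∧ ∃ w : EuclideanSpace ℝ (Fin n), inner ℝ e w = inner ℝ e z ∧
        1 / 2 ^ r ≤ ‖w - z‖ ∧ ‖w - z‖ < 1 ∧ pointK U ∅ r w ≤ (k + 2 - x) +
            8 * (Nat.size (Nat.pair (r + n) (Nat.pair k x)) + Nat.size (k + 2 - x)) + C₂ := by
    intro hn x m hm hx
    obtain ⟨j, hj, hjt⟩ := exists_tube_index hdig hbdig a w c lo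
    rw [hN, ← hjt] at hx
    obtain ⟨hxk, G, hG, hGK⟩ := hC₂ ∅ (r + n) k x S j m hj hm hx
    rw [hjt, decide_eq_true_eq] at hG
    obtain ⟨hG1, hG2⟩ := hout G hG
    obtain ⟨w', h1, h2, h3, h4⟩ := exists_mem_slice_near hn he z (d := 1 / 2 ^ r) (by positivity)
      hr4 hG1
    refine ⟨hxk, w', h1, h2, h3, pointK_le_of_near (A := A) (fun i => ?_) (fun i => ?_) hGK⟩
    · have h5 := abs_apply_le_norm (w' - z) i
      rw [PiLp.sub_apply] at h5
      have := (abs_le.1 h5).1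
      have := hzA i
      linarith
    · have h5 := abs_apply_le_norm (ratPoint (gridVec A (r + n) G) - w') i
      refine h5.trans (h4.trans ?_)
      push_cast
      rw [hPr, add_div, ← mul_div_assoc]
      linarith
  obtain ⟨E, hE⟩ : ∃ E, E = (Nat.size D + 1) * Nat.size r := ⟨_, rfl⟩
  have hsz : ∀ N ≤ D * r, Nat.size N ≤ E := fun N h => hE ▸ hsize hr1 h
  have hDr : 2 * (T * r) + 2 + (r + n) + (Z + (n - 1) * r) + ((r + n + s) * (n + 1) + 3) ≤
      D * r := by
    have d1 : n ≤ n * r := Nat.le_mul_of_pos_right n hr1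
    have d2 : Z ≤ Z * r := Nat.le_mul_of_pos_right Z hr1
    have d3 : (n + s) * (n + 1) ≤ (n + s) * (n + 1) * r := Nat.le_mul_of_pos_right _ hr1
    rw [hD]
    linarith
  -- There are 2^((r+n+s)(n+1)) tubes; the summand 2 makes 2^m₀ larger than twice that number.
  obtain ⟨m₀, hm₀⟩ : ∃ m₀, m₀ = (r + n + s) * (n + 1) + 2 := ⟨_, rfl⟩
  obtain ⟨W, hW⟩ : ∃ W, W = (n - 1) * r := ⟨_, rfl⟩
  have hm₀s := size_le_self m₀
  have sR := hsz (r + n) (by omega)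
  have sk := hsz k (by omega)
  have sl := hsz l (by omega)
  have sm := hsz m₀ (by omega)
  have hcost' : ∀ m, N ≤ 2 ^ m → l + m ≤ D * r → KB ≤ l + m + 88 * E + C₁ := fun m hm hlm => by
    have h1 := hcost m hm
    have h2 := hsz _ hlm
    have h3 := size_pair_le (r + n) (Nat.pair k l)
    have h4 := size_pair_le k l
    omega
  have hC : (177 * (Nat.size D + 1) + (C₁ + C₂ + 3 + Z)) * Nat.size r ≥
      177 * E + (C₁ + C₂ + 3 + Z) := by
    have h1 : (C₁ + C₂ + 3 + Z) ≤ (C₁ + C₂ + 3 + Z) * Nat.size r :=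
      Nat.le_mul_of_pos_right _ (one_le_size hr1)
    rw [hE]
    linarith
  refine ⟨?_, fun hn => ?_⟩
  · have h0 : (2 * n * κ + 1) + (K + (r + n)) * (n - 1) = Z + W := by
      rw [hZ, hW]
      ring
    rw [h0] at hcount
    have h1 := hcost' _ hcount (by omega)
    omega
  · rcases exists_pow_mul_le N (m := m₀) (by omega) with h | ⟨x, hx, hxN⟩
    · left
      have h1 := hcost' _ h (by omega)
      omega
    · right
      obtain ⟨hxk, w', h1, h2, h3, h4⟩ := hsimple hn x m₀ (by
        rw [hm₀, pow_add _ ((r + n + s) * (n + 1))]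
        have : 0 < 2 ^ ((r + n + s) * (n + 1)) := by positivity
        omega) hx
      refine ⟨w', h1, h2, h3, ?_⟩
      have h5 := hcost' _ hxN (by omega)
      have h6 := size_pair_le (r + n) (Nat.pair k x)
      have h7 := size_pair_le k x
      have h8 := hsz x (by omega)
      have h9 := hsz (k + 2 - x) (by omega)
      omega

end Tubes

/-! ### Combining the bounds, and the theorem. -/

theorem size_le_two_mul_logb {r : ℕ} (hr : 2 ≤ r) : (Nat.size r : ℝ) ≤ 2 * Real.logb 2 r := by
  have hr0 : (0 : ℝ) < r := by exact_mod_cast (by omega : 0 < r)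
  have h1 : (1 : ℝ) ≤ Real.logb 2 r := by
    rw [Real.le_logb_iff_rpow_le (by norm_num) hr0, Real.rpow_one]
    exact_mod_cast hr
  have h2 : 0 < Nat.size r := Nat.size_pos.2 (by omega)
  have h3 : ((Nat.size r - 1 : ℕ) : ℝ) ≤ Real.logb 2 r := by
    rw [Real.le_logb_iff_rpow_le (by norm_num) hr0, Real.rpow_natCast]
    have : 2 ^ (Nat.size r - 1) ≤ r := Nat.lt_size.1 (by omega)
    exact_mod_cast this
  rw [Nat.cast_sub h2] at h3
  push_cast at h3
  linarith

/-- The bounds for the loss of complexity `D` under a projection combine to a single one. -/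
theorem le_of_projection_bounds {n r δ ε η D E : ℝ} (hn : 2 ≤ n) (hr : 1 ≤ r) (hδ : 0 < δ)
    (hε : 0 < ε) (hη : 0 < η) (hE : 1 ≤ E) (h₁ : D ≤ (n - 1) * r + E) (h₂ : D ≤ 2 * ε * r + E)
    (h₃ : D ≤ (η + ε) * r + E) (h₄ : (η - ε) * r + (r - 1) * δ ≤ r + E) :
    D ≤ n * ε / δ * r + (n + 2) * E := by
  obtain ⟨u, hu⟩ : ∃ u, u = n / δ := ⟨_, rfl⟩
  have huδ : u * δ = n := by rw [hu, div_mul_cancel₀ _ hδ.ne']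
  have hu0 : 0 < u := by rw [hu]; positivity
  have e1 : n * ε / δ = u * ε := by rw [hu]; ring
  have hr0 : 0 < r := by linarith
  have hnE : n ≤ n * E := le_mul_of_one_le_right (by linarith) hE
  have hnE0 : E ≤ (n + 2) * E := le_mul_of_one_le_left (by linarith) (by linarith)
  rw [e1]
  -- For δ ≤ n/2 the bound 2εr is already good enough.
  rcases le_or_gt 2 u with h2u | h2u
  · have h5 : 2 * ε * r ≤ u * ε * r := by gcongr
    linarith
  -- For δ ≥ n, multiplying the fourth bound by n/δ gives (n - 1)r ≤ (nε/δ)r + n + E, and the first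
  -- bound finishes.
  rcases le_or_gt u 1 with hu1 | hu1
  · have h5 : r * δ - δ - r - E ≤ ε * r := by
      have : 0 < η * r := by positivity
      linarith
    have h6 := mul_le_mul_of_nonneg_left h5 hu0.le
    have h7 : u * (r * δ - δ - r - E) = n * r - n - u * r - u * E := by
      rw [← huδ]
      ring
    have h8 : u * r ≤ 1 * r := by gcongr
    have h9 : u * E ≤ 1 * E := by gcongr
    linarith
  · have hδn : δ ≤ n := by nlinarith
    rcases le_or_gt (n - 1) (u * ε) with h5 | h5
    · have h6 : (n - 1) * r ≤ u * ε * r := by gcongr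
      linarith
    -- For n/2 < δ < n and ε small, the third and fourth bounds add up to D ≤ (2ε - (δ - 1))r + δ +
    -- 2E, and this inequality is what remains. It follows from uε < n - 1 and (u - 1)(n - 2) ≥ 0.
    · have h6 : (2 - u) * ε ≤ δ - 1 := by
        have h7 : (2 - u) * (u * ε) ≤ (2 - u) * (n - 1) := by gcongr
        have h8 : (2 - u) * (n - 1) ≤ u * (δ - 1) := by
          have : 0 ≤ (u - 1) * (n - 2) := mul_nonneg (by linarith) (by linarith)
          rw [mul_sub u, huδ]
          linarith
        have h9 : u * ((2 - u) * ε) ≤ u * (δ - 1) := by linarith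
        exact le_of_mul_le_mul_left h9 hu0
      have h7 := mul_le_mul_of_nonneg_right h6 hr0.le
      linarith

end PointComplexity

theorem lemma5 (U : OracleMachine) (hU : U.IsUniversal)
    (n : ℕ) (z : EuclideanSpace ℝ (Fin n)) :
    ∃ C : ℝ, ∀ (e : EuclideanSpace ℝ (Fin n)) (r : ℕ) (δ : ℝ) (ε η : ℚ),
      e ∈ Metric.sphere (0 : EuclideanSpace ℝ (Fin n)) 1 →
      0 < δ → 0 < ε → 0 < η →
      Real.logb 2 (2 * ‖z‖ + 5) + 1 ≤ (r : ℝ) →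
      (pointK U ∅ r z : ℝ) ≤ ((η : ℝ) + ε) * r →
      (∀ w ∈ Metric.ball z 1, inner ℝ e w = inner ℝ e z →
        ∀ t : ℝ, w ≠ z → t = -Real.logb 2 ‖z - w‖ → t ∈ Set.Ioc (0 : ℝ) r →
          ((η : ℝ) - ε) * r + (r - t) * δ ≤ (pointK U ∅ r w : ℝ)) →
      ∀ A : Set ℕ,
        (pointK U (joinOracle A (pointOracle e)) r z : ℝ)
            - (n * (ε : ℝ) / δ) * r - ratK U ∅ ε - ratK U ∅ η - C * Real.logb 2 r
          ≤ (realK U (joinOracle A (pointOracle e)) r (inner ℝ e z) : ℝ) := by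
  obtain ⟨T, hT⟩ := hU.exists_pointK_le_mul z
  obtain ⟨C₁, hC₁⟩ := hU.exists_pointK_le_empty
  obtain ⟨C₂, r₁, hbounds⟩ := hU.exists_projection_bounds z
  obtain ⟨C₃, r₂, hsimple⟩ : ∃ C₃ r₂ : ℕ, 2 ≤ n → ∀ (e : EuclideanSpace ℝ (Fin n)) (r : ℕ),
      ‖e‖ = 1 → r₂ ≤ r → ∃ w : EuclideanSpace ℝ (Fin n), inner ℝ e w = inner ℝ e z ∧
        1 / 2 ≤ ‖w - z‖ ∧ ‖w - z‖ < 1 ∧ pointK U ∅ r w ≤ r + C₃ * Nat.size r := by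
    by_cases hn : 2 ≤ n
    · obtain ⟨C₃, r₂, h⟩ := hU.exists_simple_mem_slice hn z
      exact ⟨C₃, r₂, fun _ => h ∅⟩
    · exact ⟨0, 0, fun h => absurd h hn⟩
  -- The factor 2 converts the binary size of r into log r, and T · (r₁ + r₂) covers the precisions
  -- below the thresholds.
  refine ⟨2 * ((n + 2) * (T * (r₁ + r₂) + C₁ + C₂ + C₃ + 1)),
    fun e r δ ε η he hδ hε hη hr hk hw A => ?_⟩
  rw [mem_sphere_zero_iff_norm] at he
  obtain ⟨i, -⟩ := exists_abs_apply_ge he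
  have hn1 : 1 ≤ n := Fin.pos i
  have hε' : (0 : ℝ) < ε := by exact_mod_cast hε
  have hη' : (0 : ℝ) < η := by exact_mod_cast hη
  have hr3 : 2 ≤ r := by
    have h1 : (2 : ℝ) ≤ Real.logb 2 (2 * ‖z‖ + 5) := by
      rw [Real.le_logb_iff_rpow_le (by norm_num) (by positivity)]
      have := norm_nonneg z
      norm_num
      linarith
    have : (2 : ℝ) ≤ r := by linarith
    exact_mod_cast this
  have hrR : (2 : ℝ) ≤ r := by exact_mod_cast hr3
  set B := joinOracle A (pointOracle e) with hB
  set KB := pointK U B r z with hKB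
  set l := realK U B r (inner ℝ e z) with hl
  have hl0 : (0 : ℝ) ≤ l := Nat.cast_nonneg l
  have hs := size_le_two_mul_logb hr3
  have hs1 : (1 : ℝ) ≤ Nat.size r := by exact_mod_cast one_le_size (by omega : 1 ≤ r)
  have hKε : (0 : ℝ) ≤ ratK U ∅ ε := Nat.cast_nonneg _
  have hKη : (0 : ℝ) ≤ ratK U ∅ η := Nat.cast_nonneg _
  obtain ⟨E, hE⟩ : ∃ E : ℝ, E = (T * (r₁ + r₂) + C₁ + C₂ + C₃ + 1) * Nat.size r := ⟨_, rfl⟩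
  have hterm : ∀ {x : ℝ}, 0 ≤ x → x ≤ T * (r₁ + r₂) + C₁ + C₂ + C₃ + 1 →
      x * Nat.size r ≤ E := fun _ h2 => hE ▸ mul_le_mul_of_nonneg_right h2 (by linarith)
  have hTr : (0 : ℝ) ≤ T * (r₁ + r₂) := by positivity
  have hC₁0 : (0 : ℝ) ≤ C₁ := Nat.cast_nonneg _
  have hC₂0 : (0 : ℝ) ≤ C₂ := Nat.cast_nonneg _
  have hC₃0 : (0 : ℝ) ≤ C₃ := Nat.cast_nonneg _
  have hE1 : 1 ≤ E := by
    have := hterm (x := 1) (by linarith) (by linarith)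
    linarith
  have hu0 : 0 ≤ (n * (ε : ℝ) / δ) * r := by positivity
  have hnR : (1 : ℝ) ≤ n := by exact_mod_cast hn1
  have hEn : E ≤ (n + 2) * E := le_mul_of_one_le_left (by linarith) (by linarith)
  suffices h : (KB : ℝ) - l ≤ (n * (ε : ℝ) / δ) * r + (n + 2) * E by
    have h1 : (n + 2) * E ≤
        2 * ((n + 2) * (T * (r₁ + r₂) + C₁ + C₂ + C₃ + 1)) * Real.logb 2 r := by
      rw [hE]
      have h2 := mul_le_mul_of_nonneg_left hs
        (by positivity : (0 : ℝ) ≤ (n + 2) * (T * (r₁ + r₂) + C₁ + C₂ + C₃ + 1))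
      linarith
    linarith
  rcases lt_or_ge r (r₁ + r₂) with hlt | hge
  · have h1 : KB ≤ T * (r₁ + r₂) :=
      (hT B r (by omega)).trans (Nat.mul_le_mul_left T hlt.le)
    have h2 : (KB : ℝ) ≤ T * (r₁ + r₂) := by exact_mod_cast h1
    have h3 := hterm hTr (by linarith)
    have h4 : (T : ℝ) * (r₁ + r₂) ≤ T * (r₁ + r₂) * Nat.size r := le_mul_of_one_le_right hTr hs1
    linarith
  -- If the projection is the more complex of the two, nothing is lost. Otherwise its complexity is
  -- O(r) too, as the projection bounds require.
  rcases lt_or_ge KB l with hlt | hle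
  · have : (KB : ℝ) < l := by exact_mod_cast hlt
    linarith
  obtain ⟨hb₁, hb₂⟩ := hbounds A e r he (by omega) hle
  rw [← hB, ← hKB, ← hl] at hb₁ hb₂
  have hC₂E : (C₂ : ℝ) * Nat.size r ≤ E := hterm hC₂0 (by linarith)
  have hb₁' : (KB : ℝ) - l ≤ (n - 1) * r + E := by
    have h1 : (KB : ℝ) ≤ ((l + (n - 1) * r + C₂ * Nat.size r : ℕ) : ℝ) := by exact_mod_cast hb₁
    push_cast [Nat.cast_sub hn1] at h1
    linarith
  -- In dimension one the bound (n - 1)r vanishes and suffices.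
  rcases Nat.eq_or_lt_of_le hn1 with rfl | hn2
  · norm_num at hb₁' hu0 hEn ⊢
    linarith
  -- Condition (ii) in the form needed: distance at least 2^(-d) means t ≤ d. It is used with d = r,
  -- where the term in δ disappears, and with d = 1.
  have hlog : ∀ {w : EuclideanSpace ℝ (Fin n)} {d : ℕ}, 1 / 2 ^ d ≤ ‖w - z‖ → ‖w - z‖ < 1 →
      d ≤ r → inner ℝ e w = inner ℝ e z →
      ((η : ℝ) - ε) * r + (r - d) * δ ≤ (pointK U ∅ r w : ℝ) := fun {w d} h1 h2 h3 h4 => by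
    have hpos : 0 < ‖w - z‖ := lt_of_lt_of_le (by positivity) h1
    have h5 : -Real.logb 2 ‖z - w‖ ≤ d := by
      rw [neg_le, Real.le_logb_iff_rpow_le (by norm_num) (by rwa [norm_sub_rev]), norm_sub_rev,
        Real.rpow_neg (by norm_num), Real.rpow_natCast, ← one_div]
      exact h1
    have h6 : 0 < -Real.logb 2 ‖z - w‖ := by
      rw [norm_sub_rev]
      exact neg_pos.2 (Real.logb_neg (by norm_num) hpos h2)
    have h7 : (d : ℝ) ≤ r := by exact_mod_cast h3
    have h8 := hw w (by rwa [Metric.mem_ball, dist_eq_norm]) h4 _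
      (fun h => by simp [h] at hpos) rfl ⟨h6, h5.trans h7⟩
    have h9 : (r - d : ℝ) * δ ≤ (r - -Real.logb 2 ‖z - w‖) * δ := by gcongr
    linarith
  have hnR2 : (2 : ℝ) ≤ n := by exact_mod_cast hn2
  refine le_of_projection_bounds hnR2 (by linarith) hδ hε' hη' hE1 hb₁' ?_ ?_ ?_
  · rcases hb₂ hn2 with h | ⟨w, h1, h2, h3, h4⟩
    · have h1 : (KB : ℝ) ≤ ((l + C₂ * Nat.size r : ℕ) : ℝ) := by exact_mod_cast h
      push_cast at h1
      have : 0 ≤ 2 * (ε : ℝ) * r := by positivity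
      linarith
    · have h5 := hlog h2 h3 le_rfl h1
      have h6 : ((KB + pointK U ∅ r w : ℕ) : ℝ) ≤
          ((l + pointK U ∅ r z + C₂ * Nat.size r : ℕ) : ℝ) := by exact_mod_cast h4
      push_cast at h6
      linarith
  · have h1 : (KB : ℝ) ≤ ((pointK U ∅ r z + C₁ : ℕ) : ℝ) := by exact_mod_cast hC₁ B r n z
    push_cast at h1
    have h2 := hterm hC₁0 (by linarith)
    have h3 : (C₁ : ℝ) ≤ C₁ * Nat.size r := le_mul_of_one_le_right hC₁0 hs1
    linarith
  · obtain ⟨w, h1, h2, h3, h4⟩ := hsimple hn2 e r he (by omega)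
    have h5 := hlog (d := 1) (by simpa using h2) h3 (by omega) h1
    have h6 : (pointK U ∅ r w : ℝ) ≤ ((r + C₃ * Nat.size r : ℕ) : ℝ) := by exact_mod_cast h4
    push_cast at h5 h6
    have h7 := hterm hC₃0 (by linarith)
    linarith
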